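/- **Setting.** Fix $d\in\mathbb N$ and a probability distribution $\mathbb F$ on $\mathbb R^d$ with bounded support. A featured graph is a finite simple graph $G$ with a feature vector $H(v)\in\mathbb R^d$ at each node. Terms of the language $\mathrm{Agg}[\textsc{WMean},\textsc{RW}]$ are built from * the features $H(x)$ of a node variable, constants $c\in\mathbb R^d$, and the random walk embedding $\mathrm{rw}(x)\in\mathbb R^d$, whose $j$-th coordinate ($1\le j\le d$) measures the return to $x$ after $j$ steps: two versions are both in the language, the probability that the simple random walk started at $x$ is at $x$ after $j$ steps, and the proportion, among all walks of length $j$ from $x$, of those ending at $x$ (both are $0$ at an isolated node); * $f(\rho_1,\dots,\rho_r)$ for Lipschitz $f:(\mathbb R^{d})^r\to\mathbb R^d$; * global and local weighted means $\sum_v\rho(\bar x,v)\star h(\eta(\bar x,v))$ and $\sum_{v\in N(x_i)}\rho(\bar x,v)\star h(\eta(\bar x,v))$, where $h:\mathbb R^d\to(0,\infty)^d$ is Lipschitz on every compact set; their value is the coordinatewise quotient $\sum_v \rho\,h(\eta)\,/\sum_v h(\eta)$, with $v$ ranging over all nodes, respectively over the neighbours of $x_i$ (and the value is $0$ if there are none).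 The value of a term $\pi$ with free variables among $x_1,\dots,x_k$ at a $k$-tuple $\bar u$ of nodes is written $[\![\pi(\bar u)]\!]$. The graph type $\mathrm{type}(\bar u)$ records which pairs $u_i,u_j$ are adjacent. A $\wedge$-description $\psi(\bar u)$ is a finite (possibly empty) conjunction of statements $u_iEu_j$. A feature-type controller is a function $e$ of $k$ vectors of $\mathbb R^d$ and a type, with values in $\mathbb R^d$, that is Lipschitz in the vectors for each type. **Models.** For each $n$ a random graph on $n$ nodes is drawn from one of the following, and the node features are drawn i.i.d. from $\mathbb F$, independently of the graph. 1. Erdős–Rényi $\mathrm{ER}(n,p(n))$, where $p:\mathbb N\to[0,1]$ satisfies density ($p(n)\to\tilde p>0$), root growth ($p(n)=Kn^{-\beta}$ for all large $n$, with $K>0$, $0<\beta<1$), or logarithmic growth ($p(n)=K\log(n)/n$ for all large $n$, with $K>0$). 2. A stochastic block model with $m$ communities: the $n$ nodes are partitioned into communities of sizes $n_1(n),\dots,n_m(n)$, with $n_j(n)/n\to q_j$ for each $j$, and nodes of communities $i$ and $j$ are joined independently with probability $P_{ij}$, for a symmetric $P\in[0,1]^{m\times m}$. It is assumed that if $\sum_l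 q_lP_{lj}=0$ then $P_{ij}=0$ for all $i$ (this holds, for instance, if all $q_j>0$). In this model $\mathrm{type}(\bar u)$ also records the community of each $u_i$. **Theorem.** In each of these models, for every term $\pi$ with free variables among $x_1,\dots,x_k$, there is a feature-type controller $e_\pi$ such that for all $\epsilon,\delta,\theta>0$ and every $\wedge$-description $\psi$ in $k$ variables there is $N\in\mathbb N$ such that for all $n\ge N$, with probability at least $1-\theta$, out of all the $k$-tuples $\bar u$ of nodes satisfying $\psi$, at least a proportion $1-\delta$ satisfy $$\bigl\|e_\pi(H(\bar u),\mathrm{type}(\bar u))-[\![\pi(\bar u)]\!]\bigr\|<\epsilon .$$ -/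

import Mathlib

open MeasureTheory Filter Topology

/-- The feature space `ℝ^d` with its Euclidean norm. -/
abbrev Feat (d : ℕ) : Type := EuclideanSpace ℝ (Fin d)

/-- Terms of the language `Agg[WMean, RW]` over `d`-dimensional features whose free node variables
are among `x_0, …, x_{k-1}`. The two aggregation constructors bind the last variable `x_k` of
their two immediate subterms. -/
inductive AggTerm (d : ℕ) : ℕ → Type
  /-- the features `H(x_i)` -/
  | feature {k : ℕ} (i : Fin k) : AggTerm d k
  /-- the random walk embedding of `x_i`, by return probabilities of the simple random walk -/
  | rwProb {k : ℕ} (i : Fin k) : AggTerm d k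
  /-- the random walk embedding of `x_i`, by proportions of walks which return -/
  | rwCount {k : ℕ} (i : Fin k) : AggTerm d k
  /-- a constant -/
  | const {k : ℕ} (c : Feat d) : AggTerm d k
  /-- a Lipschitz function applied to terms -/
  | app {k r : ℕ} (f : (Fin r → Feat d) → Feat d) (hf : ∃ L, LipschitzWith L f)
      (ρ : Fin r → AggTerm d k) : AggTerm d k
  /-- the global weighted mean `∑_v ρ(u, v) ⋆ h(η(u, v))` -/
  | globalMean {k : ℕ} (h : Feat d → Feat d) (hpos : ∀ x j, 0 < h x j)
      (hlip : ∀ K : Set (Feat d), IsCompact K → ∃ L, LipschitzOnWith L h K)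
      (ρ η : AggTerm d (k + 1)) : AggTerm d k
  /-- the local weighted mean `∑_{v ∈ N(u_i)} ρ(u, v) ⋆ h(η(u, v))` -/
  | localMean {k : ℕ} (i : Fin k) (h : Feat d → Feat d) (hpos : ∀ x j, 0 < h x j)
      (hlip : ∀ K : Set (Feat d), IsCompact K → ∃ L, LipschitzOnWith L h K)
      (ρ η : AggTerm d (k + 1)) : AggTerm d k

noncomputable section

open Classical in
/-- Transition matrix of the simple random walk on `G` (a zero row at an isolated node). -/
def walkMatrix {V : Type} [Fintype V] (G : SimpleGraph V) : Matrix V V ℝ :=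
  Matrix.of fun u v => if G.Adj u v then (1 : ℝ) / (G.degree u : ℝ) else 0

open Classical in
/-- Coordinate `j` is the probability that the simple random walk from `v` is at `v` after `j + 1`
steps (`j = 0, …, d - 1`). -/
def rwProbEmb {V : Type} [Fintype V] (d : ℕ) (G : SimpleGraph V) (v : V) : Feat d :=
  WithLp.toLp 2 fun j => (walkMatrix G ^ ((j : ℕ) + 1)) v v

open Classical in
/-- Coordinate `j` is the proportion, among all walks of length `j + 1` starting at `v`, of those
ending at `v` (and `0` if there is no such walk). -/
def rwCountEmb {V : Type} [Fintype V] (d : ℕ) (G : SimpleGraph V) (v : V) : Feat d :=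
  WithLp.toLp 2 fun j =>
    (G.adjMatrix ℝ ^ ((j : ℕ) + 1)) v v / ∑ w, (G.adjMatrix ℝ ^ ((j : ℕ) + 1)) v w

/-- The weighted mean over `S` of the values `x v` with weights `w v`, taken coordinatewise.
It is the zero vector when `S` is empty. -/
def weightedMean {V : Type} {d : ℕ} (S : Finset V) (x w : V → Feat d) : Feat d :=
  WithLp.toLp 2 fun j => (∑ v ∈ S, x v j * w v j) / ∑ v ∈ S, w v j

open Classical in
/-- The value of a term at a tuple `u` of nodes of the graph `G` with node features `H`. -/
def AggTerm.interp {V : Type} [Fintype V] {d : ℕ} (G : SimpleGraph V) (H : V → Feat d) :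
    {k : ℕ} → AggTerm d k → (Fin k → V) → Feat d
  | _, .feature i, u => H (u i)
  | _, .rwProb i, u => rwProbEmb d G (u i)
  | _, .rwCount i, u => rwCountEmb d G (u i)
  | _, .const c, _ => c
  | _, .app f _ ρ, u => f fun s => (ρ s).interp G H u
  | _, .globalMean h _ _ ρ η, u =>
      weightedMean Finset.univ (fun v => ρ.interp G H (Fin.snoc (α := fun _ => V) u v))
        (fun v => h (η.interp G H (Fin.snoc (α := fun _ => V) u v)))
  | _, .localMean i h _ _ ρ η, u =>
      weightedMean (G.neighborFinset (u i))
        (fun v => ρ.interp G H (Fin.snoc (α := fun _ => V) u v))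
        (fun v => h (η.interp G H (Fin.snoc (α := fun _ => V) u v)))

/-- The graph type of a tuple: which pairs of its entries are adjacent. -/
def graphType {V : Type} {k : ℕ} (G : SimpleGraph V) (u : Fin k → V) : SimpleGraph (Fin k) :=
  G.comap u

/-- A `∧`-description in `k` variables: the conjunction of `u_i E u_j` over its pairs `(i, j)`. -/
abbrev WedgeDesc (k : ℕ) : Type := Finset (Fin k × Fin k)

/-- The tuple `u` satisfies the `∧`-description `ψ`. -/
def WedgeDesc.Holds {V : Type} {k : ℕ} (ψ : WedgeDesc k) (G : SimpleGraph V)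
    (u : Fin k → V) : Prop :=
  ∀ e ∈ ψ, G.Adj (u e.1) (u e.2)

/-- Feature-type controllers for `k`-tuples whose types range over the finite set `T`: functions of
`k` feature vectors and a type which are Lipschitz in the features. -/
def IsController {d k : ℕ} {T : Type} (e : (Fin k → Feat d) → T → Feat d) : Prop :=
  ∀ t, ∃ L, LipschitzWith L fun a => e a t

/-- The controller `e` approximates the term `π` under the laws `μ n` of featured graphs on `n`
nodes, where `tp n G u` is the type of the tuple `u` in `G`: for all `ε, δ, θ > 0` and every
`∧`-description `ψ`, for all large `n`, with probability at least `1 - θ`, at least a proportion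
`1 - δ` of the tuples `u` satisfying `ψ` have `‖e(H(u), tp(u)) - π(u)‖ < ε`. -/
def Approximates {d k : ℕ} {T : Type}
    (μ : (n : ℕ) → Measure (SimpleGraph (Fin n) × (Fin n → Feat d)))
    (tp : (n : ℕ) → SimpleGraph (Fin n) → (Fin k → Fin n) → T)
    (e : (Fin k → Feat d) → T → Feat d) (π : AggTerm d k) : Prop :=
  ∀ ε > (0 : ℝ), ∀ δ > (0 : ℝ), ∀ θ > (0 : ℝ), ∀ ψ : WedgeDesc k,
    ∃ N : ℕ, ∀ n ≥ N,
      1 - θ ≤ (μ n).real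
        {ω | (1 - δ) * ({u : Fin k → Fin n | ψ.Holds ω.1 u}.ncard : ℝ) ≤
          ({u : Fin k → Fin n | ψ.Holds ω.1 u ∧
            ‖e (fun i => ω.2 (u i)) (tp n ω.1 u) - π.interp ω.1 ω.2 u‖ < ε}.ncard : ℝ)}

/-- The non-sparse conditions on the edge probability: density, root growth, log growth. -/
def NonSparse (p : ℕ → unitInterval) : Prop :=
  (∃ p' : ℝ, 0 < p' ∧ Tendsto (fun n => (p n : ℝ)) atTop (𝓝 p')) ∨
  (∃ K β : ℝ, 0 < K ∧ 0 < β ∧ β < 1 ∧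
    ∀ᶠ n : ℕ in atTop, (p n : ℝ) = K * (n : ℝ) ^ (-β)) ∨
  (∃ K : ℝ, 0 < K ∧ ∀ᶠ n : ℕ in atTop, (p n : ℝ) = K * Real.log n / n)

/-- The law of a random graph in which each pair `e` of distinct nodes is, independently, an edge
with probability `w e` (the values of `w` on the diagonal play no role). -/
def inhomGraph {V : Type} [Fintype V] [DecidableEq V] (w : Sym2 V → unitInterval) :
    Measure (SimpleGraph V) :=
  (Measure.pi fun e : Sym2 V =>
      unitInterval.toNNReal (w e) • Measure.dirac True +
        unitInterval.toNNReal (unitInterval.symm (w e)) • Measure.dirac False).map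
    fun s => SimpleGraph.fromEdgeSet {e | s e}

/-- The stochastic block model on the node set `V`, where `C v` is the community of `v` and
`P i j` is the probability of an edge between a node of community `i` and one of community `j`. -/
def sbmGraph {V : Type} [Fintype V] [DecidableEq V] {m : ℕ} (P : Fin m → Fin m → unitInterval)
    (hP : ∀ i j, P i j = P j i) (C : V → Fin m) : Measure (SimpleGraph V) :=
  inhomGraph (Sym2.lift ⟨fun u v => P (C u) (C v), fun u v => hP (C u) (C v)⟩)

/-- A random graph with law `γ` together with node features drawn independently of the graph and
of each other from `F`. -/
def withFeatures {n d : ℕ} (γ : Measure (SimpleGraph (Fin n))) (F : Measure (Feat d)) :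
    Measure (SimpleGraph (Fin n) × (Fin n → Feat d)) :=
  γ.prod (Measure.pi fun _ => F)

end

/-! ### Feature vectors -/

/-! The controller that works never looks at adjacency: it depends on the features and, in the block
model, on the communities. The proof separates a deterministic statement about regular featured
graphs from the probability that a random graph is regular.

Deterministic part. A finite net cuts the ball containing the features into cells. A set of nodes is
`Balanced` if each pair of a community and a cell occurs in it about as often as the limit data
predict; sums of bounded Lipschitz functions over it are then close to integrals
(`Balanced.abs_sum_sub_le`). Hence a weighted mean over a balanced set is close to a quotient of
integrals, `meanLimit`, even if a few summands are wrong (`weightedMean_close`). A node is good to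
depth `D` if all nodes within distance `D` have balanced neighbourhoods. By induction on the term,
`exists_tame_approximated` gives a bounded Lipschitz controller which is accurate at good tuples. A
local mean costs one unit of depth, a global mean tolerates the few bad nodes, and the random walk
embeddings tend to zero, because the last step of a returning walk leaves a neighbour of large
degree.

Probabilistic part. Exponential moments bound the probability of an unbalanced neighbourhood by a
constant times `exp (-rate * s)`, where `s` is the scale of the degrees
(`real_edges_inter_not_good_le`). By `Converges.approximates` it is enough that most nodes are good
and that, for each `∧`-description, most satisfying tuples have good entries only. If `s` outgrows
every multiple of the logarithm, a union bound makes all nodes good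
(`Converges.approximates_of_superlog`); this covers density, root growth and the block model.

If `s = K log n`, the failure probability is only `n ^ (-κ)`, with `κ` possibly small. Bad nodes may
then exist, and the tuples satisfying `ψ` might concentrate near them. Two facts exclude this. A
lasso has as many edges as nodes, so the expected number of short lassos starting at a bad node is
polylogarithmic times `n ^ (-κ)`, and with high probability there are none. An odd closed walk in
the component of `i` in `ψ`, carried to a nearby bad node, would produce such a lasso; so either the
`i`-th entry stays away from bad nodes, or this component is bipartite. A bipartite component can be
folded onto any edge of the graph, and exchanging tuples for folded ones shows that those near bad
nodes are a fraction of at most (number of bad nodes) times polylog over `n`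
(`WedgeDesc.ncard_holds_near_le`). -/

theorem Feat.abs_apply_le {d : ℕ} (x : Feat d) (j : Fin d) : |x j| ≤ ‖x‖ := by
  simpa using PiLp.norm_apply_le x j

theorem Feat.norm_le_of_abs_le {d : ℕ} {x : Feat d} {r : ℝ} (h : ∀ j, |x j| ≤ r) :
    ‖x‖ ≤ d * r := by
  have hx : x = ∑ j, x j • EuclideanSpace.single j (1 : ℝ) := by
    ext i
    simp [Finset.sum_apply, Pi.single_apply]
  calc ‖x‖ = ‖∑ j, x j • EuclideanSpace.single j (1 : ℝ)‖ := by rw [← hx]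
    _ ≤ ∑ j, ‖x j • EuclideanSpace.single j (1 : ℝ)‖ := norm_sum_le _ _
    _ ≤ ∑ _j : Fin d, r := Finset.sum_le_sum fun j _ => by
        simpa [norm_smul] using h j
    _ = d * r := by simp

/-- Coordinatewise truncation to `[-B, B]`. -/
noncomputable def Feat.clip {d : ℕ} (B : ℝ) (x : Feat d) : Feat d :=
  WithLp.toLp 2 fun j => max (-B) (min B (x j))

theorem Feat.clip_eq_self {d : ℕ} {B : ℝ} {x : Feat d} (hx : ‖x‖ ≤ B) : Feat.clip B x = x := by
  ext j
  have := abs_le.1 ((Feat.abs_apply_le x j).trans hx)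
  simp [Feat.clip, this.1, this.2]

theorem Feat.norm_clip_le {d : ℕ} {B : ℝ} (hB : 0 ≤ B) (x : Feat d) :
    ‖Feat.clip B x‖ ≤ d * B := by
  refine Feat.norm_le_of_abs_le fun j => abs_le.2 ⟨?_, ?_⟩
  · simp [Feat.clip]
  · simp [Feat.clip, hB]

theorem Feat.lipschitzWith_clip {d : ℕ} (B : ℝ) :
    LipschitzWith 1 (Feat.clip B : Feat d → Feat d) := by
  refine LipschitzWith.of_dist_le_mul fun x y => ?_
  rw [NNReal.coe_one, one_mul, EuclideanSpace.dist_eq, EuclideanSpace.dist_eq]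
  refine Real.sqrt_le_sqrt (Finset.sum_le_sum fun j _ => ?_)
  refine pow_le_pow_left₀ dist_nonneg ?_ 2
  simp only [Feat.clip, Real.dist_eq]
  calc _ ≤ |min B (x j) - min B (y j)| := (abs_max_sub_max_le_max _ _ _ _).trans (by simp)
    _ ≤ _ := by
      exact (abs_min_sub_min_le_max _ _ _ _).trans (by simp)

/-! ### Quotients -/

/-- The difference equals `((A / D) (D' - D) + (A - A')) / D'`, so only one of the two denominators
needs a quantitative lower bound; for the other quotient a bound `R` suffices. -/
theorem abs_div_sub_div_le {A D A' D' R D₀ : ℝ} (hD : 0 < D) (hD₀ : 0 < D₀) (hD' : D₀ ≤ D')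
    (hA : |A| ≤ R * D) :
    |A / D - A' / D'| ≤ (|A - A'| + R * |D - D'|) / D₀ := by
  have h' : 0 < D' := hD₀.trans_le hD'
  have hr : |A / D| ≤ R := by
    rw [abs_div, abs_of_pos hD, div_le_iff₀ hD]; exact hA
  have key : A / D - A' / D' = (A / D * (D' - D) + (A - A')) / D' := by
    field_simp; ring
  rw [key, abs_div, abs_of_pos h']
  have hnum : |A / D * (D' - D) + (A - A')| ≤ |A - A'| + R * |D - D'| := by
    refine (abs_add_le _ _).trans ?_
    rw [abs_mul, abs_sub_comm D' D, add_comm]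
    gcongr
  have hn0 : 0 ≤ |A - A'| + R * |D - D'| := (abs_nonneg _).trans hnum
  calc _ ≤ (|A - A'| + R * |D - D'|) / D' := by gcongr
    _ ≤ _ := by gcongr

/-! ### Tame functions -/

/-- A function of `k` feature vectors and `k` communities which is bounded, and Lipschitz in the
vectors. -/
def Tame {d k m : ℕ} (e : (Fin k → Feat d) → (Fin k → Fin m) → Feat d) : Prop :=
  ∃ (K : NNReal) (M : ℝ), (∀ c, LipschitzWith K fun a => e a c) ∧ ∀ a c, ‖e a c‖ ≤ M

theorem dist_snoc_le {X : Type*} [PseudoMetricSpace X] {k : ℕ} (a a' : Fin k → X) (x x' : X) :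
    dist (Fin.snoc (α := fun _ => X) a x) (Fin.snoc (α := fun _ => X) a' x') ≤
      max (dist a a') (dist x x') := by
  refine (dist_pi_le_iff (le_max_of_le_left dist_nonneg)).2 fun i => ?_
  refine Fin.lastCases ?_ (fun i => ?_) i
  · simp
  · simpa using Or.inl (dist_le_pi_dist a a' i)

theorem comp_snoc_eq {X Y : Type*} {k : ℕ} (f : X → Y) (u : Fin k → X) (v : X) :
    (fun i => f (Fin.snoc (α := fun _ => X) u v i)) =
      Fin.snoc (α := fun _ => Y) (fun i => f (u i)) (f v) := by
  funext i
  refine Fin.lastCases ?_ (fun i => ?_) i <;> simp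

/-- A positive function which is Lipschitz on compact sets has, on the closed ball of radius `R`,
a common Lipschitz constant and bounds for all its coordinates. -/
theorem exists_weight_bounds {d : ℕ} {h : Feat d → Feat d} (hpos : ∀ x j, 0 < h x j)
    (hlip : ∀ K : Set (Feat d), IsCompact K → ∃ L, LipschitzOnWith L h K) (R : ℝ) :
    ∃ K b M : ℝ, 0 ≤ K ∧ 0 < b ∧ 0 ≤ M ∧
      (∀ x y, ‖x‖ ≤ R → ‖y‖ ≤ R → ∀ j, |h x j - h y j| ≤ K * ‖x - y‖) ∧
      ∀ x, ‖x‖ ≤ R → ∀ j, b ≤ h x j ∧ h x j ≤ M := by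
  have hc : IsCompact (Metric.closedBall (0 : Feat d) R) := isCompact_closedBall _ _
  obtain ⟨L, hL⟩ := hlip _ hc
  have hcont : ∀ j, ContinuousOn (fun x => h x j) (Metric.closedBall (0 : Feat d) R) := fun j =>
    (PiLp.continuous_apply 2 _ j).comp_continuousOn hL.continuousOn
  have hb : ∀ j, ∃ b : ℝ, 0 < b ∧ ∀ x ∈ Metric.closedBall (0 : Feat d) R, b ≤ h x j := by
    intro j
    rcases (Metric.closedBall (0 : Feat d) R).eq_empty_or_nonempty with h0 | h0
    · exact ⟨1, one_pos, by simp [h0]⟩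
    · obtain ⟨x, _, hx⟩ := hc.exists_isMinOn h0 (hcont j)
      exact ⟨h x j, hpos x j, fun y hy => hx hy⟩
  have hM : ∀ j, ∃ M : ℝ, ∀ x ∈ Metric.closedBall (0 : Feat d) R, h x j ≤ M := by
    intro j
    obtain ⟨M, hM⟩ := (hc.image_of_continuousOn (hcont j)).bddAbove
    exact ⟨M, fun x hx => hM ⟨x, hx, rfl⟩⟩
  choose b hb0 hb using hb
  choose M hM using hM
  obtain ⟨b', hb'⟩ : ∃ b' : ℝ, 0 < b' ∧ ∀ j, b' ≤ b j := by
    rcases isEmpty_or_nonempty (Fin d) with h0 | h0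
    · exact ⟨1, one_pos, fun j => h0.elim j⟩
    · obtain ⟨j, hj⟩ := Finite.exists_min b
      exact ⟨b j, hb0 j, hj⟩
  obtain ⟨M', hM'⟩ := (Set.finite_range M).bddAbove
  refine ⟨L, b', max M' 0, L.2, hb'.1, le_max_right _ _, fun x y hx hy j => ?_, fun x hx j => ?_⟩
  · have := hL.dist_le_mul x (by simpa using hx) y (by simpa using hy)
    rw [dist_eq_norm, dist_eq_norm] at this
    exact (Feat.abs_apply_le (h x - h y) j).trans this
  · exact ⟨(hb'.2 j).trans (hb j x (by simpa using hx)),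
      (hM j x (by simpa using hx)).trans ((hM' ⟨j, rfl⟩).trans (le_max_left _ _))⟩

/-! ### Limit objects and regular featured graphs -/

/-- The limit data of a sequence of random featured graphs with `m` communities: the feature
distribution `F`, supported in the ball of radius `B`, finite nets of this ball, the proportions
`q j` of the communities, and the asymptotic number `lam i j` of neighbours in community `j` of a
node of community `i`, relative to the scale of the degrees. -/
structure LocalLimit (d m : ℕ) where
  F : Measure (Feat d)
  prob : IsProbabilityMeasure F
  B : ℝ
  B_nonneg : 0 ≤ B
  ae_le : ∀ᵐ x ∂F, ‖x‖ ≤ B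
  net : ℕ → Finset (Feat d)
  net_cover : ∀ (N : ℕ) (x : Feat d), ‖x‖ ≤ B → ∃ c ∈ net N, dist x c < 1 / ((N : ℝ) + 1)
  q : Fin m → ℝ
  q_nonneg : ∀ j, 0 ≤ q j
  q_sum : 0 < ∑ j, q j
  lam : Fin m → Fin m → ℝ
  lam_nonneg : ∀ i j, 0 ≤ lam i j

namespace LocalLimit

variable {d m : ℕ} (L : LocalLimit d m)

instance : IsProbabilityMeasure L.F := L.prob

open Classical in
/-- The cell of `x` at level `N`: the points of the net near to `x`. -/
noncomputable def cell (N : ℕ) (x : Feat d) : Finset (Feat d) :=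
  (L.net N).filter fun c => dist x c < 1 / ((N : ℝ) + 1)

theorem cell_mem (N : ℕ) (x : Feat d) : L.cell N x ∈ (L.net N).powerset := by
  simp [cell, Finset.filter_subset]

/-- Since the net covers the ball, the cell of `x` is non-empty, and any of its points is near to
both `x` and `y`. Hence `y` need not lie in the ball. -/
theorem dist_le_of_cell_eq {N : ℕ} {x y : Feat d} (hx : ‖x‖ ≤ L.B)
    (h : L.cell N x = L.cell N y) : dist x y ≤ 2 / ((N : ℝ) + 1) := by
  obtain ⟨c, hc, hxc⟩ := L.net_cover N x hx
  have h1 : c ∈ L.cell N x := Finset.mem_filter.2 ⟨hc, hxc⟩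
  rw [h] at h1
  have h2 : dist y c < 1 / ((N : ℝ) + 1) := by
    simp only [cell, Finset.mem_filter] at h1; exact h1.2
  calc dist x y ≤ dist x c + dist y c := dist_triangle_right _ _ _
    _ ≤ 1 / ((N : ℝ) + 1) + 1 / ((N : ℝ) + 1) := by linarith
    _ = _ := by ring

theorem measurableSet_cell (N : ℕ) (z : Finset (Feat d)) :
    MeasurableSet {x | L.cell N x = z} := by
  have : {x | L.cell N x = z} =
      if z ⊆ L.net N then ⋂ c ∈ L.net N, {x | dist x c < 1 / ((N : ℝ) + 1) ↔ c ∈ z} else ∅ := by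
    ext x
    split_ifs with h
    · simp only [Set.mem_ofPred_eq, Set.mem_iInter, cell, Finset.ext_iff, Finset.mem_filter]
      constructor
      · intro hx c hc
        simpa [hc] using hx c
      · intro hx c
        by_cases hc : c ∈ L.net N
        · simpa [hc] using hx c hc
        · simpa [hc] using fun h' => hc (h h')
    · simp only [Set.mem_ofPred_eq, Set.mem_empty_iff_false, iff_false]
      rintro rfl
      exact h (Finset.filter_subset _ _)
  rw [this]
  split_ifs
  · refine Finset.measurableSet_biInter _ fun c _ => ?_
    have hm : MeasurableSet {x : Feat d | dist x c < 1 / ((N : ℝ) + 1)} :=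
      measurableSet_lt (measurable_id.dist measurable_const) measurable_const
    by_cases hc : c ∈ z
    · simpa [hc] using hm
    · simp only [hc, iff_false]
      exact hm.compl
  · exact MeasurableSet.empty

/-- The tolerance at level `N`. -/
noncomputable def tol (N : ℕ) : ℝ :=
  1 / (((N : ℝ) + 1) * ((m + 1) * (L.net N).powerset.card))

theorem card_powerset_pos (N : ℕ) : (0 : ℝ) < (L.net N).powerset.card := by
  rw [Finset.card_powerset]; positivity

theorem tol_pos (N : ℕ) : 0 < L.tol N := by
  have := L.card_powerset_pos N
  unfold tol; positivity

/-- The denominator of `tol` is made for this: the errors of all tests together stay below `1 / (N +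
1)`. The factor `m + 1` instead of `m` keeps it non-zero. -/
theorem sum_tol_le (N : ℕ) :
    ∑ _j : Fin m, ∑ _z ∈ (L.net N).powerset, L.tol N ≤ 1 / ((N : ℝ) + 1) := by
  have h := L.card_powerset_pos N
  rw [Finset.sum_const, Finset.sum_const, Finset.card_univ, Fintype.card_fin, nsmul_eq_mul,
    nsmul_eq_mul, tol]
  rw [← mul_assoc, mul_one_div, div_le_div_iff₀ (by positivity) (by positivity)]
  nlinarith [mul_pos h (Nat.cast_add_one_pos (α := ℝ) N)]

/-- Among the nodes of `S`, the pairs of a cell and a community are distributed, relative to the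
scale `s`, according to `lam` and `F`. -/
def Balanced {V : Type} (N : ℕ) (H : V → Feat d) (C : V → Fin m) (s : ℝ) (lam : Fin m → ℝ)
    (S : Set V) : Prop :=
  ∀ j, ∀ z ∈ (L.net N).powerset,
    |({v ∈ S | C v = j ∧ L.cell N (H v) = z}.ncard : ℝ) -
      s * lam j * L.F.real {x | L.cell N x = z}| ≤ s * L.tol N

/-- `v` is good to depth `D` if all nodes at distance at most `D` from `v` have balanced
neighbourhoods. -/
def Good {V : Type} (N : ℕ) (G : SimpleGraph V) (H : V → Feat d) (C : V → Fin m) (s : ℝ) :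
    ℕ → V → Prop
  | 0, v => L.Balanced N H C s (L.lam (C v)) (G.neighborSet v)
  | D + 1, v => Good N G H C s D v ∧ ∀ w, G.Adj v w → Good N G H C s D w

/-- A featured graph whose features are bounded and globally balanced, and in which most nodes are
good. -/
structure Regular {V : Type} [Fintype V] (N D : ℕ) (G : SimpleGraph V) (H : V → Feat d)
    (C : V → Fin m) (s : ℝ) : Prop where
  nonempty : Nonempty V
  scale : (N : ℝ) + 1 ≤ s
  norm_le : ∀ v, ‖H v‖ ≤ L.B
  isolated : ∀ v, (∀ j, L.lam (C v) j = 0) → ∀ w, ¬ G.Adj v w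
  balanced : L.Balanced N H C (Fintype.card V) L.q Set.univ
  bad_le : ({v | ¬ L.Good N G H C s D v}.ncard : ℝ) ≤ Fintype.card V / ((N : ℝ) + 1)

variable {L}

theorem Good.of_le {V : Type} {N : ℕ} {G : SimpleGraph V} {H : V → Feat d} {C : V → Fin m} {s : ℝ}
    {D D' : ℕ} (h : D ≤ D') {v : V} (hv : L.Good N G H C s D' v) : L.Good N G H C s D v := by
  induction h with
  | refl => exact hv
  | step _ ih => exact ih hv.1

theorem Regular.of_le {V : Type} [Fintype V] {N D D' : ℕ} {G : SimpleGraph V} {H : V → Feat d}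
    {C : V → Fin m} {s : ℝ} (hD : D ≤ D') (h : L.Regular N D' G H C s) :
    L.Regular N D G H C s := by
  refine { h with bad_le := le_trans ?_ h.bad_le }
  exact_mod_cast Set.ncard_le_ncard (s := {v | ¬ L.Good N G H C s D v})
    (fun v hv hv' => hv (Good.of_le hD hv')) (Set.toFinite _)

variable (L)

/-- Sums of functions of cell and community over a balanced set. -/
theorem Balanced.abs_sum_cell_sub_le {V : Type} {N : ℕ} {H : V → Feat d} {C : V → Fin m} {s : ℝ}
    {lam : Fin m → ℝ} {S : Finset V} (hs : 0 ≤ s) (h : L.Balanced N H C s lam (S : Set V))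
    {a : Fin m → Finset (Feat d) → ℝ} {M : ℝ} (ha : ∀ j z, |a j z| ≤ M) (hM : 0 ≤ M) :
    |∑ v ∈ S, a (C v) (L.cell N (H v)) -
      s * ∑ j, lam j * ∑ z ∈ (L.net N).powerset, L.F.real {x | L.cell N x = z} * a j z| ≤
      s * M / ((N : ℝ) + 1) := by
  classical
  have h1 : ∑ v ∈ S, a (C v) (L.cell N (H v)) = ∑ j, ∑ z ∈ (L.net N).powerset,
      ({v ∈ (S : Set V) | C v = j ∧ L.cell N (H v) = z}.ncard : ℝ) * a j z := by
    have h2 : ∀ j z, ({v ∈ (S : Set V) | C v = j ∧ L.cell N (H v) = z}.ncard : ℝ) * a j z =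
        ∑ v ∈ S, if C v = j ∧ L.cell N (H v) = z then a j z else 0 := by
      intro j z
      rw [← Finset.sum_filter, Finset.sum_const, nsmul_eq_mul, ← Set.ncard_coe_finset]
      congr 3
      ext v; simp
    simp_rw [h2]
    rw [Finset.sum_congr rfl fun j _ => Finset.sum_comm, Finset.sum_comm]
    refine Finset.sum_congr rfl fun v _ => ?_
    simp_rw [ite_and]
    simp [L.cell_mem]
  have h3 : s * ∑ j, lam j * ∑ z ∈ (L.net N).powerset, L.F.real {x | L.cell N x = z} * a j z =
      ∑ j, ∑ z ∈ (L.net N).powerset, s * lam j * L.F.real {x | L.cell N x = z} * a j z := by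
    simp_rw [Finset.mul_sum]
    refine Finset.sum_congr rfl fun j _ => Finset.sum_congr rfl fun z _ => by ring
  rw [h1, h3, ← Finset.sum_sub_distrib]
  simp_rw [← Finset.sum_sub_distrib, ← sub_mul]
  calc _ ≤ ∑ j, ∑ z ∈ (L.net N).powerset, s * L.tol N * M := by
        refine (Finset.abs_sum_le_sum_abs _ _).trans (Finset.sum_le_sum fun j _ => ?_)
        refine (Finset.abs_sum_le_sum_abs _ _).trans (Finset.sum_le_sum fun z hz => ?_)
        rw [abs_mul]
        exact mul_le_mul (h j z hz) (ha j z) (abs_nonneg _)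
          (mul_nonneg hs (L.tol_pos N).le)
    _ = s * M * ∑ _j : Fin m, ∑ _z ∈ (L.net N).powerset, L.tol N := by
        simp_rw [Finset.mul_sum]
        refine Finset.sum_congr rfl fun j _ => Finset.sum_congr rfl fun z _ => by ring
    _ ≤ s * M * (1 / ((N : ℝ) + 1)) :=
        mul_le_mul_of_nonneg_left (L.sum_tol_le N) (mul_nonneg hs hM)
    _ = _ := by ring

theorem integral_cell (N : ℕ) (b : Finset (Feat d) → ℝ) :
    Integrable (fun x => b (L.cell N x)) L.F ∧ ∫ x, b (L.cell N x) ∂L.F =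
      ∑ z ∈ (L.net N).powerset, L.F.real {x | L.cell N x = z} * b z := by
  classical
  have h : (fun x => b (L.cell N x)) = fun x => ∑ z ∈ (L.net N).powerset,
      Set.indicator {x | L.cell N x = z} (fun _ => b z) x := by
    funext x
    simp [Set.indicator_apply, L.cell_mem, -Finset.mem_powerset]
  have hi : ∀ z, Integrable (Set.indicator {x | L.cell N x = z} fun _ => b z) L.F := fun z =>
    (integrable_const _).indicator (L.measurableSet_cell N z)
  rw [h]
  refine ⟨integrable_finsetSum _ fun z _ => hi z, ?_⟩
  rw [integral_finsetSum _ fun z _ => hi z]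
  refine Finset.sum_congr rfl fun z _ => ?_
  rw [integral_indicator_const _ (L.measurableSet_cell N z), smul_eq_mul]

theorem Balanced.abs_card_sub_le {V : Type} {N : ℕ} {H : V → Feat d} {C : V → Fin m} {s : ℝ}
    {lam : Fin m → ℝ} {S : Finset V} (hs : 0 ≤ s) (h : L.Balanced N H C s lam (S : Set V)) :
    |(S.card : ℝ) - s * ∑ j, lam j| ≤ s / ((N : ℝ) + 1) := by
  have := Balanced.abs_sum_cell_sub_le L hs h (a := fun _ _ => 1) (M := 1) (by simp) (by simp)
  have h1 := (L.integral_cell N fun _ => 1).2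
  simp only [integral_const, probReal_univ, smul_eq_mul, mul_one] at h1 this
  simpa [← h1] using this

/-- Sums of bounded Lipschitz functions over a balanced set. -/
theorem Balanced.abs_sum_sub_le {V : Type} {N : ℕ} {H : V → Feat d} {C : V → Fin m} {s : ℝ}
    {lam : Fin m → ℝ} {S : Finset V} (hs : 0 ≤ s) (hlam : ∀ j, 0 ≤ lam j)
    (hH : ∀ v, ‖H v‖ ≤ L.B) (h : L.Balanced N H C s lam (S : Set V))
    {g : Fin m → Feat d → ℝ} {M K : ℝ} (hM : 0 ≤ M) (hK : 0 ≤ K) (hg : ∀ j x, |g j x| ≤ M)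
    (hg' : ∀ j x y, |g j x - g j y| ≤ K * dist x y) (hgm : ∀ j, Continuous (g j)) :
    |∑ v ∈ S, g (C v) (H v) - s * ∑ j, lam j * ∫ x, g j x ∂L.F| ≤
      s * ((M + 2 * K * (2 * ∑ j, lam j + 1)) / ((N : ℝ) + 1)) := by
  classical
  -- A representative in the ball for each cell that meets it. Replacing `g` by its value at the
  -- representative costs `2 K / (N + 1)` per node and turns it into a function of the cell. The
  -- default `0` is never taken at cells of points of the ball.
  let rep : Finset (Feat d) → Feat d := fun z =>
    if hz : ∃ x, ‖x‖ ≤ L.B ∧ L.cell N x = z then hz.choose else 0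
  have hrep : ∀ x, ‖x‖ ≤ L.B → dist x (rep (L.cell N x)) ≤ 2 / ((N : ℝ) + 1) := by
    intro x hx
    have hz : ∃ y, ‖y‖ ≤ L.B ∧ L.cell N y = L.cell N x := ⟨x, hx, rfl⟩
    have : rep (L.cell N x) = hz.choose := dif_pos hz
    rw [this]
    exact L.dist_le_of_cell_eq hx hz.choose_spec.2.symm
  have hclose : ∀ j x, ‖x‖ ≤ L.B →
      |g j x - g j (rep (L.cell N x))| ≤ K * (2 / ((N : ℝ) + 1)) := fun j x hx =>
    (hg' j _ _).trans (mul_le_mul_of_nonneg_left (hrep x hx) hK)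
  have h1 := Balanced.abs_sum_cell_sub_le L hs h (a := fun j z => g j (rep z)) (M := M)
    (fun j z => hg j _) hM
  have h2 : |∑ v ∈ S, g (C v) (H v) - ∑ v ∈ S, g (C v) (rep (L.cell N (H v)))| ≤
      S.card * (K * (2 / ((N : ℝ) + 1))) := by
    rw [← Finset.sum_sub_distrib]
    refine (Finset.abs_sum_le_sum_abs _ _).trans ?_
    refine (Finset.sum_le_sum fun v _ => hclose _ _ (hH v)).trans ?_
    simp
  have hint : ∀ j, Integrable (g j) L.F := fun j =>
    Integrable.of_bound (hgm j).aestronglyMeasurable M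
      (Eventually.of_forall fun x => by simpa using hg j x)
  have h3 : ∀ j, |∑ z ∈ (L.net N).powerset, L.F.real {x | L.cell N x = z} * g j (rep z) -
      ∫ x, g j x ∂L.F| ≤ K * (2 / ((N : ℝ) + 1)) := by
    intro j
    obtain ⟨hi, he⟩ := L.integral_cell N fun z => g j (rep z)
    rw [← he, ← integral_sub hi (hint j), ← Real.norm_eq_abs]
    refine (norm_integral_le_of_norm_le_const (C := K * (2 / ((N : ℝ) + 1))) ?_).trans (by simp)
    filter_upwards [L.ae_le] with x hx
    rw [Real.norm_eq_abs, abs_sub_comm]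
    exact hclose j x hx
  have h4 : |s * ∑ j, lam j * ∑ z ∈ (L.net N).powerset,
      L.F.real {x | L.cell N x = z} * g j (rep z) - s * ∑ j, lam j * ∫ x, g j x ∂L.F| ≤
      s * ((∑ j, lam j) * (K * (2 / ((N : ℝ) + 1)))) := by
    rw [← mul_sub, ← Finset.sum_sub_distrib, abs_mul, abs_of_nonneg hs, Finset.sum_mul]
    refine mul_le_mul_of_nonneg_left ?_ hs
    refine (Finset.abs_sum_le_sum_abs _ _).trans (Finset.sum_le_sum fun j _ => ?_)
    rw [← mul_sub, abs_mul, abs_of_nonneg (hlam j)]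
    exact mul_le_mul_of_nonneg_left (h3 j) (hlam j)
  have h5 : (S.card : ℝ) ≤ s * (∑ j, lam j + 1) := by
    have := (abs_le.1 (Balanced.abs_card_sub_le L hs h)).2
    have hN : s / ((N : ℝ) + 1) ≤ s := div_le_self hs (by linarith [Nat.cast_nonneg (α := ℝ) N])
    linarith
  have h6 : (S.card : ℝ) * (K * (2 / ((N : ℝ) + 1))) ≤
      s * (∑ j, lam j + 1) * (K * (2 / ((N : ℝ) + 1))) := by gcongr
  -- Three errors: discretising the sum, counting in the cells, and discretising the integral.
  have h7 : s * ((M + 2 * K * (2 * ∑ j, lam j + 1)) / ((N : ℝ) + 1)) =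
      s * (∑ j, lam j + 1) * (K * (2 / ((N : ℝ) + 1))) + s * M / ((N : ℝ) + 1) +
      s * ((∑ j, lam j) * (K * (2 / ((N : ℝ) + 1)))) := by
    field_simp; ring
  rw [h7]
  refine (abs_sub_le _ (∑ v ∈ S, g (C v) (rep (L.cell N (H v)))) _).trans ?_
  rw [add_assoc]
  refine add_le_add (h2.trans h6) ?_
  exact (abs_sub_le _ _ _).trans (add_le_add h1 h4)

end LocalLimit

/-! ### Random walk embeddings -/

/-- The factor `1` is kept so that this is the hypothesis of the return bounds below at `r = 1`,
which yields the a priori bound for both embeddings. -/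
theorem SimpleGraph.one_le_degree_of_adj {V : Type} {G : SimpleGraph V} {w x : V}
    [Fintype (G.neighborSet w)] (h : G.Adj w x) : (1 : ℝ) ≤ 1 * G.degree w := by
  rw [one_mul]
  exact_mod_cast (G.degree_pos_iff_exists_adj w).2 ⟨x, h⟩

section RandomWalk

variable {V : Type} [Fintype V] (G : SimpleGraph V)

open Classical in
theorem walkMatrix_pow_nonneg (j : ℕ) (x y : V) : 0 ≤ (walkMatrix G ^ j) x y := by
  classical
  induction j generalizing y with
  | zero => rw [pow_zero, Matrix.one_apply]; split_ifs <;> simp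
  | succ j ih =>
    rw [pow_succ, Matrix.mul_apply]
    refine Finset.sum_nonneg fun w _ => mul_nonneg (ih w) ?_
    simp only [walkMatrix, Matrix.of_apply]
    split_ifs <;> positivity

/-- Only an inequality, since the row of an isolated node vanishes. -/
theorem sum_walkMatrix_le (x : V) : ∑ y, walkMatrix G x y ≤ 1 := by
  classical
  simp only [walkMatrix, Matrix.of_apply]
  rw [← Finset.sum_filter, Finset.sum_const, nsmul_eq_mul]
  have : (Finset.univ.filter fun y => G.Adj x y) = G.neighborFinset x := by ext; simp
  rw [this, SimpleGraph.card_neighborFinset_eq_degree, mul_one_div]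
  have h1 := div_self_le_one ((G.degree x : ℕ) : ℝ)
  convert h1

open Classical in
theorem sum_walkMatrix_pow_le (j : ℕ) (x : V) : ∑ y, (walkMatrix G ^ j) x y ≤ 1 := by
  classical
  induction j with
  | zero => simp [Matrix.one_apply]
  | succ j ih =>
    simp_rw [pow_succ, Matrix.mul_apply]
    rw [Finset.sum_comm]
    simp_rw [← Finset.mul_sum]
    refine le_trans (Finset.sum_le_sum fun w _ => ?_) ih
    exact mul_le_of_le_one_right (walkMatrix_pow_nonneg G j x w) (sum_walkMatrix_le G w)

-- The last step of a returning walk goes from a neighbour `w` to `x` and has probability `1 / deg w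
-- ≤ r`, whatever the previous position; the distribution before that step has total mass at most
-- one.
open Classical in
theorem abs_rwProbEmb_le {d : ℕ} {x : V} {r : ℝ} (hr : 0 ≤ r)
    (h : ∀ w, G.Adj w x → 1 ≤ r * G.degree w) (j : Fin d) : |rwProbEmb d G x j| ≤ r := by
  simp only [rwProbEmb]
  rw [abs_of_nonneg (walkMatrix_pow_nonneg G _ x x), pow_succ, Matrix.mul_apply]
  have h1 : ∀ w, walkMatrix G w x ≤ r := by
    intro w
    simp only [walkMatrix, Matrix.of_apply]
    split_ifs with hw
    · have := h w hw
      have hd : (0 : ℝ) < G.degree w := by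
        rcases (Nat.cast_nonneg (α := ℝ) (G.degree w)).eq_or_lt with h0 | h0
        · rw [← h0] at this; norm_num at this
        · exact h0
      rw [div_le_iff₀ (by convert hd)]
      convert this
    · exact hr
  calc _ ≤ ∑ w, (walkMatrix G ^ (j : ℕ)) x w * r :=
        Finset.sum_le_sum fun w _ => mul_le_mul_of_nonneg_left (h1 w)
          (walkMatrix_pow_nonneg G _ x w)
    _ = (∑ w, (walkMatrix G ^ (j : ℕ)) x w) * r := by rw [Finset.sum_mul]
    _ ≤ r := mul_le_of_le_one_left hr (sum_walkMatrix_pow_le G _ x)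

open Classical in
theorem adjMatrix_pow_nonneg (j : ℕ) (x y : V) : 0 ≤ (G.adjMatrix ℝ ^ j) x y := by
  rw [SimpleGraph.adjMatrix_pow_apply_eq_card_walk]; positivity

-- A walk of length `j` ending at `w` has `deg w` extensions by one step, of which at most one ends
-- at `x`. Thus returning walks are at most a fraction `r` of all walks of length `j + 1`.
open Classical in
theorem abs_rwCountEmb_le {d : ℕ} {x : V} {r : ℝ} (hr : 0 ≤ r)
    (h : ∀ w, G.Adj w x → 1 ≤ r * G.degree w) (j : Fin d) : |rwCountEmb d G x j| ≤ r := by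
  have hsum : ∑ w, (G.adjMatrix ℝ ^ ((j : ℕ) + 1)) x w =
      ∑ w, (G.adjMatrix ℝ ^ (j : ℕ)) x w * G.degree w := by
    simp_rw [pow_succ, Matrix.mul_apply]
    rw [Finset.sum_comm]
    refine Finset.sum_congr rfl fun w _ => ?_
    rw [← Finset.mul_sum]
    congr 1
    simp [SimpleGraph.adjMatrix_apply, ← SimpleGraph.card_neighborFinset_eq_degree,
      SimpleGraph.neighborFinset_eq_filter]
  have hret : (G.adjMatrix ℝ ^ ((j : ℕ) + 1)) x x ≤
      r * ∑ w, (G.adjMatrix ℝ ^ ((j : ℕ) + 1)) x w := by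
    rw [hsum, pow_succ, Matrix.mul_apply, Finset.mul_sum]
    refine Finset.sum_le_sum fun w _ => ?_
    rw [mul_left_comm]
    refine mul_le_mul_of_nonneg_left ?_ (adjMatrix_pow_nonneg G _ x w)
    rw [SimpleGraph.adjMatrix_apply]
    split_ifs with hw
    · exact h w hw
    · positivity
  have h0 : 0 ≤ ∑ w, (G.adjMatrix ℝ ^ ((j : ℕ) + 1)) x w :=
    Finset.sum_nonneg fun w _ => adjMatrix_pow_nonneg G _ x w
  simp only [rwCountEmb]
  rw [abs_of_nonneg (div_nonneg (by convert adjMatrix_pow_nonneg G _ x x) (by convert h0))]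
  convert div_le_of_le_mul₀ h0 hr hret

end RandomWalk

/-! ### Bounds for the values of terms -/

/-- The denominator is only asked to be non-negative, so the empty mean, with value `0 / 0 = 0`, is
covered. -/
theorem abs_weightedMean_le {V : Type} {d : ℕ} {S : Finset V} {x w : V → Feat d} {R : ℝ}
    (hR : 0 ≤ R) (hx : ∀ v ∈ S, ‖x v‖ ≤ R) (hw : ∀ v ∈ S, ∀ j, 0 ≤ w v j) (j : Fin d) :
    |weightedMean S x w j| ≤ R := by
  simp only [weightedMean]
  have h0 : 0 ≤ ∑ v ∈ S, w v j := Finset.sum_nonneg fun v hv => hw v hv j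
  rw [abs_div, abs_of_nonneg h0]
  refine div_le_of_le_mul₀ h0 hR ?_
  rw [Finset.mul_sum]
  refine (Finset.abs_sum_le_sum_abs _ _).trans (Finset.sum_le_sum fun v hv => ?_)
  rw [abs_mul, abs_of_nonneg (hw v hv j)]
  exact mul_le_mul_of_nonneg_right ((Feat.abs_apply_le _ _).trans (hx v hv)) (hw v hv j)

/-- On featured graphs with features of norm at most `B`, the values of a term are bounded. -/
theorem exists_interp_bound {d k : ℕ} (B : ℝ) (hB : 0 ≤ B) (π : AggTerm d k) :
    ∃ R : ℝ, 0 ≤ R ∧ ∀ {V : Type} [Fintype V] (G : SimpleGraph V) (H : V → Feat d),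
      (∀ v, ‖H v‖ ≤ B) → ∀ u, ‖π.interp G H u‖ ≤ R := by
  classical
  induction π with
  | feature i => exact ⟨B, hB, fun G H hH u => by simpa [AggTerm.interp] using hH (u i)⟩
  | rwProb i =>
    refine ⟨d * 1, by positivity, fun G H hH u => Feat.norm_le_of_abs_le fun j => ?_⟩
    exact abs_rwProbEmb_le G zero_le_one (fun w hw => SimpleGraph.one_le_degree_of_adj hw) j
  | rwCount i =>
    refine ⟨d * 1, by positivity, fun G H hH u => Feat.norm_le_of_abs_le fun j => ?_⟩
    exact abs_rwCountEmb_le G zero_le_one (fun w hw => SimpleGraph.one_le_degree_of_adj hw) j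
  | const c => exact ⟨‖c‖, norm_nonneg _, fun G H hH u => le_rfl⟩
  | app f hf ρ ih =>
    obtain ⟨K, hK⟩ := hf
    choose R hR0 hR using ih
    refine ⟨‖f 0‖ + K * ∑ s, R s, ?_, fun G H hH u => ?_⟩
    · have := Finset.sum_nonneg fun s (_ : s ∈ Finset.univ) => hR0 s
      positivity
    · have h1 := hK.dist_le_mul (fun s => (ρ s).interp G H u) 0
      have h2 : dist (fun s => (ρ s).interp G H u) 0 ≤ ∑ s, R s := by
        refine (dist_pi_le_iff (Finset.sum_nonneg fun s _ => hR0 s)).2 fun s => ?_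
        rw [Pi.zero_apply, dist_zero_right]
        exact (hR s G H hH u).trans
          (Finset.single_le_sum (f := R) (fun s _ => hR0 s) (Finset.mem_univ s))
      rw [dist_eq_norm] at h1
      have h3 := norm_le_norm_add_norm_sub (f 0) (f fun s => (ρ s).interp G H u)
      have h4 : (K : ℝ) * dist (fun s => (ρ s).interp G H u) 0 ≤ K * ∑ s, R s := by gcongr
      rw [norm_sub_rev] at h3
      simp only [AggTerm.interp]
      linarith
  | globalMean h hpos hlip ρ η ihρ ihη =>
    obtain ⟨R, hR0, hR⟩ := ihρ
    refine ⟨d * R, by positivity, fun G H hH u => Feat.norm_le_of_abs_le fun j => ?_⟩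
    simp only [AggTerm.interp]
    exact abs_weightedMean_le hR0 (fun v _ => hR G H hH _) (fun v _ j => (hpos _ j).le) j
  | localMean i h hpos hlip ρ η ihρ ihη =>
    obtain ⟨R, hR0, hR⟩ := ihρ
    refine ⟨d * R, by positivity, fun G H hH u => Feat.norm_le_of_abs_le fun j => ?_⟩
    simp only [AggTerm.interp]
    exact abs_weightedMean_le hR0 (fun v _ => hR G H hH _) (fun v _ j => (hpos _ j).le) j

/-! ### Limits of weighted means -/

/-- Bounds for the functions `(x, y) ↦ x ⋆ h(y)` and `h` on balls. -/
theorem exists_weight_mul_bounds {d : ℕ} {h : Feat d → Feat d} (hpos : ∀ x j, 0 < h x j)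
    (hlip : ∀ K : Set (Feat d), IsCompact K → ∃ L, LipschitzOnWith L h K) {R : ℝ} (hR : 0 ≤ R) :
    ∃ K b M : ℝ, 0 ≤ K ∧ 0 < b ∧ 0 ≤ M ∧
      (∀ (x y x' y' : Feat d) (δ : ℝ), ‖x‖ ≤ R → ‖y‖ ≤ R → ‖x'‖ ≤ R → ‖y'‖ ≤ R →
        ‖x - x'‖ ≤ δ → ‖y - y'‖ ≤ δ →
        ∀ j, |x j * h y j - x' j * h y' j| ≤ K * δ ∧ |h y j - h y' j| ≤ K * δ) ∧
      ∀ x y : Feat d, ‖x‖ ≤ R → ‖y‖ ≤ R → ∀ j,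
        b ≤ h y j ∧ |h y j| ≤ M ∧ |x j * h y j| ≤ M ∧ |x j * h y j| ≤ R * h y j := by
  obtain ⟨K, b, M, hK, hb, hM, hl, hbd⟩ := exists_weight_bounds hpos hlip R
  -- By the product rule `M + R * K` is a Lipschitz constant for the product; the extra `K` lets the
  -- same constant serve `h`. Likewise `M + R * M` bounds both functions.
  refine ⟨M + R * K + K, b, M + R * M, by positivity, hb, by positivity, ?_, ?_⟩
  · intro x y x' y' δ hx hy hx' hy' hxx hyy j
    have hδ : 0 ≤ δ := (norm_nonneg _).trans hxx
    have h1 : |h y j - h y' j| ≤ K * δ :=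
      (hl y y' hy hy' j).trans (mul_le_mul_of_nonneg_left hyy hK)
    have h2 : |x j - x' j| ≤ δ := (Feat.abs_apply_le (x - x') j).trans hxx
    have h3 : |h y j| ≤ M := by rw [abs_of_pos (hpos y j)]; exact (hbd y hy j).2
    have h4 : |x' j| ≤ R := (Feat.abs_apply_le x' j).trans hx'
    constructor
    · have : x j * h y j - x' j * h y' j = (x j - x' j) * h y j + x' j * (h y j - h y' j) := by
        ring
      rw [this]
      refine (abs_add_le _ _).trans ?_
      rw [abs_mul, abs_mul]
      have h5 : |x j - x' j| * |h y j| ≤ δ * M := by gcongr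
      have h6 : |x' j| * |h y j - h y' j| ≤ R * (K * δ) := by gcongr
      nlinarith [mul_nonneg hK hδ]
    · have : 0 ≤ (M + R * K) * δ := by positivity
      nlinarith
  · intro x y hx hy j
    have h1 : |x j| ≤ R := (Feat.abs_apply_le x j).trans hx
    have h2 : |x j * h y j| ≤ R * h y j := by
      rw [abs_mul, abs_of_pos (hpos y j)]
      exact mul_le_mul_of_nonneg_right h1 (hpos y j).le
    have h3 : R * h y j ≤ R * M := mul_le_mul_of_nonneg_left (hbd y hy j).2 hR
    refine ⟨(hbd y hy j).1, ?_, ?_, h2⟩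
    · rw [abs_of_pos (hpos y j)]
      have := (hbd y hy j).2
      nlinarith [mul_nonneg hR hM]
    · linarith

namespace LocalLimit

variable {d m : ℕ} (L : LocalLimit d m)

/-- The expectation of `g` under the distribution with community weights `lam`. -/
noncomputable def mix (lam : Fin m → ℝ) (g : Fin m → Feat d → ℝ) : ℝ :=
  ∑ j, lam j * ∫ x, g j x ∂L.F

/-- The limit of weighted means over sets of nodes with community weights `lam`. -/
noncomputable def meanLimit {k : ℕ} (lam : Fin m → ℝ) (h : Feat d → Feat d)
    (eρ eη : (Fin (k + 1) → Feat d) → (Fin (k + 1) → Fin m) → Feat d)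
    (a : Fin k → Feat d) (c : Fin k → Fin m) : Feat d :=
  WithLp.toLp 2 fun i =>
    L.mix lam (fun j x => eρ (Fin.snoc (α := fun _ => Feat d) a x)
        (Fin.snoc (α := fun _ => Fin m) c j) i *
      h (eη (Fin.snoc (α := fun _ => Feat d) a x) (Fin.snoc (α := fun _ => Fin m) c j)) i) /
    L.mix lam (fun j x =>
      h (eη (Fin.snoc (α := fun _ => Feat d) a x) (Fin.snoc (α := fun _ => Fin m) c j)) i)

variable {L}

theorem integrable_of_bound {g : Feat d → ℝ} {M : ℝ} (hc : Continuous g)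
    (hM : ∀ x, |g x| ≤ M) : Integrable g L.F :=
  Integrable.of_bound hc.aestronglyMeasurable M (Eventually.of_forall fun x => by simpa using hM x)

theorem abs_mix_sub_le {lam : Fin m → ℝ} (hlam : ∀ j, 0 ≤ lam j) {g g' : Fin m → Feat d → ℝ}
    {r : ℝ} (hg : ∀ j, Integrable (g j) L.F) (hg' : ∀ j, Integrable (g' j) L.F)
    (h : ∀ j x, |g j x - g' j x| ≤ r) :
    |L.mix lam g - L.mix lam g'| ≤ (∑ j, lam j) * r := by
  unfold mix
  rw [← Finset.sum_sub_distrib, Finset.sum_mul]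
  refine (Finset.abs_sum_le_sum_abs _ _).trans (Finset.sum_le_sum fun j _ => ?_)
  rw [← mul_sub, abs_mul, abs_of_nonneg (hlam j), ← integral_sub (hg j) (hg' j),
    ← Real.norm_eq_abs]
  refine mul_le_mul_of_nonneg_left ?_ (hlam j)
  refine (norm_integral_le_of_norm_le_const (C := r) (Eventually.of_forall fun x => ?_)).trans
    (by simp)
  simpa using h j x

theorem le_mix {lam : Fin m → ℝ} (hlam : ∀ j, 0 ≤ lam j) {g : Fin m → Feat d → ℝ}
    {b : ℝ} (hg : ∀ j, Integrable (g j) L.F) (h : ∀ j x, b ≤ g j x) :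
    (∑ j, lam j) * b ≤ L.mix lam g := by
  unfold mix
  rw [Finset.sum_mul]
  refine Finset.sum_le_sum fun j _ => mul_le_mul_of_nonneg_left ?_ (hlam j)
  calc b = ∫ _x, b ∂L.F := by simp
    _ ≤ _ := integral_mono (integrable_const _) (hg j) (h j)

theorem abs_mix_le {lam : Fin m → ℝ} (hlam : ∀ j, 0 ≤ lam j) {g g' : Fin m → Feat d → ℝ}
    {R : ℝ} (hg' : ∀ j, Integrable (g' j) L.F)
    (h : ∀ j x, |g j x| ≤ R * g' j x) : |L.mix lam g| ≤ R * L.mix lam g' := by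
  unfold mix
  rw [Finset.mul_sum]
  refine (Finset.abs_sum_le_sum_abs _ _).trans (Finset.sum_le_sum fun j _ => ?_)
  rw [abs_mul, abs_of_nonneg (hlam j), mul_left_comm]
  refine mul_le_mul_of_nonneg_left ?_ (hlam j)
  rw [← integral_const_mul, ← Real.norm_eq_abs]
  exact norm_integral_le_of_norm_le ((hg' j).const_mul R)
    (Eventually.of_forall fun x => by simpa using h j x)

/-- The integrands of a limit of weighted means are bounded and Lipschitz. -/
theorem exists_integrand_bounds {k : ℕ}
    {eρ eη : (Fin (k + 1) → Feat d) → (Fin (k + 1) → Fin m) → Feat d} (hρ : Tame eρ)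
    (hη : Tame eη) {h : Feat d → Feat d} (hpos : ∀ x j, 0 < h x j)
    (hlip : ∀ K : Set (Feat d), IsCompact K → ∃ L, LipschitzOnWith L h K) (R₀ : ℝ) :
    ∃ R K b M : ℝ, R₀ ≤ R ∧ 0 ≤ R ∧ 0 ≤ K ∧ 0 < b ∧ 0 ≤ M ∧
      (∀ a c, ‖eρ a c‖ ≤ R) ∧ (∀ a c, ‖eη a c‖ ≤ R) ∧
      (∀ (x y x' y' : Feat d) (δ : ℝ), ‖x‖ ≤ R → ‖y‖ ≤ R → ‖x'‖ ≤ R → ‖y'‖ ≤ R →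
        ‖x - x'‖ ≤ δ → ‖y - y'‖ ≤ δ →
        ∀ i, |x i * h y i - x' i * h y' i| ≤ K * δ ∧ |h y i - h y' i| ≤ K * δ) ∧
      (∀ x y : Feat d, ‖x‖ ≤ R → ‖y‖ ≤ R → ∀ i,
        b ≤ h y i ∧ |h y i| ≤ M ∧ |x i * h y i| ≤ M ∧ |x i * h y i| ≤ R * h y i) ∧
      ∀ c a a' i,
        |eρ a c i * h (eη a c) i - eρ a' c i * h (eη a' c) i| ≤ K * dist a a' ∧
        |h (eη a c) i - h (eη a' c) i| ≤ K * dist a a' := by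
  obtain ⟨K₁, R₁, hl₁, hb₁⟩ := hρ
  obtain ⟨K₂, R₂, hl₂, hb₂⟩ := hη
  -- Including `R₀` gives one ball that contains the values of the controllers and, later, the true
  -- values of the terms.
  set R := max (max R₁ R₂) (max R₀ 0) with hRdef
  have hR : 0 ≤ R := by simp [hRdef]
  obtain ⟨K, b, M, hK, hb, hM, hlip', hbd⟩ := exists_weight_mul_bounds hpos hlip hR
  have hRρ : ∀ a c, ‖eρ a c‖ ≤ R := fun a c => (hb₁ a c).trans (by simp [hRdef])
  have hRη : ∀ a c, ‖eη a c‖ ≤ R := fun a c => (hb₂ a c).trans (by simp [hRdef])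
  refine ⟨R, max K (K * (K₁ + K₂)), b, M, by simp [hRdef], hR, by positivity, hb, hM, hRρ, hRη,
    ?_, hbd, ?_⟩
  · intro x y x' y' δ hx hy hx' hy' hxx hyy i
    have hδ : 0 ≤ δ := (norm_nonneg _).trans hxx
    obtain ⟨h1, h2⟩ := hlip' x y x' y' δ hx hy hx' hy' hxx hyy i
    have h3 : K * δ ≤ max K (K * (K₁ + K₂)) * δ :=
      mul_le_mul_of_nonneg_right (le_max_left _ _) hδ
    exact ⟨h1.trans h3, h2.trans h3⟩
  · intro c a a' i
    have hd : 0 ≤ dist a a' := dist_nonneg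
    have h1 : ‖eρ a c - eρ a' c‖ ≤ (K₁ + K₂) * dist a a' := by
      rw [← dist_eq_norm]
      refine ((hl₁ c).dist_le_mul a a').trans (mul_le_mul_of_nonneg_right ?_ hd)
      simp
    have h2 : ‖eη a c - eη a' c‖ ≤ (K₁ + K₂) * dist a a' := by
      rw [← dist_eq_norm]
      refine ((hl₂ c).dist_le_mul a a').trans (mul_le_mul_of_nonneg_right ?_ hd)
      simp
    obtain ⟨h4, h5⟩ := hlip' _ _ _ _ _ (hRρ a c) (hRη a c) (hRρ a' c) (hRη a' c) h1 h2 i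
    have h3 : K * ((K₁ + K₂) * dist a a') ≤ max K (K * (K₁ + K₂)) * dist a a' := by
      rw [← mul_assoc]
      exact mul_le_mul_of_nonneg_right (le_max_right _ _) hd
    exact ⟨h4.trans h3, h5.trans h3⟩

theorem continuous_of_abs_sub_le {X : Type*} [PseudoMetricSpace X] {g : X → ℝ} {K : ℝ}
    (h : ∀ x y, |g x - g y| ≤ K * dist x y) : Continuous g :=
  (LipschitzWith.of_dist_le' (K := K) fun x y => by
    simpa [Real.dist_eq] using h x y).continuous

/-- Here `0 / 0 = 0` matches the convention for means over an empty neighbourhood, so that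
communities without neighbours need no separate controller. -/
theorem meanLimit_eq_zero {k : ℕ} {lam : Fin m → ℝ} (hlam : ∀ j, lam j = 0)
    (h : Feat d → Feat d) (eρ eη : (Fin (k + 1) → Feat d) → (Fin (k + 1) → Fin m) → Feat d)
    (a : Fin k → Feat d) (c : Fin k → Fin m) : L.meanLimit lam h eρ eη a c = 0 := by
  ext i
  simp [meanLimit, mix, hlam]

/-- Numerator and denominator are integrals of functions Lipschitz in `a`, and the denominator is at
least `b` times the total weight. Where that weight vanishes the limit is constantly zero. There are
finitely many `c`, so the Lipschitz constants have a common bound. -/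
theorem tame_meanLimit {k : ℕ} {lam : (Fin k → Fin m) → Fin m → ℝ} (hlam : ∀ c j, 0 ≤ lam c j)
    {eρ eη : (Fin (k + 1) → Feat d) → (Fin (k + 1) → Fin m) → Feat d} (hρ : Tame eρ)
    (hη : Tame eη) {h : Feat d → Feat d} (hpos : ∀ x j, 0 < h x j)
    (hlip : ∀ K : Set (Feat d), IsCompact K → ∃ L, LipschitzOnWith L h K) :
    Tame fun a c => L.meanLimit (lam c) h eρ eη a c := by
  obtain ⟨R, K, b, M, -, hR, hK, hb, hM, hRρ, hRη, -, hbd, hl⟩ :=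
    exists_integrand_bounds hρ hη hpos hlip 0
  have hc1 : ∀ (c : Fin k → Fin m) (a : Fin k → Feat d) j i,
      Integrable (fun x => eρ (Fin.snoc (α := fun _ => Feat d) a x)
        (Fin.snoc (α := fun _ => Fin m) c j) i *
      h (eη (Fin.snoc (α := fun _ => Feat d) a x) (Fin.snoc (α := fun _ => Fin m) c j)) i)
      L.F := fun c a j i =>
    integrable_of_bound (continuous_of_abs_sub_le (K := K) fun x y => (hl _ _ _ i).1.trans
      (mul_le_mul_of_nonneg_left ((dist_snoc_le a a x y).trans (by simp)) hK))
      fun x => (hbd _ _ (hRρ _ _) (hRη _ _) i).2.2.1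
  have hc2 : ∀ (c : Fin k → Fin m) (a : Fin k → Feat d) j i, Integrable (fun x =>
      h (eη (Fin.snoc (α := fun _ => Feat d) a x) (Fin.snoc (α := fun _ => Fin m) c j)) i)
      L.F := fun c a j i =>
    integrable_of_bound (continuous_of_abs_sub_le (K := K) fun x y => (hl _ _ _ i).2.trans
      (mul_le_mul_of_nonneg_left ((dist_snoc_le a a x y).trans (by simp)) hK))
      fun x => (hbd _ _ (hRρ (Fin.snoc (α := fun _ => Feat d) a x)
        (Fin.snoc (α := fun _ => Fin m) c j)) (hRη _ _) i).2.1
  have hmix : ∀ (c : Fin k → Fin m) (a : Fin k → Feat d) i,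
      |L.mix (lam c) (fun j x => eρ (Fin.snoc (α := fun _ => Feat d) a x)
        (Fin.snoc (α := fun _ => Fin m) c j) i *
        h (eη (Fin.snoc (α := fun _ => Feat d) a x) (Fin.snoc (α := fun _ => Fin m) c j)) i)| ≤
      R * L.mix (lam c) (fun j x => h (eη (Fin.snoc (α := fun _ => Feat d) a x)
        (Fin.snoc (α := fun _ => Fin m) c j)) i) := fun c a i =>
    abs_mix_le (hlam c) (fun j => hc2 c a j i)
      fun j x => (hbd _ _ (hRρ _ _) (hRη _ _) i).2.2.2
  have hmix0 : ∀ (c : Fin k → Fin m) (a : Fin k → Feat d) i, (∑ j, lam c j) * b ≤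
      L.mix (lam c) (fun j x => h (eη (Fin.snoc (α := fun _ => Feat d) a x)
        (Fin.snoc (α := fun _ => Fin m) c j)) i) := fun c a i =>
    le_mix (hlam c) (fun j => hc2 c a j i) fun j x =>
      (hbd _ _ (hRρ (Fin.snoc (α := fun _ => Feat d) a x)
        (Fin.snoc (α := fun _ => Fin m) c j)) (hRη _ _) i).1
  have hLip : ∀ c, ∃ K' : NNReal, LipschitzWith K' fun a => L.meanLimit (lam c) h eρ eη a c := by
    intro c
    rcases (Finset.sum_nonneg fun j (_ : j ∈ Finset.univ) => hlam c j).eq_or_lt with h0 | h0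
    · have h0' : ∀ j, lam c j = 0 := fun j =>
        (Finset.sum_eq_zero_iff_of_nonneg fun j _ => hlam c j).1 h0.symm j (Finset.mem_univ j)
      exact ⟨0, by simp [meanLimit_eq_zero h0']⟩
    · refine ⟨_, LipschitzWith.of_dist_le' (K := d * (((∑ j, lam c j) * K + R *
        ((∑ j, lam c j) * K)) / ((∑ j, lam c j) * b))) fun a a' => ?_⟩
      rw [dist_eq_norm, mul_assoc]
      refine Feat.norm_le_of_abs_le fun i => ?_
      have hpos' : 0 < (∑ j, lam c j) * b := mul_pos h0 hb
      refine (abs_div_sub_div_le (hpos'.trans_le (hmix0 c a i)) hpos' (hmix0 c a' i)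
        (hmix c a i)).trans ?_
      have h1 := abs_mix_sub_le (hlam c) (fun j => hc1 c a j i) (fun j => hc1 c a' j i)
        (r := K * dist a a') fun j x => (hl _ _ _ i).1.trans
          (mul_le_mul_of_nonneg_left ((dist_snoc_le a a' x x).trans (by simp)) hK)
      have h2 := abs_mix_sub_le (hlam c) (fun j => hc2 c a j i) (fun j => hc2 c a' j i)
        (r := K * dist a a') fun j x => (hl _ _ _ i).2.trans
          (mul_le_mul_of_nonneg_left ((dist_snoc_le a a' x x).trans (by simp)) hK)
      rw [div_mul_eq_mul_div]
      refine div_le_div_of_nonneg_right ?_ hpos'.le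
      have h3 := mul_le_mul_of_nonneg_left h2 hR
      linarith
  choose K' hK' using hLip
  refine ⟨Finset.univ.sup K', d * R, fun c => (hK' c).weaken (Finset.le_sup (Finset.mem_univ c)),
    fun a c => Feat.norm_le_of_abs_le fun i => ?_⟩
  simp only [meanLimit]
  rw [abs_div]
  have h0 : 0 ≤ L.mix (lam c) (fun j x => h (eη (Fin.snoc (α := fun _ => Feat d) a x)
        (Fin.snoc (α := fun _ => Fin m) c j)) i) :=
    le_trans (mul_nonneg (Finset.sum_nonneg fun j _ => hlam c j) hb.le) (hmix0 c a i)
  rw [abs_of_nonneg h0]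
  exact div_le_of_le_mul₀ h0 hR (hmix c a i)

end LocalLimit

/-! ### Convergence of weighted means over balanced sets, and growth of degrees. -/

namespace LocalLimit

variable {d m : ℕ} {L : LocalLimit d m}

/-- Weighted means over balanced sets are close to their limits, if most of the values are close
to the values of the controllers. -/
theorem weightedMean_close {k : ℕ} {lam : Fin m → ℝ} (hlam : ∀ j, 0 ≤ lam j)
    (hΛ : 0 < ∑ j, lam j)
    {eρ eη : (Fin (k + 1) → Feat d) → (Fin (k + 1) → Fin m) → Feat d} (hρ : Tame eρ)
    (hη : Tame eη) {h : Feat d → Feat d} (hpos : ∀ x j, 0 < h x j)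
    (hlip : ∀ K : Set (Feat d), IsCompact K → ∃ L, LipschitzOnWith L h K) (R₀ : ℝ)
    {ε : ℝ} (hε : 0 < ε) :
    ∀ᶠ r : ℝ in 𝓝[>] 0, ∀ᶠ N : ℕ in atTop, ∀ {V : Type} (H : V → Feat d) (C : V → Fin m) (s : ℝ)
      (S : Finset V), 0 < s → (∀ v, ‖H v‖ ≤ L.B) → L.Balanced N H C s lam (S : Set V) →
      ∀ (a : Fin k → Feat d) (c : Fin k → Fin m) (ρ η : V → Feat d),
      (∀ v, ‖ρ v‖ ≤ R₀) → (∀ v, ‖η v‖ ≤ R₀) →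
      (({v ∈ (S : Set V) | ¬ (‖eρ (Fin.snoc (α := fun _ => Feat d) a (H v))
          (Fin.snoc (α := fun _ => Fin m) c (C v)) - ρ v‖ < r ∧
        ‖eη (Fin.snoc (α := fun _ => Feat d) a (H v))
          (Fin.snoc (α := fun _ => Fin m) c (C v)) - η v‖ < r)}.ncard : ℝ) ≤ r * s) →
      ‖L.meanLimit lam h eρ eη a c - weightedMean S ρ (fun v => h (η v))‖ < ε := by
  classical
  obtain ⟨R, K, b, M, hRR, hR, hK, hb, hM, hRρ, hRη, hpert, hbd, hl⟩ :=
    exists_integrand_bounds hρ hη hpos hlip R₀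
  set Λ := ∑ j, lam j with hΛdef
  -- `T` measures the effect of `r`: an error `K r` at each of at most `s (Λ + 1)` nodes, and `2 M`
  -- at each of at most `r s` exceptional nodes. `T'` is the error constant for sums over balanced
  -- sets.
  set T : ℝ := (Λ + 1) * K + 2 * M with hT
  set T' : ℝ := M + 2 * K * (2 * Λ + 1) with hT'
  have hT0 : 0 ≤ T := by positivity
  have hlim : Tendsto (fun r : ℝ => d * ((1 + R) * (T * r) / (b * (Λ / 2)))) (𝓝[>] 0)
      (𝓝 (d * ((1 + R) * (T * 0) / (b * (Λ / 2))))) := by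
    refine Tendsto.mono_left ?_ nhdsWithin_le_nhds
    exact Continuous.tendsto (by fun_prop) 0
  have hlim' : Tendsto (fun N : ℕ => d * ((1 + R) * (T' * (1 / ((N : ℝ) + 1))) / (b * (Λ / 2))))
      atTop (𝓝 (d * ((1 + R) * (T' * 0) / (b * (Λ / 2))))) := by
    have h1 := tendsto_one_div_add_atTop_nhds_zero_nat (𝕜 := ℝ)
    exact (((h1.const_mul T').const_mul (1 + R)).div_const _).const_mul _
  simp only [mul_zero, zero_div] at hlim hlim'
  -- The precision `r` asked of the subterms is fixed before the level `N`; each is responsible for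
  -- `ε / 2`. The second condition on `N` ensures that `S` has at least `s Λ / 2` elements, which
  -- bounds the denominator from below.
  filter_upwards [hlim.eventually (gt_mem_nhds (half_pos hε)), self_mem_nhdsWithin] with r hr hr0
  filter_upwards [hlim'.eventually (gt_mem_nhds (half_pos hε)),
    (tendsto_one_div_add_atTop_nhds_zero_nat (𝕜 := ℝ)).eventually (gt_mem_nhds (half_pos hΛ))]
    with N hN hN'
  intro V H C s S hs hH hbal a c ρ η hρR hηR hbad
  replace hr0 : 0 < r := hr0
  suffices hmain : ∀ i, |(L.meanLimit lam h eρ eη a c - weightedMean S ρ (fun v => h (η v))) i| ≤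
      (1 + R) * (T * r) / (b * (Λ / 2)) + (1 + R) * (T' * (1 / ((N : ℝ) + 1))) / (b * (Λ / 2)) by
    refine (Feat.norm_le_of_abs_le hmain).trans_lt ?_
    rw [mul_add]; linarith
  intro i
  let g₁ : Fin m → Feat d → ℝ := fun j x => eρ (Fin.snoc (α := fun _ => Feat d) a x)
        (Fin.snoc (α := fun _ => Fin m) c j) i *
      h (eη (Fin.snoc (α := fun _ => Feat d) a x) (Fin.snoc (α := fun _ => Fin m) c j)) i
  let g₂ : Fin m → Feat d → ℝ := fun j x =>
    h (eη (Fin.snoc (α := fun _ => Feat d) a x) (Fin.snoc (α := fun _ => Fin m) c j)) i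
  have hg : ∀ j x, b ≤ g₂ j x ∧ |g₂ j x| ≤ M ∧ |g₁ j x| ≤ M ∧ |g₁ j x| ≤ R * g₂ j x :=
    fun j x => hbd _ _ (hRρ _ _) (hRη _ _) i
  have hgl : ∀ j x y, |g₁ j x - g₁ j y| ≤ K * dist x y ∧ |g₂ j x - g₂ j y| ≤ K * dist x y := by
    intro j x y
    have hd := mul_le_mul_of_nonneg_left
      ((dist_snoc_le a a x y).trans (by simp : _ ≤ dist x y)) hK
    exact ⟨(hl _ _ _ i).1.trans hd, (hl _ _ _ i).2.trans hd⟩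
  have hgc₁ : ∀ j, Continuous (g₁ j) := fun j =>
    continuous_of_abs_sub_le (K := K) fun x y => (hgl j x y).1
  have hgc₂ : ∀ j, Continuous (g₂ j) := fun j =>
    continuous_of_abs_sub_le (K := K) fun x y => (hgl j x y).2
  have hgi₂ : ∀ j, Integrable (g₂ j) L.F := fun j =>
    integrable_of_bound (hgc₂ j) fun x => (hg j x).2.1
  have hcard := abs_le.1 (Balanced.abs_card_sub_le L hs.le hbal)
  rw [← hΛdef] at hcard
  have hN1 : s / ((N : ℝ) + 1) = s * (1 / ((N : ℝ) + 1)) := by ring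
  have hN0 : 1 / ((N : ℝ) + 1) ≤ 1 := by
    rw [div_le_one (by positivity)]; linarith [Nat.cast_nonneg (α := ℝ) N]
  have hcard1 : (S.card : ℝ) ≤ s * (Λ + 1) := by
    have := mul_le_mul_of_nonneg_left hN0 hs.le
    rw [hN1] at hcard; linarith [hcard.2]
  have hcard2 : s * (Λ / 2) ≤ S.card := by
    have := mul_lt_mul_of_pos_left hN' hs
    rw [hN1] at hcard; linarith [hcard.1]
  -- the sums over `S` of the true values and of the controllers
  have hcmp : ∀ (f f' : V → ℝ), (∀ v, |f v| ≤ M) → (∀ v, |f' v| ≤ M) →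
      (∀ v ∈ S, (‖eρ (Fin.snoc (α := fun _ => Feat d) a (H v))
          (Fin.snoc (α := fun _ => Fin m) c (C v)) - ρ v‖ < r ∧
        ‖eη (Fin.snoc (α := fun _ => Feat d) a (H v))
          (Fin.snoc (α := fun _ => Fin m) c (C v)) - η v‖ < r) → |f v - f' v| ≤ K * r) →
      |∑ v ∈ S, f v - ∑ v ∈ S, f' v| ≤ s * (T * r) := by
    intro f f' hf hf' hff
    set bad := S.filter fun v => ¬ (‖eρ (Fin.snoc (α := fun _ => Feat d) a (H v))
          (Fin.snoc (α := fun _ => Fin m) c (C v)) - ρ v‖ < r ∧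
        ‖eη (Fin.snoc (α := fun _ => Feat d) a (H v))
          (Fin.snoc (α := fun _ => Fin m) c (C v)) - η v‖ < r) with hbaddef
    have hbc : (bad.card : ℝ) ≤ r * s := by
      rw [← Set.ncard_coe_finset]
      convert hbad using 4
      ext v; simp [hbaddef]
    rw [← Finset.sum_sub_distrib]
    refine (Finset.abs_sum_le_sum_abs _ _).trans ?_
    have h1 : ∀ v ∈ S, |f v - f' v| ≤ K * r + if v ∈ bad then 2 * M else 0 := by
      intro v hv
      by_cases hvb : v ∈ bad
      · rw [if_pos hvb]
        have : |f v - f' v| ≤ |f v| + |f' v| := abs_sub _ _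
        have := hf v
        have := hf' v
        nlinarith [mul_nonneg hK hr0.le]
      · rw [if_neg hvb, add_zero]
        refine hff v hv ?_
        by_contra hcon
        exact hvb (Finset.mem_filter.2 ⟨hv, hcon⟩)
    refine (Finset.sum_le_sum h1).trans ?_
    rw [Finset.sum_add_distrib, Finset.sum_const, nsmul_eq_mul, Finset.sum_ite_mem,
      Finset.inter_eq_right.2 (Finset.filter_subset _ _), Finset.sum_const, nsmul_eq_mul]
    have h2 : (S.card : ℝ) * (K * r) ≤ s * (Λ + 1) * (K * r) := by gcongr
    have h3 : (bad.card : ℝ) * (2 * M) ≤ r * s * (2 * M) := by gcongr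
    calc _ ≤ s * (Λ + 1) * (K * r) + r * s * (2 * M) := add_le_add h2 h3
      _ = _ := by rw [hT]; ring
  have hρR' : ∀ v, ‖ρ v‖ ≤ R := fun v => (hρR v).trans hRR
  have hηR' : ∀ v, ‖η v‖ ≤ R := fun v => (hηR v).trans hRR
  have hval : ∀ v, b ≤ h (η v) i ∧ |h (η v) i| ≤ M ∧ |ρ v i * h (η v) i| ≤ M ∧
      |ρ v i * h (η v) i| ≤ R * h (η v) i := fun v => hbd _ _ (hρR' v) (hηR' v) i
  have hA1 := hcmp (fun v => g₁ (C v) (H v)) (fun v => ρ v i * h (η v) i)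
    (fun v => (hg _ _).2.2.1) (fun v => (hval v).2.2.1)
    fun v _ hv => (hpert _ _ _ _ r (hRρ _ _) (hRη _ _) (hρR' v) (hηR' v) hv.1.le hv.2.le i).1
  have hD1 := hcmp (fun v => g₂ (C v) (H v)) (fun v => h (η v) i)
    (fun v => (hg _ _).2.1) (fun v => (hval v).2.1)
    fun v _ hv => (hpert _ _ _ _ r (hRρ _ _) (hRη _ _) (hρR' v) (hηR' v) hv.1.le hv.2.le i).2
  have hA2 := Balanced.abs_sum_sub_le L hs.le hlam hH hbal hM hK (fun j x => (hg j x).2.2.1)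
    (fun j x y => (hgl j x y).1) hgc₁
  have hD2 := Balanced.abs_sum_sub_le L hs.le hlam hH hbal hM hK (fun j x => (hg j x).2.1)
    (fun j x y => (hgl j x y).2) hgc₂
  have hE : ∀ {x y z : ℝ}, |y - z| ≤ s * (T * r) → |y - x| ≤ s * (T' / ((N : ℝ) + 1)) →
      |x - z| ≤ s * (T * r) + s * (T' / ((N : ℝ) + 1)) := by
    intro x y z h1 h2
    refine (abs_sub_le x y z).trans ?_
    rw [abs_sub_comm x y]; linarith
  have hA := hE hA1 hA2
  have hD := hE hD1 hD2
  have hmix0 : Λ * b ≤ L.mix lam g₂ := le_mix hlam hgi₂ fun j x => (hg j x).1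
  have hmix : |L.mix lam g₁| ≤ R * L.mix lam g₂ := abs_mix_le hlam hgi₂ fun j x => (hg j x).2.2.2
  have hmixpos : 0 < L.mix lam g₂ := lt_of_lt_of_le (by positivity) hmix0
  have hden : s * (b * (Λ / 2)) ≤ ∑ v ∈ S, h (η v) i := by
    calc s * (b * (Λ / 2)) = s * (Λ / 2) * b := by ring
      _ ≤ S.card * b := mul_le_mul_of_nonneg_right hcard2 hb.le
      _ = ∑ v ∈ S, b := by simp
      _ ≤ _ := Finset.sum_le_sum fun v _ => (hval v).1
  have hD₀ : 0 < s * (b * (Λ / 2)) := by positivity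
  have hnum : |s * L.mix lam g₁| ≤ R * (s * L.mix lam g₂) := by
    rw [abs_mul, abs_of_pos hs, mul_left_comm]
    exact mul_le_mul_of_nonneg_left hmix hs.le
  -- The limit is expanded by the scale `s`, so that both quotients have numerators and denominators
  -- of order `s`.
  have key := abs_div_sub_div_le (A := s * L.mix lam g₁) (D := s * L.mix lam g₂)
    (A' := ∑ v ∈ S, ρ v i * h (η v) i) (by positivity) hD₀ hden hnum
  rw [mul_div_mul_left _ _ hs.ne'] at key
  refine key.trans ?_
  unfold mix
  rw [div_le_iff₀ hD₀]
  have h9 : ((1 + R) * (T * r) / (b * (Λ / 2)) +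
      (1 + R) * (T' * (1 / ((N : ℝ) + 1))) / (b * (Λ / 2))) * (s * (b * (Λ / 2))) =
      (1 + R) * (s * (T * r) + s * (T' / ((N : ℝ) + 1))) := by
    field_simp
  rw [h9]
  have h10 := mul_le_mul_of_nonneg_left hD hR
  linarith

/-- Nodes with good neighbours and at least one neighbour have large degree. -/
theorem eventually_degree_large {r : ℝ} (hr : 0 < r) :
    ∀ᶠ N : ℕ in atTop, ∀ {V : Type} [Fintype V] (G : SimpleGraph V) (H : V → Feat d)
      (C : V → Fin m) (s : ℝ) (w x : V) [Fintype (G.neighborSet w)], (N : ℝ) + 1 ≤ s →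
      (∀ v, (∀ j, L.lam (C v) j = 0) → ∀ w, ¬ G.Adj v w) → G.Adj w x →
      L.Good N G H C s 0 w → 1 ≤ r * G.degree w := by
  classical
  -- If a row of `lam` vanishes, nodes of that community have no neighbours. Otherwise, with row sum
  -- `Λ`, the degree of a balanced node is at least `s Λ / 2 ≥ (N + 1) Λ / 2`, which eventually
  -- exceeds `1 / r`.
  have h1 : ∀ i, ∀ᶠ N : ℕ in atTop, (∑ j, L.lam i j = 0 ∨
      1 / r + 1 ≤ ((N : ℝ) + 1) * ∑ j, L.lam i j ∧ 1 / ((N : ℝ) + 1) ≤ (∑ j, L.lam i j) / 2 ∧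
      2 / r ≤ ((N : ℝ) + 1) * ∑ j, L.lam i j) := by
    intro i
    rcases (Finset.sum_nonneg fun j (_ : j ∈ Finset.univ) => L.lam_nonneg i j).eq_or_lt with h0 | h0
    · exact Eventually.of_forall fun N => Or.inl h0.symm
    · have ht : Tendsto (fun N : ℕ => ((N : ℝ) + 1) * ∑ j, L.lam i j) atTop atTop :=
        (tendsto_atTop_add_const_right _ _ tendsto_natCast_atTop_atTop).atTop_mul_const h0
      filter_upwards [ht.eventually_ge_atTop (1 / r + 1), ht.eventually_ge_atTop (2 / r),
        (tendsto_one_div_add_atTop_nhds_zero_nat (𝕜 := ℝ)).eventually (ge_mem_nhds (half_pos h0))]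
        with N h1 h2 h3
      exact Or.inr ⟨h1, h3, h2⟩
  filter_upwards [eventually_all.2 h1] with N hN V _ G H C s w x _ hs hiso hwx hgood
  rcases hN (C w) with h0 | ⟨-, h2, h3⟩
  · have h0' : ∀ j, L.lam (C w) j = 0 := fun j =>
      (Finset.sum_eq_zero_iff_of_nonneg fun j _ => L.lam_nonneg _ j).1 h0 j (Finset.mem_univ j)
    exact absurd hwx (hiso w h0' x)
  · have hs0 : 0 < s := lt_of_lt_of_le (by positivity) hs
    have hb : L.Balanced N H C s (L.lam (C w)) ((G.neighborFinset w : Finset V) : Set V) := by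
      rw [SimpleGraph.coe_neighborFinset]; exact hgood
    have h4 := (abs_le.1 (Balanced.abs_card_sub_le L hs0.le hb)).1
    rw [SimpleGraph.card_neighborFinset_eq_degree] at h4
    have h5 : s / ((N : ℝ) + 1) ≤ s * ((∑ j, L.lam (C w) j) / 2) := by
      rw [div_eq_mul_one_div]; exact mul_le_mul_of_nonneg_left h2 hs0.le
    have h6 : ((N : ℝ) + 1) * ∑ j, L.lam (C w) j ≤ s * ∑ j, L.lam (C w) j :=
      mul_le_mul_of_nonneg_right hs (Finset.sum_nonneg fun j _ => L.lam_nonneg _ j)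
    have h7 : 1 / r ≤ G.degree w := by
      have : 2 / r = 2 * (1 / r) := by ring
      linarith
    rw [div_le_iff₀ hr] at h7
    linarith

end LocalLimit

/-! ### Induction on terms over regular featured graphs. -/

namespace LocalLimit

variable {d m : ℕ}

/-- On regular featured graphs, the controller `e` is close to the values of `π` at tuples of nodes
which are good to depth `D`. -/
def Approximated (L : LocalLimit d m) {k : ℕ} (D : ℕ)
    (e : (Fin k → Feat d) → (Fin k → Fin m) → Feat d) (π : AggTerm d k) : Prop :=
  ∀ ε > (0 : ℝ), ∀ᶠ N : ℕ in atTop, ∀ {V : Type} [Fintype V] (G : SimpleGraph V)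
    (H : V → Feat d) (C : V → Fin m) (s : ℝ), L.Regular N D G H C s →
    ∀ u : Fin k → V, (∀ i, L.Good N G H C s D (u i)) →
      ‖e (fun i => H (u i)) (fun i => C (u i)) - π.interp G H u‖ < ε

variable {L : LocalLimit d m}

-- This serves both random walk embeddings. Depth one is needed because the return bound concerns
-- the degrees of the neighbours of the node, not its own degree.
open Classical in
theorem approximated_zero {k D : ℕ} (hD : 1 ≤ D) (i : Fin k) {π : AggTerm d k}
    (hπ : ∀ {V : Type} [Fintype V] (G : SimpleGraph V) (H : V → Feat d) (u : Fin k → V) (r : ℝ),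
      0 ≤ r → (∀ w, G.Adj w (u i) → 1 ≤ r * G.degree w) → ∀ j, |π.interp G H u j| ≤ r) :
    L.Approximated D (fun _ _ => 0) π := by
  intro ε hε
  have hr : 0 < ε / (d + 1) := by positivity
  filter_upwards [eventually_degree_large (L := L) hr] with N hN V _ G H C s hreg u hu
  rw [zero_sub, norm_neg]
  have h1 : ∀ j, |π.interp G H u j| ≤ ε / (d + 1) := by
    refine hπ G H u _ hr.le fun w hw => ?_
    refine hN G H C s w (u i) hreg.scale hreg.isolated hw ?_
    exact ((hu i).of_le hD).2 w hw.symm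
  refine (Feat.norm_le_of_abs_le h1).trans_lt ?_
  rw [mul_div_assoc', div_lt_iff₀ (by positivity)]
  nlinarith

theorem approximated_app {k r D : ℕ} {f : (Fin r → Feat d) → Feat d}
    (hf : ∃ K, LipschitzWith K f) {ρ : Fin r → AggTerm d k}
    {e : Fin r → (Fin k → Feat d) → (Fin k → Fin m) → Feat d}
    (h : ∀ t, L.Approximated D (e t) (ρ t)) :
    L.Approximated D (fun a c => f fun t => e t a c) (.app f hf ρ) := by
  intro ε hε
  obtain ⟨K, hK⟩ := hf
  have hr : 0 < ε / (K + 1) := by positivity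
  filter_upwards [eventually_all.2 fun t => h t _ hr] with N hN V _ G H C s hreg u hu
  simp only [AggTerm.interp]
  rw [← dist_eq_norm]
  refine (hK.dist_le_mul _ _).trans_lt ?_
  have h1 : dist (fun t => e t (fun i => H (u i)) fun i => C (u i))
      (fun t => (ρ t).interp G H u) ≤ ε / (K + 1) := by
    refine (dist_pi_le_iff hr.le).2 fun t => ?_
    rw [dist_eq_norm]
    exact (hN t G H C s hreg u hu).le
  calc (K : ℝ) * _ ≤ K * (ε / (K + 1)) := mul_le_mul_of_nonneg_left h1 K.2
    _ < ε := by
      rw [mul_div_assoc', div_lt_iff₀ (by positivity)]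
      nlinarith

theorem forall_good_snoc {V : Type} {k N D : ℕ} {G : SimpleGraph V} {H : V → Feat d}
    {C : V → Fin m} {s : ℝ} {u : Fin k → V} (hu : ∀ i, L.Good N G H C s D (u i)) {v : V}
    (hv : L.Good N G H C s D v) :
    ∀ i, L.Good N G H C s D (Fin.snoc (α := fun _ => V) u v i) := by
  intro i
  refine Fin.lastCases ?_ (fun i => ?_) i
  · simpa using hv
  · simpa using hu i

/-- Adding a good node to a good tuple leaves it good, so the controllers of the subterms can fail
only at bad nodes `v`; regularity makes these a proportion of at most `1 / (N + 1)`, eventually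
below the permitted `r`. -/
theorem approximated_globalMean {k D : ℕ} {h : Feat d → Feat d} {hpos : ∀ x j, 0 < h x j}
    {hlip : ∀ K : Set (Feat d), IsCompact K → ∃ L, LipschitzOnWith L h K}
    {ρ η : AggTerm d (k + 1)}
    {eρ eη : (Fin (k + 1) → Feat d) → (Fin (k + 1) → Fin m) → Feat d} (tρ : Tame eρ)
    (tη : Tame eη) (hρ : L.Approximated D eρ ρ) (hη : L.Approximated D eη η) :
    L.Approximated D (fun a c => L.meanLimit L.q h eρ eη a c)
      (.globalMean h hpos hlip ρ η) := by
  classical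
  intro ε hε
  obtain ⟨R₁, -, hR₁⟩ := exists_interp_bound L.B L.B_nonneg ρ
  obtain ⟨R₂, -, hR₂⟩ := exists_interp_bound L.B L.B_nonneg η
  obtain ⟨r, hr, hr0⟩ := ((weightedMean_close L.q_nonneg L.q_sum tρ tη hpos hlip (max R₁ R₂)
    hε).and self_mem_nhdsWithin).exists
  replace hr0 : 0 < r := hr0
  filter_upwards [hr, hρ r hr0, hη r hr0,
    (tendsto_one_div_add_atTop_nhds_zero_nat (𝕜 := ℝ)).eventually (ge_mem_nhds hr0)]
    with N hN h1 h2 h3 V _ G H C s hreg u hu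
  have hV : (0 : ℝ) < Fintype.card V := by
    have := hreg.nonempty
    exact_mod_cast Fintype.card_pos
  simp only [AggTerm.interp]
  refine hN H C (Fintype.card V) Finset.univ hV hreg.norm_le
    (by simpa using hreg.balanced) _ _ _ _
    (fun v => (hR₁ G H hreg.norm_le _).trans (le_max_left _ _))
    (fun v => (hR₂ G H hreg.norm_le _).trans (le_max_right _ _)) ?_
  calc _ ≤ ({v | ¬ L.Good N G H C s D v}.ncard : ℝ) := by
        refine Nat.cast_le.2 (Set.ncard_le_ncard (fun v hv hgood => hv.2 ?_) (Set.toFinite _))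
        have h4 := h1 G H C s hreg _ (forall_good_snoc hu hgood)
        have h5 := h2 G H C s hreg _ (forall_good_snoc hu hgood)
        rw [comp_snoc_eq, comp_snoc_eq] at h4 h5
        exact ⟨h4, h5⟩
    _ ≤ Fintype.card V / ((N : ℝ) + 1) := hreg.bad_le
    _ = 1 / ((N : ℝ) + 1) * Fintype.card V := by ring
    _ ≤ _ := mul_le_mul_of_nonneg_right h3 hV.le

/-- At depth `D + 1` all neighbours are good to depth `D`, so no summand is exceptional. This is why
the depth rises: a single bad node could dominate some neighbourhoods, which a global count of bad
nodes does not prevent. -/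
theorem approximated_localMean {k D : ℕ} {i : Fin k} {h : Feat d → Feat d}
    {hpos : ∀ x j, 0 < h x j}
    {hlip : ∀ K : Set (Feat d), IsCompact K → ∃ L, LipschitzOnWith L h K}
    {ρ η : AggTerm d (k + 1)}
    {eρ eη : (Fin (k + 1) → Feat d) → (Fin (k + 1) → Fin m) → Feat d} (tρ : Tame eρ)
    (tη : Tame eη) (hρ : L.Approximated D eρ ρ) (hη : L.Approximated D eη η) :
    L.Approximated (D + 1) (fun a c => L.meanLimit (L.lam (c i)) h eρ eη a c)
      (.localMean i h hpos hlip ρ η) := by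
  classical
  intro ε hε
  obtain ⟨R₁, -, hR₁⟩ := exists_interp_bound L.B L.B_nonneg ρ
  obtain ⟨R₂, -, hR₂⟩ := exists_interp_bound L.B L.B_nonneg η
  -- The limit depends on the community of `u i`; as there are finitely many, one `r` serves all
  -- those with neighbours.
  have hclose := eventually_all.2 fun l : {l // 0 < ∑ j, L.lam l j} =>
    weightedMean_close (L := L) (k := k) (L.lam_nonneg l.1) l.2 tρ tη hpos hlip (max R₁ R₂) hε
  obtain ⟨r, hr, hr0⟩ := (hclose.and self_mem_nhdsWithin).exists
  replace hr0 : 0 < r := hr0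
  filter_upwards [eventually_all.2 hr, hρ r hr0, hη r hr0] with N hN h1 h2 V _ G H C s hreg u hu
  have hs : 0 < s := lt_of_lt_of_le (by positivity) hreg.scale
  have hreg' : L.Regular N D G H C s := hreg.of_le (Nat.le_succ D)
  have hu' : ∀ i, L.Good N G H C s D (u i) := fun i => (hu i).1
  simp only [AggTerm.interp]
  rcases (Finset.sum_nonneg fun j (_ : j ∈ Finset.univ) =>
    L.lam_nonneg (C (u i)) j).eq_or_lt with h0 | h0
  · have h0' : ∀ j, L.lam (C (u i)) j = 0 := fun j =>
      (Finset.sum_eq_zero_iff_of_nonneg fun j _ => L.lam_nonneg _ j).1 h0.symm j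
        (Finset.mem_univ j)
    have hnb : G.neighborFinset (u i) = ∅ := by
      ext w; simpa using hreg.isolated (u i) h0' w
    rw [meanLimit_eq_zero h0', hnb, zero_sub, norm_neg]
    have : weightedMean (∅ : Finset V) (fun v => ρ.interp G H (Fin.snoc (α := fun _ => V) u v))
        (fun v => h (η.interp G H (Fin.snoc (α := fun _ => V) u v))) = 0 := by
      ext j; simp [weightedMean]
    rw [this, norm_zero]
    exact hε
  · refine hN ⟨C (u i), h0⟩ H C s (G.neighborFinset (u i)) hs hreg.norm_le ?_ _ _ _ _
      (fun v => (hR₁ G H hreg.norm_le _).trans (le_max_left _ _))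
      (fun v => (hR₂ G H hreg.norm_le _).trans (le_max_right _ _)) ?_
    · rw [SimpleGraph.coe_neighborFinset]
      exact (hu i).of_le (Nat.zero_le _)
    · rw [Set.ncard_eq_zero (Set.toFinite _) |>.2]
      · rw [Nat.cast_zero]; positivity
      · refine Set.eq_empty_iff_forall_notMem.2 fun v hv => hv.2 ?_
        have hgood : L.Good N G H C s D v := (hu i).2 v (by simpa using hv.1)
        have h4 := h1 G H C s hreg' _ (forall_good_snoc hu' hgood)
        have h5 := h2 G H C s hreg' _ (forall_good_snoc hu' hgood)
        rw [comp_snoc_eq, comp_snoc_eq] at h4 h5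
        exact ⟨h4, h5⟩

theorem tame_app {k r : ℕ} {f : (Fin r → Feat d) → Feat d} (hf : ∃ K, LipschitzWith K f)
    {e : Fin r → (Fin k → Feat d) → (Fin k → Fin m) → Feat d} (h : ∀ t, Tame (e t)) :
    Tame fun a c => f fun t => e t a c := by
  obtain ⟨K, hK⟩ := hf
  choose K' M hl hb using h
  have hle : ∀ t, K' t ≤ Finset.univ.sup K' := fun t => Finset.le_sup (Finset.mem_univ t)
  refine ⟨K * Finset.univ.sup K', ‖f 0‖ + K * ∑ t, |M t|, fun c => ?_, fun a c => ?_⟩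
  · refine hK.comp (LipschitzWith.of_dist_le_mul fun a a' => ?_)
    refine (dist_pi_le_iff (by positivity)).2 fun t => ?_
    exact (((hl t c).weaken (hle t)).dist_le_mul a a')
  · have h1 := hK.dist_le_mul (fun t => e t a c) 0
    have h2 : dist (fun t => e t a c) 0 ≤ ∑ t, |M t| := by
      refine (dist_pi_le_iff (Finset.sum_nonneg fun t _ => abs_nonneg _)).2 fun t => ?_
      rw [Pi.zero_apply, dist_zero_right]
      exact ((hb t a c).trans (le_abs_self _)).trans
        (Finset.single_le_sum (f := fun t => |M t|) (fun t _ => abs_nonneg _) (Finset.mem_univ t))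
    rw [dist_eq_norm] at h1
    have h3 := norm_le_norm_add_norm_sub (f 0) (f fun t => e t a c)
    have h4 : (K : ℝ) * dist (fun t => e t a c) 0 ≤ K * ∑ t, |M t| := by gcongr
    rw [norm_sub_rev] at h3
    change ‖f fun t => e t a c‖ ≤ _
    linarith

/-- Every term is approximated by a tame controller. -/
theorem exists_tame_approximated (L : LocalLimit d m) {k : ℕ} (π : AggTerm d k) :
    ∃ e : (Fin k → Feat d) → (Fin k → Fin m) → Feat d,
      Tame e ∧ ∀ᶠ D in atTop, L.Approximated D e π := by
  induction π with
  | feature i =>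
    -- Truncation makes the projection bounded, as tameness requires, and changes nothing on
    -- features of norm at most `L.B`.
    refine ⟨fun a _ => Feat.clip L.B (a i), ⟨1, d * L.B, fun c => ?_, fun a c =>
      Feat.norm_clip_le L.B_nonneg _⟩, Eventually.of_forall fun D ε hε =>
      Eventually.of_forall fun N V _ G H C s hreg u hu => ?_⟩
    · rw [← mul_one 1]
      exact (Feat.lipschitzWith_clip L.B).comp (LipschitzWith.eval i)
    · simpa [AggTerm.interp, Feat.clip_eq_self (hreg.norm_le (u i))] using hε
  | rwProb i =>
    refine ⟨fun _ _ => 0, ⟨0, 0, fun c => LipschitzWith.const _, by simp⟩, ?_⟩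
    filter_upwards [eventually_ge_atTop 1] with D hD
    exact approximated_zero hD i fun G H u r hr h j => abs_rwProbEmb_le G hr h j
  | rwCount i =>
    refine ⟨fun _ _ => 0, ⟨0, 0, fun c => LipschitzWith.const _, by simp⟩, ?_⟩
    filter_upwards [eventually_ge_atTop 1] with D hD
    exact approximated_zero hD i fun G H u r hr h j => abs_rwCountEmb_le G hr h j
  | const c =>
    refine ⟨fun _ _ => c, ⟨0, ‖c‖, fun c => LipschitzWith.const _, by simp⟩,
      Eventually.of_forall fun D ε hε => Eventually.of_forall fun N V _ G H C s hreg u hu => ?_⟩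
    simpa [AggTerm.interp] using hε
  | app f hf ρ ih =>
    choose e he hD using ih
    exact ⟨fun a c => f fun t => e t a c, tame_app hf he,
      (eventually_all.2 hD).mono fun D h => approximated_app hf h⟩
  | globalMean h hpos hlip ρ η ihρ ihη =>
    obtain ⟨eρ, tρ, hρ⟩ := ihρ
    obtain ⟨eη, tη, hη⟩ := ihη
    exact ⟨_, tame_meanLimit (fun _ => L.q_nonneg) tρ tη hpos hlip,
      (hρ.and hη).mono fun D h => approximated_globalMean tρ tη h.1 h.2⟩
  | localMean i h hpos hlip ρ η ihρ ihη =>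
    obtain ⟨eρ, tρ, hρ⟩ := ihρ
    obtain ⟨eη, tη, hη⟩ := ihη
    refine ⟨_, tame_meanLimit (L := L) (lam := fun c => L.lam (c i)) (fun c => L.lam_nonneg _) tρ
      tη hpos
      hlip, ?_⟩
    filter_upwards [(tendsto_sub_atTop_nat 1).eventually (hρ.and hη), eventually_ge_atTop 1]
      with D h hD
    obtain ⟨D, rfl⟩ := Nat.exists_eq_add_of_le' hD
    exact approximated_localMean tρ tη h.1 h.2

end LocalLimit

/-! ### Exponential moments and concentration -/

/-- For finite `V` this makes the σ-algebra on graphs discrete, so functions of the graph alone are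
automatically measurable. -/
instance {V : Type} [Countable V] : MeasurableSingletonClass (SimpleGraph V) where
  measurableSet_singleton G := by
    have : ({G} : Set (SimpleGraph V)) = SimpleGraph.edgeSet ⁻¹' {G.edgeSet} := by
      ext G'; simp
    rw [this]
    exact SimpleGraph.measurable_edgeSet (MeasurableSet.singleton _)

theorem integral_bernoulli (w : unitInterval) (f : Prop → ℝ) :
    ∫ p, f p ∂(unitInterval.toNNReal w • Measure.dirac True +
      unitInterval.toNNReal (unitInterval.symm w) • Measure.dirac False) =
      w * f True + (1 - w) * f False := by
  rw [integral_add_measure, integral_smul_nnreal_measure, integral_smul_nnreal_measure,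
    integral_dirac, integral_dirac]
  · rfl
  · exact (integrable_dirac (by simp)).smul_measure_nnreal
  · exact (integrable_dirac (by simp)).smul_measure_nnreal

section Moments

variable {V : Type} [Fintype V] [DecidableEq V] (w : Sym2 V → unitInterval)

instance : IsProbabilityMeasure (inhomGraph w) := by
  refine Measure.isProbabilityMeasure_map ?_
  refine Measurable.aemeasurable ?_
  exact SimpleGraph.measurable_fromEdgeSet.comp MeasurableEquiv.setOfPred.measurable

open Classical in
/-- Exponential moment of the number of neighbours in `U` of a node `b`, on the event that the
edges of `S` are present. -/
theorem integral_edges_mul_prod {S : Finset (Sym2 V)} {U : Finset V} {b : V} (hb : b ∉ U)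
    (hS : ∀ e ∈ S, ¬ e.IsDiag) (hSU : ∀ v ∈ U, s(b, v) ∉ S) (z : ℝ) :
    ∫ G, (if ∀ e ∈ S, e ∈ G.edgeSet then (1 : ℝ) else 0) *
      ∏ v ∈ U, (if G.Adj b v then z else 1) ∂(inhomGraph w) =
      (∏ e ∈ S, (w e : ℝ)) * ∏ v ∈ U, (1 + w s(b, v) * (z - 1)) := by
  have hinj : Set.InjOn (fun v => s(b, v)) (U : Set V) := by
    intro v _ v' _ h
    exact Sym2.congr_right.1 h
  unfold inhomGraph
  have hmeas : Measurable fun s : Sym2 V → Prop => SimpleGraph.fromEdgeSet {e | s e} :=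
    SimpleGraph.measurable_fromEdgeSet.comp MeasurableEquiv.setOfPred.measurable
  rw [integral_map hmeas.aemeasurable Measurable.of_discrete.aestronglyMeasurable]
  -- The integrand is a product over independent pairs. Since the pairs joining `b` to `U` avoid
  -- `S`, each pair contributes to at most one of the two factors.
  let ψ : Sym2 V → Prop → ℝ := fun e p =>
    (if e ∈ S then (if p then 1 else 0) else 1) *
    (if e ∈ U.image fun v => s(b, v) then (if p then z else 1) else 1)
  have h1 : ∀ s : Sym2 V → Prop,
      (if ∀ e ∈ S, e ∈ (SimpleGraph.fromEdgeSet {e | s e}).edgeSet then (1 : ℝ) else 0) *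
      ∏ v ∈ U, (if (SimpleGraph.fromEdgeSet {e | s e}).Adj b v then z else 1) =
      ∏ e, ψ e (s e) := by
    intro s
    simp only [ψ]
    rw [Finset.prod_mul_distrib, Finset.prod_ite_mem, Finset.prod_ite_mem, Finset.univ_inter,
      Finset.univ_inter, Finset.prod_image hinj, Finset.prod_ite_zero]
    congr 1
    · have : (∀ e ∈ S, e ∈ (SimpleGraph.fromEdgeSet {e | s e}).edgeSet) ↔ ∀ e ∈ S, s e := by
        refine forall₂_congr fun e he => ?_
        rw [SimpleGraph.edgeSet_fromEdgeSet]
        simp [Sym2.mem_diagSet, hS e he]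
      simp only [this, Finset.prod_const_one]
    · refine Finset.prod_congr rfl fun v hv => ?_
      have hbv : b ≠ v := fun h => hb (h ▸ hv)
      simp [SimpleGraph.fromEdgeSet_adj, hbv]
  refine (integral_congr_ae (g := fun s => ∏ e, ψ e (s e))
    (Eventually.of_forall fun s => ?_)).trans ?_
  · convert h1 s
  rw [integral_fintype_prod_eq_prod]
  have h2 : ∀ e, ∫ p, ψ e p ∂(unitInterval.toNNReal (w e) • Measure.dirac True +
      unitInterval.toNNReal (unitInterval.symm (w e)) • Measure.dirac False) =
      (if e ∈ S then (w e : ℝ) else 1) *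
      (if e ∈ U.image fun v => s(b, v) then 1 + (w e : ℝ) * (z - 1) else 1) := by
    intro e
    rw [integral_bernoulli]
    by_cases he : e ∈ S
    · have he' : e ∉ U.image fun v => s(b, v) := by
        intro h
        obtain ⟨v, hv, rfl⟩ := Finset.mem_image.1 h
        exact hSU v hv he
      simp only [ψ, he, he', if_true, if_false]; ring
    · by_cases he' : e ∈ U.image fun v => s(b, v)
      · simp only [ψ, he, he', if_true, if_false]; ring
      · simp only [ψ, he, he', if_false]; ring
  simp_rw [h2]
  rw [Finset.prod_mul_distrib, Finset.prod_ite_mem, Finset.prod_ite_mem, Finset.univ_inter,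
    Finset.univ_inter, Finset.prod_image hinj]

variable {X : Type} [MeasurableSpace X] (F : Measure X) [IsProbabilityMeasure F]

open Classical in
/-- Exponential moment of the number of features in `Q`. -/
theorem integral_prod_features {Q : Set X} (hQ : MeasurableSet Q) (A : Finset V) (y : ℝ) :
    ∫ H : V → X, ∏ v ∈ A, (if H v ∈ Q then y else 1) ∂(Measure.pi fun _ => F) =
      (1 + F.real Q * (y - 1)) ^ A.card := by
  obtain ⟨φ, hφ⟩ : ∃ φ : V → X → ℝ, ∀ v x, φ v x =
      if v ∈ A then (if x ∈ Q then y else 1) else 1 := ⟨_, fun _ _ => rfl⟩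
  have h1 : ∀ H : V → X, ∏ v ∈ A, (if H v ∈ Q then y else 1) = ∏ v, φ v (H v) := by
    intro H
    simp_rw [hφ]
    rw [Finset.prod_ite_mem, Finset.univ_inter]
  simp_rw [h1]
  rw [integral_fintype_prod_eq_prod]
  have h2 : ∀ v, ∫ x, φ v x ∂F = if v ∈ A then 1 + F.real Q * (y - 1) else 1 := by
    intro v
    simp_rw [hφ]
    split_ifs with hv
    · have : (fun x => if x ∈ Q then y else (1 : ℝ)) =
          fun x => 1 + Set.indicator Q (fun _ => y - 1) x := by
        funext x; by_cases hx : x ∈ Q <;> simp [hx]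
      rw [this, integral_add (integrable_const _) ((integrable_const _).indicator hQ),
        integral_indicator_const _ hQ]
      simp
    · simp
  simp_rw [h2]
  rw [Finset.prod_ite_mem, Finset.univ_inter, Finset.prod_const]

/-- Factorwise this is `1 + x ≤ exp x`; the bounds on `a` and `c` keep the factors non-negative, as
needed to multiply the inequalities. -/
theorem prod_one_add_le_exp {ι : Type*} (U : Finset ι) (a : ι → ℝ) {c : ℝ} (hc : -1 ≤ c)
    (h0 : ∀ i, 0 ≤ a i) (h1 : ∀ i, a i ≤ 1) :
    ∏ i ∈ U, (1 + a i * c) ≤ Real.exp ((∑ i ∈ U, a i) * c) := by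
  rw [Finset.sum_mul, Real.exp_sum]
  refine Finset.prod_le_prod (fun i _ => ?_) fun i _ => ?_
  · nlinarith [h0 i, h1 i]
  · rw [add_comm]; exact Real.add_one_le_exp _

/-- Upper bound for the probability that the edges of `S` are present and a multiple of the number
of those neighbours of `b` in `U` which have a feature in `Q` is at least `c`. -/
theorem real_edges_inter_le {S : Finset (Sym2 V)} {U : Finset V} {b : V} (hb : b ∉ U)
    (hS : ∀ e ∈ S, ¬ e.IsDiag) (hSU : ∀ v ∈ U, s(b, v) ∉ S) {Q : Set X} (hQ : MeasurableSet Q)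
    (l c : ℝ) :
    ((inhomGraph w).prod (Measure.pi fun _ : V => F)).real
      {ω | (∀ e ∈ S, e ∈ ω.1.edgeSet) ∧
        c ≤ l * ({v | v ∈ U ∧ ω.1.Adj b v ∧ ω.2 v ∈ Q}.ncard : ℝ)} ≤
      (∏ e ∈ S, (w e : ℝ)) *
        Real.exp ((∑ v ∈ U, (w s(b, v) : ℝ)) * F.real Q * (Real.exp l - 1) - c) := by
  classical
  set μ := (inhomGraph w).prod (Measure.pi fun _ : V => F)
  let f : SimpleGraph V × (V → X) → ℝ := fun ω =>
    (if ∀ e ∈ S, e ∈ ω.1.edgeSet then (1 : ℝ) else 0) *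
      ∏ v ∈ U.filter (fun v => ω.1.Adj b v), (if ω.2 v ∈ Q then Real.exp l else 1)
  have hexp : ∀ ω : SimpleGraph V × (V → X),
      ∏ v ∈ U.filter (fun v => ω.1.Adj b v), (if ω.2 v ∈ Q then Real.exp l else 1) =
      Real.exp (l * ({v | v ∈ U ∧ ω.1.Adj b v ∧ ω.2 v ∈ Q}.ncard : ℝ)) := by
    intro ω
    rw [Finset.prod_ite, Finset.prod_const_one, mul_one, Finset.prod_const, ← Real.exp_nat_mul,
      mul_comm, Finset.filter_filter, ← Set.ncard_coe_finset]
    congr 3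
    simp
  have hf0 : ∀ ω, 0 ≤ f ω := by
    intro ω
    refine mul_nonneg (by split_ifs <;> simp) (Finset.prod_nonneg fun v _ => ?_)
    split_ifs
    · exact (Real.exp_pos _).le
    · exact zero_le_one
  have hfm : Measurable f := by
    refine measurable_from_prod_countable_right fun G => ?_
    have h1 : Measurable fun H : V → X => ∏ v ∈ U.filter (fun v => G.Adj b v),
        (if H v ∈ Q then Real.exp l else 1) := Finset.measurable_prod _ fun v _ =>
      Measurable.ite (measurable_pi_apply v hQ) measurable_const measurable_const
    exact h1.const_mul (if ∀ e ∈ S, e ∈ G.edgeSet then (1 : ℝ) else 0)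
  have hfb : ∀ ω, f ω ≤ Real.exp (|l| * U.card) := by
    intro ω
    have h1 : f ω ≤ 1 * ∏ v ∈ U.filter (fun v => ω.1.Adj b v),
        (if ω.2 v ∈ Q then Real.exp l else 1) := by
      refine mul_le_mul_of_nonneg_right (by split_ifs <;> simp) ?_
      rw [hexp]; exact (Real.exp_pos _).le
    refine h1.trans ?_
    rw [one_mul, hexp]
    refine Real.exp_le_exp.2 ?_
    refine (mul_le_mul_of_nonneg_right (le_abs_self l) (Nat.cast_nonneg _)).trans ?_
    refine mul_le_mul_of_nonneg_left ?_ (abs_nonneg l)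
    rw [← Set.ncard_coe_finset]
    exact Nat.cast_le.2 (Set.ncard_le_ncard (fun v hv => hv.1) (Set.toFinite _))
  have hfi : Integrable f μ := Integrable.of_bound hfm.aestronglyMeasurable
    (Real.exp (|l| * U.card))
    (Eventually.of_forall fun ω => by
      rw [Real.norm_eq_abs, abs_of_nonneg (hf0 ω)]; exact hfb ω)
  have hint : ∫ ω, f ω ∂μ ≤ (∏ e ∈ S, (w e : ℝ)) *
      Real.exp ((∑ v ∈ U, (w s(b, v) : ℝ)) * F.real Q * (Real.exp l - 1)) := by
    rw [integral_prod _ hfi]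
    -- Integrating over the features first replaces `exp l` by `1 + F(Q) (exp l - 1)` for each
    -- neighbour, which is the parameter `z` of the exponential moment for edges.
    have h1 : ∀ G : SimpleGraph V, ∫ H, f (G, H) ∂(Measure.pi fun _ : V => F) =
        (if ∀ e ∈ S, e ∈ G.edgeSet then (1 : ℝ) else 0) *
        ∏ v ∈ U, (if G.Adj b v then 1 + F.real Q * (Real.exp l - 1) else 1) := by
      intro G
      change ∫ H : V → X, (if ∀ e ∈ S, e ∈ G.edgeSet then (1 : ℝ) else 0) *
        ∏ v ∈ U.filter (fun v => G.Adj b v), (if H v ∈ Q then Real.exp l else 1)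
        ∂(Measure.pi fun _ : V => F) = _
      rw [integral_const_mul, integral_prod_features F hQ, Finset.prod_ite, Finset.prod_const_one,
        mul_one, Finset.prod_const]
    simp_rw [h1]
    rw [integral_edges_mul_prod w hb hS hSU]
    refine mul_le_mul_of_nonneg_left ?_ (Finset.prod_nonneg fun e _ => (w e).2.1)
    have h2 : ∀ v, (1 : ℝ) + w s(b, v) * (1 + F.real Q * (Real.exp l - 1) - 1) =
        1 + (w s(b, v) * F.real Q) * (Real.exp l - 1) := fun v => by ring
    simp_rw [h2]
    rw [Finset.sum_mul]
    refine prod_one_add_le_exp U _ (by linarith [Real.exp_pos l])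
      (fun v => mul_nonneg (w _).2.1 measureReal_nonneg)
      fun v => mul_le_one₀ (w _).2.2 measureReal_nonneg measureReal_le_one
  -- Markov's inequality for the exponential. The sign of `l` is free, so both tails are covered.
  have hmarkov := mul_meas_ge_le_integral_of_nonneg (Eventually.of_forall hf0) hfi (Real.exp c)
  have hsub : μ.real {ω | (∀ e ∈ S, e ∈ ω.1.edgeSet) ∧
        c ≤ l * ({v | v ∈ U ∧ ω.1.Adj b v ∧ ω.2 v ∈ Q}.ncard : ℝ)} ≤
      μ.real {ω | Real.exp c ≤ f ω} := by
    refine measureReal_mono (fun ω hω => ?_)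
    simp only [Set.mem_ofPred_eq, f]
    rw [if_pos hω.1, one_mul, hexp]
    exact Real.exp_le_exp.2 hω.2
  rw [Real.exp_sub, ← mul_div_assoc, le_div_iff₀ (Real.exp_pos c), mul_comm]
  exact (mul_le_mul_of_nonneg_left hsub (Real.exp_pos c).le).trans (hmarkov.trans hint)

end Moments

/-- From exponential bounds with all small parameters to a two-sided bound. -/
theorem real_abs_sub_ge_le {Ω : Type*} [MeasurableSpace Ω] {μ : Measure Ω} [IsFiniteMeasure μ]
    {E : Set Ω} {N : Ω → ℝ} {A m σ τ : ℝ} (hA : 0 ≤ A) (hm : 0 ≤ m) (hσ : m ≤ σ) (hτ : 0 ≤ τ)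
    (hτ1 : τ ≤ 1)
    (h : ∀ l c : ℝ, μ.real {ω | ω ∈ E ∧ c ≤ l * N ω} ≤ A * Real.exp (m * (Real.exp l - 1) - c)) :
    μ.real {ω | ω ∈ E ∧ τ * σ ≤ |N ω - m|} ≤ 2 * A * Real.exp (-(τ ^ 2 * σ / 4)) := by
  -- Used for `l = ± τ / 2`. As `exp l - 1 - l ≤ l ^ 2` for `|l| ≤ 1`, the exponent is at most `σ τ
  -- ^ 2 / 4 - σ τ ^ 2 / 2`.
  have hexp : ∀ l : ℝ, l ^ 2 = τ ^ 2 / 4 → ∀ c, c = l * m + τ ^ 2 * σ / 2 →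
      A * Real.exp (m * (Real.exp l - 1) - c) ≤ A * Real.exp (-(τ ^ 2 * σ / 4)) := by
    intro l hl c hc
    refine mul_le_mul_of_nonneg_left (Real.exp_le_exp.2 ?_) hA
    have h1 : |l| ≤ 1 := by
      rw [← sq_le_one_iff_abs_le_one, hl]; nlinarith
    have h2 := (abs_le.1 (Real.abs_exp_sub_one_sub_id_le h1)).2
    rw [hl] at h2
    have h3 : m * (Real.exp l - 1 - l) ≤ m * (τ ^ 2 / 4) := mul_le_mul_of_nonneg_left h2 hm
    have h4 : m * (τ ^ 2 / 4) ≤ σ * (τ ^ 2 / 4) := by gcongr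
    rw [hc]; nlinarith
  have h1 := (h (τ / 2) (τ / 2 * m + τ ^ 2 * σ / 2)).trans (hexp _ (by ring) _ rfl)
  have h2 := (h (-(τ / 2)) (-(τ / 2) * m + τ ^ 2 * σ / 2)).trans (hexp _ (by ring) _ rfl)
  calc _ ≤ μ.real ({ω | ω ∈ E ∧ τ / 2 * m + τ ^ 2 * σ / 2 ≤ τ / 2 * N ω} ∪
        {ω | ω ∈ E ∧ -(τ / 2) * m + τ ^ 2 * σ / 2 ≤ -(τ / 2) * N ω}) := by
        refine measureReal_mono fun ω hω => ?_
        rcases le_abs.1 hω.2 with h3 | h3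
        · refine Or.inl ⟨hω.1, ?_⟩
          nlinarith [mul_le_mul_of_nonneg_left h3 (half_pos zero_lt_two).le]
        · refine Or.inr ⟨hω.1, ?_⟩
          nlinarith
    _ ≤ _ := measureReal_union_le _ _
    _ ≤ _ := by linarith

section Features

variable {V : Type} [Fintype V] {Y : Type} [MeasurableSpace Y] (γ : Measure Y)
  [IsProbabilityMeasure γ] {X : Type} [MeasurableSpace X] (F : Measure X) [IsProbabilityMeasure F]

theorem real_features_le {Q : Set X} (hQ : MeasurableSet Q) (A : Finset V) (l c : ℝ) :
    (γ.prod (Measure.pi fun _ : V => F)).real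
      {ω | c ≤ l * ({v | v ∈ A ∧ ω.2 v ∈ Q}.ncard : ℝ)} ≤
      Real.exp (A.card * F.real Q * (Real.exp l - 1) - c) := by
  classical
  set μ := γ.prod (Measure.pi fun _ : V => F)
  let g : (V → X) → ℝ := fun H => ∏ v ∈ A, (if H v ∈ Q then Real.exp l else 1)
  have hexp : ∀ H : V → X, g H = Real.exp (l * ({v | v ∈ A ∧ H v ∈ Q}.ncard : ℝ)) := by
    intro H
    simp only [g]
    rw [Finset.prod_ite, Finset.prod_const_one, mul_one, Finset.prod_const, ← Real.exp_nat_mul,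
      mul_comm, ← Set.ncard_coe_finset]
    congr 3
    simp
  have hgm : Measurable g := Finset.measurable_prod _ fun v _ =>
    Measurable.ite (measurable_pi_apply v hQ) measurable_const measurable_const
  have hgb : ∀ H, ‖g H‖ ≤ Real.exp (|l| * A.card) := by
    intro H
    rw [hexp, Real.norm_eq_abs, abs_of_pos (Real.exp_pos _)]
    refine Real.exp_le_exp.2 ?_
    refine (mul_le_mul_of_nonneg_right (le_abs_self l) (Nat.cast_nonneg _)).trans ?_
    refine mul_le_mul_of_nonneg_left ?_ (abs_nonneg l)
    rw [← Set.ncard_coe_finset]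
    exact Nat.cast_le.2 (Set.ncard_le_ncard (fun v hv => hv.1) (Set.toFinite _))
  have hfi : Integrable (fun ω : Y × (V → X) => g ω.2) μ :=
    Integrable.of_bound (hgm.comp measurable_snd).aestronglyMeasurable _
      (Eventually.of_forall fun ω => hgb ω.2)
  have hint : ∫ ω, g ω.2 ∂μ ≤ Real.exp (A.card * F.real Q * (Real.exp l - 1)) := by
    have h1 : ∫ ω, g ω.2 ∂μ = ∫ H, g H ∂(Measure.pi fun _ : V => F) := by
      have := integral_prod_mul (μ := γ) (ν := Measure.pi fun _ : V => F) (fun _ => (1 : ℝ)) g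
      simpa using this
    rw [h1, integral_prod_features F hQ, ← Finset.prod_const]
    refine (prod_one_add_le_exp A (fun _ => F.real Q) (by linarith [Real.exp_pos l])
      (fun _ => measureReal_nonneg) fun _ => measureReal_le_one).trans ?_
    simp
  have hmarkov := mul_meas_ge_le_integral_of_nonneg
    (Eventually.of_forall fun ω => by rw [hexp]; exact (Real.exp_pos _).le) hfi (Real.exp c)
  have hsub : μ.real {ω | c ≤ l * ({v | v ∈ A ∧ ω.2 v ∈ Q}.ncard : ℝ)} ≤
      μ.real {ω | Real.exp c ≤ g ω.2} := by
    refine measureReal_mono (fun ω hω => ?_)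
    simp only [Set.mem_ofPred_eq]
    rw [hexp]
    exact Real.exp_le_exp.2 hω
  rw [Real.exp_sub, le_div_iff₀ (Real.exp_pos c), mul_comm]
  exact (mul_le_mul_of_nonneg_left hsub (Real.exp_pos c).le).trans (hmarkov.trans hint)

end Features

/-! ### Probability of unbalanced sets and neighbourhoods. -/

namespace LocalLimit

variable {d m : ℕ} (L : LocalLimit d m)

theorem tol_le_one (N : ℕ) : L.tol N ≤ 1 := by
  unfold tol
  have h1 : (1 : ℝ) ≤ (L.net N).powerset.card := by
    rw [Finset.card_powerset]; exact_mod_cast Nat.one_le_two_pow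
  rw [div_le_one (by positivity)]
  have h2 : (0 : ℝ) ≤ N := Nat.cast_nonneg N
  have h3 : (0 : ℝ) ≤ m := Nat.cast_nonneg m
  nlinarith [mul_nonneg h2 h3, mul_nonneg h2 (mul_nonneg h3 (zero_le_one.trans h1)),
    mul_nonneg h2 (zero_le_one.trans h1), mul_nonneg h3 (zero_le_one.trans h1)]

/-- The number of tests in the definition of balanced sets, with a factor `2`. -/
noncomputable def tests (N : ℕ) : ℝ := m * ((L.net N).powerset.card * 2)

theorem tests_nonneg (N : ℕ) : 0 ≤ L.tests N := by unfold tests; positivity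

/-- The exponential rate at which balanced neighbourhoods fail. -/
noncomputable def rate (N : ℕ) : ℝ := L.tol N ^ 2 / (16 * (∑ i, ∑ j, L.lam i j + 1))

theorem sum_lam_nonneg : 0 ≤ ∑ i, ∑ j, L.lam i j :=
  Finset.sum_nonneg fun i _ => Finset.sum_nonneg fun j _ => L.lam_nonneg i j

theorem rate_pos (N : ℕ) : 0 < L.rate N := by
  have := L.sum_lam_nonneg
  have := L.tol_pos N
  unfold rate; positivity

/-- A union bound over communities and cells; the factor `2` inside `tests` absorbs the two tails.
-/
theorem real_exists_test_le {Ω : Type*} [MeasurableSpace Ω] (μ : Measure Ω) [IsFiniteMeasure μ]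
    (N : ℕ) (E : Fin m → Finset (Feat d) → Set Ω) {a : ℝ} (h : ∀ j z, μ.real (E j z) ≤ 2 * a) :
    μ.real {ω | ∃ j, ∃ z ∈ (L.net N).powerset, ω ∈ E j z} ≤ L.tests N * a := by
  have h1 : {ω | ∃ j, ∃ z ∈ (L.net N).powerset, ω ∈ E j z} =
      ⋃ j ∈ (Finset.univ : Finset (Fin m)), ⋃ z ∈ (L.net N).powerset, E j z := by
    ext ω; simp
  rw [h1]
  calc _ ≤ ∑ j : Fin m, μ.real (⋃ z ∈ (L.net N).powerset, E j z) :=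
        measureReal_biUnion_finset_le _ _
    _ ≤ ∑ _j : Fin m, ∑ _z ∈ (L.net N).powerset, 2 * a := Finset.sum_le_sum fun j _ =>
        (measureReal_biUnion_finset_le _ _).trans (Finset.sum_le_sum fun z _ => h j z)
    _ = _ := by simp [tests]; ring

variable {V : Type} [Fintype V] [DecidableEq V] (w : Sym2 V → unitInterval)

/-- Probability that the nodes are not globally balanced. -/
theorem real_not_balanced_univ_le (γ : Measure (SimpleGraph V)) [IsProbabilityMeasure γ] (N : ℕ)
    (C : V → Fin m)
    (hq : ∀ j, |({v | C v = j}.ncard : ℝ) - Fintype.card V * L.q j| ≤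
      Fintype.card V * L.tol N / 2) :
    (γ.prod (Measure.pi fun _ : V => L.F)).real
      {ω | ¬ L.Balanced N ω.2 C (Fintype.card V) L.q Set.univ} ≤
      L.tests N * Real.exp (-(L.tol N ^ 2 * Fintype.card V / 16)) := by
  classical
  have ht := L.tol_pos N
  have ht1 := L.tol_le_one N
  -- Half of the tolerance pays for the fluctuation of the features, the other half for the
  -- deviation of the community sizes from `q`.
  have key := L.real_exists_test_le (γ.prod (Measure.pi fun _ : V => L.F)) N
    (fun j z => {ω | ω ∈ (Set.univ : Set (SimpleGraph V × (V → Feat d))) ∧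
        L.tol N / 2 * (Fintype.card V : ℝ) ≤
      |({v | v ∈ Finset.univ.filter (fun v => C v = j) ∧ ω.2 v ∈ {x | L.cell N x = z}}.ncard : ℝ) -
      (Finset.univ.filter (fun v => C v = j)).card * L.F.real {x | L.cell N x = z}|})
    (a := 1 * Real.exp (-((L.tol N / 2) ^ 2 * Fintype.card V / 4))) (fun j z => by
      rw [← mul_assoc 2]
      refine real_abs_sub_ge_le zero_le_one (mul_nonneg (Nat.cast_nonneg _) measureReal_nonneg)
        ?_ (by linarith) (by linarith) fun l c => ?_
      · refine (mul_le_of_le_one_right (Nat.cast_nonneg _) measureReal_le_one).trans ?_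
        exact_mod_cast Finset.card_le_univ _
      · rw [one_mul]
        refine le_trans (measureReal_mono fun ω hω => ?_)
          (real_features_le γ L.F (L.measurableSet_cell N z) _ l c)
        exact hω.2)
  have he : (L.tol N / 2) ^ 2 * Fintype.card V / 4 = L.tol N ^ 2 * Fintype.card V / 16 := by ring
  rw [one_mul, he] at key
  refine le_trans (measureReal_mono fun ω hω => ?_) key
  simp only [Balanced, Set.mem_ofPred_eq, not_forall, not_le] at hω
  obtain ⟨j, z, hz, h⟩ := hω
  refine ⟨j, z, hz, Set.mem_univ _, ?_⟩
  have h1 : {v ∈ (Set.univ : Set V) | C v = j ∧ L.cell N (ω.2 v) = z} =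
      {v | v ∈ Finset.univ.filter (fun v => C v = j) ∧ ω.2 v ∈ {x | L.cell N x = z}} := by
    ext v; simp
  have h2 : ((Finset.univ.filter (fun v => C v = j)).card : ℝ) = ({v | C v = j}.ncard : ℝ) := by
    rw [← Set.ncard_coe_finset]; simp
  rw [h1] at h
  rw [h2]
  have hp0 : 0 ≤ L.F.real {x | L.cell N x = z} := measureReal_nonneg
  have hp1 : L.F.real {x | L.cell N x = z} ≤ 1 := measureReal_le_one
  set p := L.F.real {x | L.cell N x = z}
  have h3 : |({v | C v = j}.ncard : ℝ) * p - Fintype.card V * L.q j * p| ≤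
      Fintype.card V * L.tol N / 2 := by
    rw [← sub_mul, abs_mul, abs_of_nonneg hp0]
    exact (mul_le_of_le_one_right (abs_nonneg _) hp1).trans (hq j)
  have h4 := abs_sub_le ({v | v ∈ Finset.univ.filter (fun v => C v = j) ∧
    ω.2 v ∈ {x | L.cell N x = z}}.ncard : ℝ) (({v | C v = j}.ncard : ℝ) * p)
    (Fintype.card V * L.q j * p)
  linarith

/-- Probability that the edges of `S`, which lie inside of a small set `W`, are present, and that
the neighbourhood of a node `b` of `W` is not balanced. -/
theorem real_edges_inter_not_good_le (N : ℕ) (C : V → Fin m) {s : ℝ} (hs : 0 < s) {b : V}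
    {W : Finset V} (hb : b ∈ W) {S : Finset (Sym2 V)} (hS : ∀ e ∈ S, ¬ e.IsDiag)
    (hSW : ∀ e ∈ S, ∀ v ∈ e, v ∈ W) (hW : (W.card : ℝ) ≤ s * L.tol N / 8)
    (hmean : ∀ j, |∑ v with C v = j, (w s(b, v) : ℝ) - s * L.lam (C b) j| ≤ s * L.tol N / 8) :
    ((inhomGraph w).prod (Measure.pi fun _ : V => L.F)).real
      {ω | (∀ e ∈ S, e ∈ ω.1.edgeSet) ∧ ¬ L.Good N ω.1 ω.2 C s 0 b} ≤
      L.tests N * ((∏ e ∈ S, (w e : ℝ)) * Real.exp (-(L.rate N * s))) := by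
  classical
  have ht := L.tol_pos N
  have ht1 := L.tol_le_one N
  set Λ := ∑ i, ∑ j, L.lam i j with hΛ
  have hΛ0 : 0 ≤ Λ := L.sum_lam_nonneg
  have hlam : ∀ j, L.lam (C b) j ≤ Λ := fun j =>
    (Finset.single_le_sum (fun j _ => L.lam_nonneg (C b) j) (Finset.mem_univ j)).trans
      (Finset.single_le_sum (f := fun i => ∑ j, L.lam i j)
        (fun i _ => Finset.sum_nonneg fun j _ => L.lam_nonneg i j) (Finset.mem_univ (C b)))
  -- Leaving out `W` makes the pairs from `b` to `U j` disjoint from `S`, hence independent of it.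
  -- It changes mean and count by at most `W.card ≤ s * tol / 8` each.
  let U : Fin m → Finset V := fun j => Finset.univ.filter fun v => C v = j ∧ v ∉ W
  have hUsum : ∀ j, |∑ v ∈ U j, (w s(b, v) : ℝ) - s * L.lam (C b) j| ≤ s * L.tol N / 4 := by
    intro j
    have h1 : ∑ v with C v = j, (w s(b, v) : ℝ) = ∑ v ∈ U j, (w s(b, v) : ℝ) +
        ∑ v with C v = j ∧ v ∈ W, (w s(b, v) : ℝ) := by
      rw [← Finset.sum_filter_add_sum_filter_not (Finset.univ.filter fun v => C v = j)
        (fun v => v ∉ W), Finset.filter_filter, Finset.filter_filter]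
      simp [U]
    have h2 : ∑ v with C v = j ∧ v ∈ W, (w s(b, v) : ℝ) ≤ W.card := by
      calc _ ≤ ∑ v with C v = j ∧ v ∈ W, (1 : ℝ) := Finset.sum_le_sum fun v _ => (w _).2.2
        _ = ((Finset.univ.filter fun v => C v = j ∧ v ∈ W).card : ℝ) := by simp
        _ ≤ W.card := Nat.cast_le.2 (Finset.card_le_card fun v hv => by simp at hv; exact hv.2)
    have h3 : 0 ≤ ∑ v with C v = j ∧ v ∈ W, (w s(b, v) : ℝ) :=
      Finset.sum_nonneg fun v _ => (w _).2.1
    have h4 := abs_le.1 (hmean j)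
    rw [h1] at h4
    exact abs_le.2 ⟨by linarith [h4.1], by linarith [h4.2]⟩
  let mean : Fin m → Finset (Feat d) → ℝ := fun j z =>
    (∑ v ∈ U j, (w s(b, v) : ℝ)) * L.F.real {x | L.cell N x = z}
  -- The means are at most `s (Λ + 1)`, and `τ` times this is half of the tolerance `s * tol`. With
  -- `1 / 8` for the count and `1 / 4` for the mean, the total stays within the tolerance.
  set τ := L.tol N / (2 * (Λ + 1)) with hτ
  have hτ0 : 0 ≤ τ := by positivity
  have hτ1 : τ ≤ 1 := by
    rw [hτ, div_le_one (by positivity)]; linarith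
  have hA : 0 ≤ ∏ e ∈ S, (w e : ℝ) := Finset.prod_nonneg fun e _ => (w e).2.1
  have key := L.real_exists_test_le ((inhomGraph w).prod (Measure.pi fun _ : V => L.F)) N
    (fun j z => {ω | ω ∈ {ω : SimpleGraph V × (V → Feat d) | ∀ e ∈ S, e ∈ ω.1.edgeSet} ∧
      τ * (s * (Λ + 1)) ≤
      |({v | v ∈ U j ∧ ω.1.Adj b v ∧ ω.2 v ∈ {x | L.cell N x = z}}.ncard : ℝ) - mean j z|})
    (a := (∏ e ∈ S, (w e : ℝ)) * Real.exp (-(τ ^ 2 * (s * (Λ + 1)) / 4))) (fun j z => by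
      rw [← mul_assoc 2]
      refine real_abs_sub_ge_le (μ := (inhomGraph w).prod (Measure.pi fun _ : V => L.F))
        (E := {ω | ∀ e ∈ S, e ∈ ω.1.edgeSet}) hA
        (mul_nonneg (Finset.sum_nonneg fun v _ => (w _).2.1)
        measureReal_nonneg) ?_ hτ0 hτ1 fun l c => ?_
      · refine (mul_le_of_le_one_right (Finset.sum_nonneg fun v _ => (w _).2.1)
          measureReal_le_one).trans ?_
        have h1 := (abs_le.1 (hUsum j)).2
        have h2 := mul_le_mul_of_nonneg_left (hlam j) hs.le
        nlinarith [mul_le_mul_of_nonneg_left ht1 hs.le]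
      · refine real_edges_inter_le w L.F ?_ hS (fun v hv hvS => ?_) (L.measurableSet_cell N z) l c
        · simp [U, hb]
        · have := hSW _ hvS v (Sym2.mem_mk_right b v)
          simp [U] at hv
          exact hv.2 this)
  have he : τ ^ 2 * (s * (Λ + 1)) / 4 = L.rate N * s := by
    rw [hτ, rate, ← hΛ]; field_simp; norm_num
  rw [he] at key
  refine (measureReal_mono ?_).trans key
  rintro ω ⟨hωS, hω⟩
  simp only [Good, Balanced, not_forall, not_le] at hω
  obtain ⟨j, z, hz, h⟩ := hω
  refine ⟨j, z, hz, hωS, ?_⟩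
  have hp0 : 0 ≤ L.F.real {x | L.cell N x = z} := measureReal_nonneg
  have hp1 : L.F.real {x | L.cell N x = z} ≤ 1 := measureReal_le_one
  simp only [mean]
  set p := L.F.real {x | L.cell N x = z}
  set A : Set V := {v ∈ ω.1.neighborSet b | C v = j ∧ L.cell N (ω.2 v) = z}
  set A' : Set V := {v | v ∈ U j ∧ ω.1.Adj b v ∧ ω.2 v ∈ {x | L.cell N x = z}}
  have h1 : (A'.ncard : ℝ) ≤ A.ncard := by
    refine Nat.cast_le.2 (Set.ncard_le_ncard (fun v hv => ?_) (Set.toFinite _))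
    have hvU := hv.1
    simp only [U, Finset.mem_filter, Finset.mem_univ, true_and] at hvU
    exact ⟨hv.2.1, hvU.1, hv.2.2⟩
  have h2 : (A.ncard : ℝ) ≤ A'.ncard + W.card := by
    rw [← Set.ncard_coe_finset W]
    have : A ⊆ A' ∪ (W : Set V) := by
      intro v hv
      by_cases hvW : v ∈ W
      · exact Or.inr hvW
      · exact Or.inl ⟨by simp [U, hvW, hv.2.1], hv.1, hv.2.2⟩
    exact_mod_cast (Set.ncard_le_ncard this (Set.toFinite _)).trans (Set.ncard_union_le _ _)
  have h3 : |(∑ v ∈ U j, (w s(b, v) : ℝ)) * p - s * L.lam (C b) j * p| ≤ s * L.tol N / 4 := by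
    rw [← sub_mul, abs_mul, abs_of_nonneg hp0]
    exact (mul_le_of_le_one_right (abs_nonneg _) hp1).trans (hUsum j)
  have h4 : |(A.ncard : ℝ) - A'.ncard| ≤ s * L.tol N / 8 := by
    rw [abs_of_nonneg (by linarith)]; linarith
  have h5 := abs_sub_le (A.ncard : ℝ) A'.ncard (s * L.lam (C b) j * p)
  have h6 := abs_sub_le (A'.ncard : ℝ) ((∑ v ∈ U j, (w s(b, v) : ℝ)) * p)
    (s * L.lam (C b) j * p)
  have h7 : τ * (s * (Λ + 1)) = s * L.tol N / 2 := by rw [hτ]; field_simp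
  rw [h7]
  have h8 : 0 < s * L.tol N := mul_pos hs ht
  linarith

end LocalLimit

/-! ### Edge probabilities and the upper tail of degrees. -/

section Degrees

variable {V : Type} [Fintype V] [DecidableEq V] (w : Sym2 V → unitInterval) {X : Type}
  [MeasurableSpace X] (F : Measure X) [IsProbabilityMeasure F]

/-- Probability of edges. -/
theorem real_edges_le {S : Finset (Sym2 V)} (hS : ∀ e ∈ S, ¬ e.IsDiag) :
    ((inhomGraph w).prod (Measure.pi fun _ : V => F)).real {ω | ∀ e ∈ S, e ∈ ω.1.edgeSet} ≤
      ∏ e ∈ S, (w e : ℝ) := by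
  classical
  rcases isEmpty_or_nonempty V with hV | ⟨⟨b⟩⟩
  · have : S = ∅ := Finset.eq_empty_of_forall_notMem fun e => by
      induction e with | _ x y => exact isEmptyElim x
    rw [this, Finset.prod_empty]
    exact measureReal_le_one
  -- With `l = c = 0` the condition on neighbours is void.
  · have := real_edges_inter_le w F (b := b) (U := ∅) (by simp) hS (by simp)
      (Q := Set.univ) MeasurableSet.univ 0 0
    simpa using this

/-- Upper tail of the degrees. -/
theorem real_degree_ge_le (b : V) (c : ℝ) :
    ((inhomGraph w).prod (Measure.pi fun _ : V => F)).real
      {ω | c ≤ ((ω.1.neighborSet b).ncard : ℝ)} ≤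
      Real.exp ((∑ v, (w s(b, v) : ℝ)) * (Real.exp 1 - 1) - c) := by
  classical
  have := real_edges_inter_le w F (b := b) (U := Finset.univ.erase b) (S := ∅) (by simp) (by simp)
      (by simp) (Q := Set.univ) MeasurableSet.univ 1 c
  rw [Finset.prod_empty, one_mul, probReal_univ, mul_one] at this
  refine le_trans (measureReal_mono fun ω hω => ?_) (this.trans (Real.exp_le_exp.2 ?_))
  · refine ⟨by simp, ?_⟩
    rw [one_mul]
    convert (show c ≤ _ from hω) using 3
    ext v
    simp only [Finset.mem_erase, Set.mem_ofPred_eq, SimpleGraph.mem_neighborSet]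
    exact ⟨fun h => h.2.1, fun h => ⟨⟨h.ne', Finset.mem_univ _⟩, h, Set.mem_univ _⟩⟩
  · refine sub_le_sub_right (mul_le_mul_of_nonneg_right ?_ ?_) c
    · exact Finset.sum_le_sum_of_subset_of_nonneg (Finset.erase_subset _ _)
        fun v _ _ => (w _).2.1
    · linarith [Real.add_one_le_exp 1]

end Degrees

/-! ### Balls, lassos and homomorphisms -/

namespace SimpleGraph

variable {V : Type} (G : SimpleGraph V)

/-- The nodes which are joined to a node of `B` by a walk of length at most `r`. -/
def nearSet (B : Set V) (r : ℕ) : Set V := {v | ∃ b ∈ B, ∃ p : G.Walk v b, p.length ≤ r}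

theorem ncard_nearSet_le [Fintype V] {Δ : ℕ} (hΔ : ∀ v, (G.neighborSet v).ncard ≤ Δ) (B : Set V)
    (r : ℕ) : (G.nearSet B r).ncard ≤ B.ncard * (Δ + 1) ^ r := by
  classical
  induction r with
  | zero =>
    rw [pow_zero, mul_one]
    refine Set.ncard_le_ncard ?_ (Set.toFinite _)
    rintro v ⟨b, hb, p, hp⟩
    rwa [Walk.eq_of_length_eq_zero (Nat.le_zero.1 hp)]
  | succ r ih =>
    have hsub : G.nearSet B (r + 1) ⊆ (((G.nearSet B r).toFinset.biUnion fun v =>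
        insert v (G.neighborFinset v) : Finset V) : Set V) := by
      rintro v ⟨b, hb, p, hp⟩
      simp only [Finset.coe_biUnion, Set.mem_iUnion, Finset.mem_coe, Set.mem_toFinset,
        Finset.mem_insert, mem_neighborFinset, exists_prop]
      cases p with
      | nil => exact ⟨v, ⟨v, hb, Walk.nil, Nat.zero_le _⟩, Or.inl rfl⟩
      | @cons _ w _ h p =>
        exact ⟨w, ⟨b, hb, p, by simpa using hp⟩, Or.inr h.symm⟩
    refine (Set.ncard_le_ncard hsub (Set.toFinite _)).trans ?_
    rw [Set.ncard_coe_finset]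
    refine (Finset.card_biUnion_le_card_mul _ _ (Δ + 1) fun v _ => ?_).trans ?_
    · refine (Finset.card_insert_le _ _).trans (Nat.succ_le_succ ?_)
      rw [← Set.ncard_coe_finset, coe_neighborFinset]
      exact hΔ v
    · rw [← Set.ncard_coe_finset, Set.coe_toFinset, pow_succ, ← mul_assoc]
      exact Nat.mul_le_mul_right _ ih

/-- `f` lists a path of length `t` with a chord from its end to its entry `s`. -/
def IsLasso (t s : ℕ) (f : ℕ → V) : Prop :=
  s + 1 < t ∧ Set.InjOn f (Set.Iic t) ∧ (∀ i < t, G.Adj (f i) (f (i + 1))) ∧ G.Adj (f t) (f s)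

variable {G}

/-- A walk which ends in `b` yields a lasso at `b`, or a path with the same ends whose length has
the same parity. -/
theorem Walk.exists_lasso_or_path {x b : V} (p : G.Walk x b) :
    (∃ t ≤ p.length, ∃ s f, f 0 = b ∧ G.IsLasso t s f) ∨
    ∃ t ≤ p.length, t % 2 = p.length % 2 ∧ ∃ f : ℕ → V, f 0 = b ∧ f t = x ∧
      Set.InjOn f (Set.Iic t) ∧ ∀ i < t, G.Adj (f i) (f (i + 1)) := by
  classical
  induction p with
  | @nil x => exact Or.inr ⟨0, le_rfl, rfl, fun _ => x, rfl, rfl,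
      fun i hi j hj _ => (Nat.le_zero.1 hi).trans (Nat.le_zero.1 hj).symm, fun i hi => by omega⟩
  | @cons x y b h p ih =>
    rcases ih with ⟨t, ht, s, f, hf0, hf⟩ | ⟨t, ht, hpar, f, hf0, hft, hinj, hadj⟩
    · exact Or.inl ⟨t, ht.trans (by simp), s, f, hf0, hf⟩
    · rw [Walk.length_cons]
      -- The path from `b` to `y` meets the new edge from `y` to `x`. If `x` is new, the path grows.
      -- If `x` is its last entry but one, the walk backtracks and the path loses one node, keeping
      -- the parity. If `x` is an earlier entry, the edge is a chord.
      by_cases hx : ∃ s ≤ t, f s = x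
      · obtain ⟨s, hs, rfl⟩ := hx
        rcases hs.eq_or_lt with rfl | hs
        · rw [hft] at h; exact absurd h (G.loopless.irrefl _)
        · rcases (Nat.succ_le_of_lt hs).eq_or_lt with hs1 | hs1
          · refine Or.inr ⟨s, by omega, by omega, f, hf0, rfl,
              hinj.mono (Set.Iic_subset_Iic.2 hs.le), fun i hi => hadj i (hi.trans hs)⟩
          · exact Or.inl ⟨t, by omega, s, f, hf0, hs1, hinj, hadj, by rw [hft]; exact h.symm⟩
      · push Not at hx
        refine Or.inr ⟨t + 1, by omega, by omega, Function.update f (t + 1) x, ?_, by simp, ?_, ?_⟩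
        · rw [Function.update_of_ne (by omega), hf0]
        · intro i hi j hj hij
          simp only [Set.mem_Iic] at hi hj
          rcases hi.eq_or_lt with rfl | hi'
          · rcases hj.eq_or_lt with rfl | hj'
            · rfl
            · rw [Function.update_self, Function.update_of_ne hj'.ne] at hij
              exact absurd hij.symm (hx j (by omega))
          · rcases hj.eq_or_lt with rfl | hj'
            · rw [Function.update_self, Function.update_of_ne hi'.ne] at hij
              exact absurd hij (hx i (by omega))
            · rw [Function.update_of_ne hi'.ne, Function.update_of_ne hj'.ne] at hij
              exact hinj (Nat.lt_succ_iff.1 hi') (Nat.lt_succ_iff.1 hj') hij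
        · intro i hi
          rw [Function.update_of_ne (by omega)]
          rcases (Nat.lt_succ_iff.1 hi).eq_or_lt with rfl | hi'
          · rw [Function.update_self, hft]; exact h.symm
          · rw [Function.update_of_ne (by omega)]; exact hadj i hi'

/-- The alternative is a path from `b` to `b`, which has the even length `0`. -/
theorem Walk.exists_lasso_of_odd {b : V} (p : G.Walk b b) (hp : Odd p.length) :
    ∃ t ≤ p.length, ∃ s f, f 0 = b ∧ G.IsLasso t s f := by
  rcases p.exists_lasso_or_path with h | ⟨t, -, hpar, f, hf0, hft, hinj, -⟩
  · exact h
  · have h0 : 0 = t := hinj (Nat.zero_le t) (le_refl t) (hf0.trans hft.symm)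
    rw [Nat.odd_iff] at hp
    omega

end SimpleGraph

/-! ### Counting tuples satisfying a `∧`-description near exceptional nodes. -/

section Homs

variable {k : ℕ}

/-- The graph on the variables of a `∧`-description. -/
def WedgeDesc.graph (ψ : WedgeDesc k) : SimpleGraph (Fin k) :=
  SimpleGraph.fromRel fun a b => (a, b) ∈ ψ

theorem WedgeDesc.Holds.adj {V : Type} {G : SimpleGraph V} {ψ : WedgeDesc k} {u : Fin k → V}
    (h : ψ.Holds G u) {a b : Fin k} (hab : ψ.graph.Adj a b) : G.Adj (u a) (u b) := by
  rw [WedgeDesc.graph, SimpleGraph.fromRel_adj] at hab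
  rcases hab.2 with h' | h'
  · exact h _ h'
  · exact (h _ h').symm

/-- A bound for the lengths of some odd closed walks. -/
theorem WedgeDesc.exists_odd_walk_bound (ψ : WedgeDesc k) :
    ∃ T : ℕ, ∀ i, (∃ p : ψ.graph.Walk i i, Odd p.length) →
      ∃ p : ψ.graph.Walk i i, Odd p.length ∧ p.length ≤ T := by
  classical
  have h : ∀ i, ∃ T : ℕ, (∃ p : ψ.graph.Walk i i, Odd p.length) →
      ∃ p : ψ.graph.Walk i i, Odd p.length ∧ p.length ≤ T := by
    intro i
    by_cases hi : ∃ p : ψ.graph.Walk i i, Odd p.length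
    · obtain ⟨p, hp⟩ := hi
      exact ⟨p.length, fun _ => ⟨p, hp, le_rfl⟩⟩
    · exact ⟨0, fun h => absurd h hi⟩
  choose T hT using h
  refine ⟨Finset.univ.sup T, fun i hi => ?_⟩
  obtain ⟨p, hp, hpT⟩ := hT i hi
  exact ⟨p, hp, hpT.trans (Finset.le_sup (Finset.mem_univ i))⟩

/-- If the nodes of `B` are not close to short odd cycles, then the `i`-th entry of few tuples which
satisfy `ψ` is close to `B`. -/
theorem WedgeDesc.ncard_holds_near_le {V : Type} [Fintype V] {G : SimpleGraph V} (ψ : WedgeDesc k)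
    (i : Fin k) {B : Set V} {D T Δ : ℕ} (hΔ : ∀ v, (G.neighborSet v).ncard ≤ Δ)
    (hT : ∀ i, (∃ p : ψ.graph.Walk i i, Odd p.length) →
      ∃ p : ψ.graph.Walk i i, Odd p.length ∧ p.length ≤ T)
    (hB : ∀ b ∈ B, ∀ t ≤ T + 2 * D, ∀ s f, f 0 = b → ¬ G.IsLasso t s f) :
    {u | ψ.Holds G u ∧ u i ∈ G.nearSet B D}.ncard * {x | ∃ y, G.Adj x y}.ncard ≤
      {u | ψ.Holds G u}.ncard * (B.ncard * (Δ + 1) ^ D * ((Δ + 1) ^ k) ^ k) := by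
  classical
  rcases Set.eq_empty_or_nonempty {u | ψ.Holds G u ∧ u i ∈ G.nearSet B D} with h0 | ⟨u₀, hu₀⟩
  · rw [h0]; simp
  have hloop : ∀ e ∈ ψ, ψ.graph.Adj e.1 e.2 := by
    intro e he
    rw [WedgeDesc.graph, SimpleGraph.fromRel_adj]
    refine ⟨fun h => ?_, Or.inl he⟩
    have := hu₀.1 e he
    rw [h] at this
    exact G.loopless.irrefl _ this
  -- The image of an odd closed walk at `i`, conjugated by a walk of length at most `D` to a node of
  -- `B`, is an odd closed walk of length at most `T + 2 * D` there, and yields a forbidden lasso.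
  have hodd : ¬ ∃ p : ψ.graph.Walk i i, Odd p.length := by
    intro hp
    obtain ⟨p, hp, hpT⟩ := hT i hp
    obtain ⟨hu, b, hb, q, hq⟩ := hu₀
    let φ : ψ.graph →g G := ⟨u₀, fun hab => hu.adj hab⟩
    let p' : G.Walk b b := q.reverse.append ((p.map φ).append q)
    have hlen : p'.length = p.length + 2 * q.length := by
      simp [p']; ring
    have hp' : Odd p'.length := by
      rw [hlen]; exact hp.add_even (even_two_mul _)
    obtain ⟨t, ht, s, f, hf0, hf⟩ := p'.exists_lasso_of_odd hp'
    exact hB b hb t (by omega) s f hf0 hf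
  -- Without odd closed walks at `i`, the parity of walks from `i` properly 2-colours its component.
  let col : Fin k → Prop := fun a => ∃ p : ψ.graph.Walk i a, Odd p.length
  have hcol : ∀ a b, ψ.graph.Adj a b → ψ.graph.Reachable i a → (col a ↔ ¬ col b) := by
    intro a b hab ⟨p⟩
    constructor
    · rintro ⟨p₁, hp₁⟩ ⟨p₂, hp₂⟩
      refine hodd ⟨(p₁.concat hab).append p₂.reverse, ?_⟩
      rw [SimpleGraph.Walk.length_append, SimpleGraph.Walk.length_concat,
        SimpleGraph.Walk.length_reverse]
      exact hp₁.add_one.add_odd hp₂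
    · intro hb
      by_contra ha
      refine hb ⟨p.concat hab, ?_⟩
      rw [SimpleGraph.Walk.length_concat]
      exact (Nat.not_odd_iff_even.1 fun h => ha ⟨p, h⟩).add_one
  let I : Set V := {x | ∃ y, G.Adj x y}
  let nb : V → V := fun x => if h : ∃ y, G.Adj x y then h.choose else x
  have hnb : ∀ x ∈ I, G.Adj x (nb x) := by
    intro x hx
    have hx' : ∃ y, G.Adj x y := hx
    simp only [nb, dif_pos hx']
    exact hx'.choose_spec
  -- Tuples with all entries within distance `k` of a single node near `B`; their number does not
  -- involve the number of nodes of the graph except through `B` and `Δ`.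
  let Z : Finset (Fin k → V) := (G.nearSet B D).toFinset.biUnion fun x =>
    Fintype.piFinset fun _ => (G.nearSet {x} k).toFinset
  have hZ : Z.card ≤ B.ncard * (Δ + 1) ^ D * ((Δ + 1) ^ k) ^ k := by
    refine (Finset.card_biUnion_le_card_mul _ _ (((Δ + 1) ^ k) ^ k) fun x _ => ?_).trans ?_
    · rw [Fintype.card_piFinset, Finset.prod_const, Finset.card_univ, Fintype.card_fin]
      refine Nat.pow_le_pow_left ?_ k
      rw [← Set.ncard_coe_finset, Set.coe_toFinset]
      simpa using G.ncard_nearSet_le hΔ {x} k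
    · refine Nat.mul_le_mul_right _ ?_
      rw [← Set.ncard_coe_finset, Set.coe_toFinset]
      exact G.ncard_nearSet_le hΔ B D
  -- The first tuple folds the component of `i` onto the edge from `x` to `nb x`, with `i` sent to
  -- `x`, and keeps the other entries. The second stores the overwritten entries, padded by `u i`.
  -- Together they determine `u` and `x`.
  let Φ : (Fin k → V) × V → (Fin k → V) × (Fin k → V) := fun q =>
    (fun a => if ψ.graph.Reachable i a then (if col a ↔ col i then q.2 else nb q.2) else q.1 a,
      fun a => if ψ.graph.Reachable i a then q.1 a else q.1 i)
  have hΦ : ∀ q ∈ {u | ψ.Holds G u ∧ u i ∈ G.nearSet B D} ×ˢ I,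
      Φ q ∈ {u | ψ.Holds G u} ×ˢ (Z : Set (Fin k → V)) := by
    rintro ⟨u, x⟩ ⟨⟨hu, hui⟩, hx⟩
    refine ⟨fun e he => ?_, ?_⟩
    · have hadj := hloop e he
      have hreach : ψ.graph.Reachable i e.1 ↔ ψ.graph.Reachable i e.2 :=
        ⟨fun h => h.trans hadj.reachable, fun h => h.trans hadj.symm.reachable⟩
      simp only [Φ]
      by_cases hr : ψ.graph.Reachable i e.1
      · rw [if_pos hr, if_pos (hreach.1 hr)]
        have hc := hcol _ _ hadj hr
        by_cases h1 : col e.1 ↔ col i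
        · rw [if_pos h1, if_neg (by tauto)]; exact hnb x hx
        · rw [if_neg h1, if_pos (by tauto)]; exact (hnb x hx).symm
      · rw [if_neg hr, if_neg (fun h => hr (hreach.2 h))]
        exact hu e he
    · simp only [Z, Finset.coe_biUnion, Set.mem_iUnion, Finset.mem_coe, Set.mem_toFinset,
        Fintype.mem_piFinset, exists_prop, Φ]
      refine ⟨u i, hui, fun a => ⟨u i, rfl, ?_⟩⟩
      by_cases hr : ψ.graph.Reachable i a
      · rw [if_pos hr]
        obtain ⟨p, hp⟩ := hr.symm.exists_isPath
        let φ : ψ.graph →g G := ⟨u, fun hab => hu.adj hab⟩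
        refine ⟨p.map φ, ?_⟩
        have := hp.length_lt
        rw [Fintype.card_fin] at this
        rw [SimpleGraph.Walk.length_map]
        exact this.le
      · rw [if_neg hr]
        exact ⟨SimpleGraph.Walk.nil, Nat.zero_le _⟩
  have hinj : Set.InjOn Φ ({u | ψ.Holds G u ∧ u i ∈ G.nearSet B D} ×ˢ I) := by
    rintro ⟨u, x⟩ - ⟨u', x'⟩ - h
    simp only [Φ, Prod.mk.injEq] at h
    have hx := congrFun h.1 i
    simp only [SimpleGraph.Reachable.refl, if_true] at hx
    refine Prod.ext (funext fun a => ?_) hx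
    by_cases hr : ψ.graph.Reachable i a
    · have := congrFun h.2 a
      simpa only [hr, if_true] using this
    · have := congrFun h.1 a
      simpa only [hr, if_false] using this
  have := Set.ncard_le_ncard_of_injOn Φ hΦ hinj (Set.toFinite _)
  rw [Set.ncard_prod, Set.ncard_prod, Set.ncard_coe_finset] at this
  exact this.trans (Nat.mul_le_mul_left _ hZ)

end Homs

/-! ### Sequences of random featured graphs -/

instance {n d : ℕ} (γ : Measure (SimpleGraph (Fin n))) [IsProbabilityMeasure γ]
    (F : Measure (Feat d)) [IsProbabilityMeasure F] : IsProbabilityMeasure (withFeatures γ F) := by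
  unfold withFeatures; infer_instance

/-- Markov's inequality for the number of events which occur. -/
theorem mul_real_le_sum_real {Ω ι : Type*} [MeasurableSpace Ω] (μ : Measure Ω) [IsFiniteMeasure μ]
    [Fintype ι] (E : ι → Set Ω) {t : ℝ} :
    t * μ.real {ω | t ≤ ({b | ω ∈ E b}.ncard : ℝ)} ≤ ∑ b, μ.real (E b) := by
  classical
  -- The events need not be measurable, so they are replaced by measurable hulls of the same
  -- measure.
  let f : Ω → ℝ := fun ω => ∑ b, Set.indicator (toMeasurable μ (E b)) (fun _ => (1 : ℝ)) ω
  have hi : ∀ b, Integrable (Set.indicator (toMeasurable μ (E b)) fun _ => (1 : ℝ)) μ := fun b =>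
    (integrable_const _).indicator (measurableSet_toMeasurable _ _)
  have hf0 : ∀ ω, 0 ≤ f ω := fun ω => Finset.sum_nonneg fun b _ =>
    Set.indicator_nonneg (fun _ _ => zero_le_one) _
  have h1 := mul_meas_ge_le_integral_of_nonneg (Eventually.of_forall hf0)
    (integrable_finsetSum _ fun b _ => hi b) t
  have h2 : ∫ ω, f ω ∂μ = ∑ b, μ.real (E b) := by
    rw [integral_finsetSum _ fun b _ => hi b]
    refine Finset.sum_congr rfl fun b _ => ?_
    rw [integral_indicator_const _ (measurableSet_toMeasurable _ _), smul_eq_mul, mul_one,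
      measureReal_def, measure_toMeasurable, measureReal_def]
  rw [h2] at h1
  rcases le_or_gt t 0 with ht | ht
  · exact (mul_nonpos_of_nonpos_of_nonneg ht measureReal_nonneg).trans
      (Finset.sum_nonneg fun b _ => measureReal_nonneg)
  refine le_trans (mul_le_mul_of_nonneg_left (measureReal_mono fun ω hω => ?_) ht.le) h1
  refine le_trans (show t ≤ _ from hω) ?_
  have h3 : ({b | ω ∈ E b}.ncard : ℝ) = ∑ b, Set.indicator (E b) (fun _ => (1 : ℝ)) ω := by
    simp only [Set.indicator_apply]
    rw [Finset.sum_boole, ← Set.ncard_coe_finset]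
    simp
  rw [h3]
  exact Finset.sum_le_sum fun b _ =>
    Set.indicator_le_indicator_of_subset (subset_toMeasurable _ _) (fun _ => zero_le_one) ω

/-! ### Reduction to good tuples, and the superlogarithmic case. -/

namespace LocalLimit

variable {d m : ℕ}

/-- The random graphs with edge probabilities `w n` and communities `C n` have the limit data `L`
when degrees are measured at the scale `s n`. -/
structure Converges (L : LocalLimit d m) (w : (n : ℕ) → Sym2 (Fin n) → unitInterval)
    (C : (n : ℕ) → Fin n → Fin m) (s : ℕ → ℝ) : Prop where
  scale : Tendsto s atTop atTop
  communities : ∀ j, Tendsto (fun n : ℕ => ({v : Fin n | C n v = j}.ncard : ℝ) / (n : ℝ)) atTop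
    (𝓝 (L.q j))
  degrees : ∀ j, ∀ r > 0, ∀ᶠ n in atTop, ∀ b : Fin n,
    |∑ v with C n v = j, (w n s(b, v) : ℝ) - s n * L.lam (C n b) j| ≤ r * s n
  isolated : ∀ᶠ n in atTop, ∀ b : Fin n, (∀ j, L.lam (C n b) j = 0) → ∀ v, (w n s(b, v) : ℝ) = 0

variable {L : LocalLimit d m} {w : (n : ℕ) → Sym2 (Fin n) → unitInterval}
  {C : (n : ℕ) → Fin n → Fin m} {s : ℕ → ℝ}

theorem tendsto_real_norm_gt (γ : (n : ℕ) → Measure (SimpleGraph (Fin n)))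
    [∀ n, IsProbabilityMeasure (γ n)] :
    Tendsto (fun n => (withFeatures (γ n) L.F).real {ω | ¬ ∀ v, ‖ω.2 v‖ ≤ L.B}) atTop (𝓝 0) := by
  have h : ∀ n, (withFeatures (γ n) L.F).real {ω | ¬ ∀ v, ‖ω.2 v‖ ≤ L.B} = 0 := by
    intro n
    have h1 : ∀ᵐ H : Fin n → Feat d ∂(Measure.pi fun _ => L.F), ∀ v, ‖H v‖ ≤ L.B :=
      ae_all_iff.2 fun v => (Measure.tendsto_eval_ae_ae (μ := fun _ : Fin n => L.F) (i := v)).eventually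
        L.ae_le
    have h2 : ∀ᵐ ω ∂(withFeatures (γ n) L.F), ∀ v, ‖ω.2 v‖ ≤ L.B :=
      Measure.quasiMeasurePreserving_snd.ae h1
    rw [measureReal_def, ae_iff.1 h2, ENNReal.toReal_zero]
  simp_rw [h]
  exact tendsto_const_nhds

theorem Converges.tendsto_real_isolated (h : L.Converges w C s) :
    Tendsto (fun n => (withFeatures (inhomGraph (w n)) L.F).real
      {ω | ¬ ∀ v, (∀ j, L.lam (C n v) j = 0) → ∀ v', ¬ ω.1.Adj v v'}) atTop (𝓝 0) := by
  refine tendsto_const_nhds.congr' ?_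
  filter_upwards [h.isolated] with n hn
  symm
  have h1 : {ω : SimpleGraph (Fin n) × (Fin n → Feat d) |
      ¬ ∀ v, (∀ j, L.lam (C n v) j = 0) → ∀ v', ¬ ω.1.Adj v v'} ⊆
      ⋃ q ∈ (Finset.univ : Finset (Fin n × Fin n)),
        {ω | (∀ j, L.lam (C n q.1) j = 0) ∧ ω.1.Adj q.1 q.2} := by
    intro ω hω
    simp only [Set.mem_ofPred_eq, not_forall, not_not] at hω
    obtain ⟨v, hv, v', hvv⟩ := hω
    simp only [Set.mem_iUnion]
    exact ⟨(v, v'), Finset.mem_univ _, hv, hvv⟩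
  refine le_antisymm ((measureReal_mono h1 (measure_ne_top _ _)).trans
    ((measureReal_biUnion_finset_le _ _).trans ?_))
    measureReal_nonneg
  refine Finset.sum_nonpos fun q _ => ?_
  by_cases hq : ∀ j, L.lam (C n q.1) j = 0
  · by_cases hne : q.1 = q.2
    · have : {ω : SimpleGraph (Fin n) × (Fin n → Feat d) |
          (∀ j, L.lam (C n q.1) j = 0) ∧ ω.1.Adj q.1 q.2} = ∅ := by
        ext ω; simp [hne]
      rw [this]; simp
    · have h2 := real_edges_le (w n) L.F (S := {s(q.1, q.2)}) (by simpa using hne)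
      rw [Finset.prod_singleton, hn q.1 hq q.2] at h2
      refine le_trans (measureReal_mono fun ω hω => ?_) h2
      simpa using hω.2
  · have : {ω : SimpleGraph (Fin n) × (Fin n → Feat d) |
        (∀ j, L.lam (C n q.1) j = 0) ∧ ω.1.Adj q.1 q.2} = ∅ := by
      ext ω; simp [hq]
    rw [this]; simp

theorem Converges.tendsto_real_not_balanced (h : L.Converges w C s) (N : ℕ) :
    Tendsto (fun n => (withFeatures (inhomGraph (w n)) L.F).real
      {ω | ¬ L.Balanced N ω.2 (C n) n L.q Set.univ}) atTop (𝓝 0) := by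
  have ht := L.tol_pos N
  have hlim : Tendsto (fun n : ℕ => L.tests N * Real.exp (-(L.tol N ^ 2 * (n : ℝ) / 16))) atTop
      (𝓝 (L.tests N * 0)) := by
    refine Tendsto.const_mul _ (Real.tendsto_exp_neg_atTop_nhds_zero.comp ?_)
    have h1 : Tendsto (fun n : ℕ => (n : ℝ) * (L.tol N ^ 2 / 16)) atTop atTop :=
      tendsto_natCast_atTop_atTop.atTop_mul_const (by positivity)
    refine h1.congr fun n => by ring
  rw [mul_zero] at hlim
  refine squeeze_zero' (Eventually.of_forall fun n => measureReal_nonneg) ?_ hlim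
  have hq : ∀ᶠ n : ℕ in atTop, ∀ j, |({v : Fin n | C n v = j}.ncard : ℝ) / n - L.q j| ≤
      L.tol N / 2 := by
    refine eventually_all.2 fun j => ?_
    have := (Metric.tendsto_nhds.1 (h.communities j)) (L.tol N / 2) (by positivity)
    filter_upwards [this] with n hn
    rw [Real.dist_eq] at hn
    exact hn.le
  filter_upwards [hq, eventually_gt_atTop 0] with n hn hn0
  have hn0' : (0 : ℝ) < n := by exact_mod_cast hn0
  have := L.real_not_balanced_univ_le (inhomGraph (w n)) N (C n) (fun j => by
    rw [Fintype.card_fin]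
    have h2 := mul_le_mul_of_nonneg_left (hn j) hn0'.le
    rw [← abs_of_pos hn0', ← abs_mul, abs_of_pos hn0', mul_sub, mul_div_cancel₀ _ hn0'.ne'] at h2
    linarith)
  rw [Fintype.card_fin] at this
  exact this

/-- If most nodes are good, and most entries of the tuples satisfying a `∧`-description are good,
with high probability, then the controllers of regular graphs approximate the terms. -/
theorem Converges.approximates (h : L.Converges w C s) {k D : ℕ} {π : AggTerm d k}
    {e : (Fin k → Feat d) → (Fin k → Fin m) → Feat d} (he : L.Approximated D e π) {T : Type}
    {tp : (n : ℕ) → SimpleGraph (Fin n) → (Fin k → Fin n) → T}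
    {e' : (Fin k → Feat d) → T → Feat d}
    (hee : ∀ n G u a, e' a (tp n G u) = e a fun i => C n (u i))
    (hgood : ∀ᶠ N : ℕ in atTop, ∀ ψ : WedgeDesc k, ∀ δ > (0 : ℝ),
      Tendsto (fun n => (withFeatures (inhomGraph (w n)) L.F).real
        {ω | ¬ (({v | ¬ L.Good N ω.1 ω.2 (C n) (s n) D v}.ncard : ℝ) ≤ n / ((N : ℝ) + 1) ∧
          ∀ i, ({u | ψ.Holds ω.1 u ∧ ¬ L.Good N ω.1 ω.2 (C n) (s n) D (u i)}.ncard : ℝ) ≤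
            δ * {u | ψ.Holds ω.1 u}.ncard)}) atTop (𝓝 0)) :
    Approximates (fun n => withFeatures (inhomGraph (w n)) L.F) tp e' π := by
  classical
  intro ε hε δ hδ θ hθ ψ
  -- The level `N` is determined by `ε` alone, before `n`. The proportion `δ / (k + 1)` leaves room
  -- for a union over the `k` entries.
  obtain ⟨N, hN, hNgood⟩ := ((he ε hε).and hgood).exists
  have hδ' : 0 < δ / (k + 1) := by positivity
  have hlim := ((tendsto_real_norm_gt (L := L) fun n => inhomGraph (w n)).add
    h.tendsto_real_isolated).add ((h.tendsto_real_not_balanced N).add (hNgood ψ _ hδ'))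
  simp only [add_zero] at hlim
  obtain ⟨n₀, hn₀⟩ := eventually_atTop.1 (((hlim.eventually (gt_mem_nhds hθ)).and
    (h.scale.eventually_ge_atTop ((N : ℝ) + 1))).and (eventually_gt_atTop 0))
  refine ⟨n₀, fun n hn => ?_⟩
  obtain ⟨⟨hlt, hsn⟩, hn0⟩ := hn₀ n hn
  set μ := withFeatures (inhomGraph (w n)) L.F
  set A := {ω : SimpleGraph (Fin n) × (Fin n → Feat d) |
    (1 - δ) * ({u : Fin k → Fin n | ψ.Holds ω.1 u}.ncard : ℝ) ≤
          ({u : Fin k → Fin n | ψ.Holds ω.1 u ∧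
            ‖e' (fun i => ω.2 (u i)) (tp n ω.1 u) - π.interp ω.1 ω.2 u‖ < ε}.ncard : ℝ)} with hA
  set E₁ := {ω : SimpleGraph (Fin n) × (Fin n → Feat d) | ¬ ∀ v, ‖ω.2 v‖ ≤ L.B}
  set E₂ := {ω : SimpleGraph (Fin n) × (Fin n → Feat d) |
    ¬ ∀ v, (∀ j, L.lam (C n v) j = 0) → ∀ v', ¬ ω.1.Adj v v'}
  set E₃ := {ω : SimpleGraph (Fin n) × (Fin n → Feat d) |
    ¬ L.Balanced N ω.2 (C n) n L.q Set.univ}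
  set E₄ := {ω : SimpleGraph (Fin n) × (Fin n → Feat d) |
    ¬ (({v | ¬ L.Good N ω.1 ω.2 (C n) (s n) D v}.ncard : ℝ) ≤ n / ((N : ℝ) + 1) ∧
          ∀ i, ({u | ψ.Holds ω.1 u ∧ ¬ L.Good N ω.1 ω.2 (C n) (s n) D (u i)}.ncard : ℝ) ≤
            δ / (k + 1) * {u | ψ.Holds ω.1 u}.ncard)}
  -- Outside of the four exceptional events the graph is regular. Covering the whole space, instead
  -- of passing to complements, avoids measurability of `A`.
  have hsub : (Set.univ : Set (SimpleGraph (Fin n) × (Fin n → Feat d))) ⊆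
      A ∪ ((E₁ ∪ E₂) ∪ (E₃ ∪ E₄)) := by
    intro ω _
    by_contra hω
    simp only [Set.mem_union, not_or] at hω
    obtain ⟨hωA, ⟨h1, h2⟩, h3, h4⟩ := hω
    simp only [E₁, E₂, E₃, E₄, Set.mem_ofPred_eq, not_not] at h1 h2 h3 h4
    refine hωA ?_
    have hreg : L.Regular N D ω.1 ω.2 (C n) (s n) :=
      { nonempty := ⟨⟨0, hn0⟩⟩
        scale := hsn
        norm_le := h1
        isolated := h2
        balanced := by rw [Fintype.card_fin]; exact h3
        bad_le := by rw [Fintype.card_fin]; exact h4.1 }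
    rw [hA, Set.mem_ofPred_eq]
    set X := {u : Fin k → Fin n | ψ.Holds ω.1 u}
    set Y := {u : Fin k → Fin n | ψ.Holds ω.1 u ∧
            ‖e' (fun i => ω.2 (u i)) (tp n ω.1 u) - π.interp ω.1 ω.2 u‖ < ε}
    have hXY : X ⊆ Y ∪ ⋃ i ∈ (Finset.univ : Finset (Fin k)),
        {u | ψ.Holds ω.1 u ∧ ¬ L.Good N ω.1 ω.2 (C n) (s n) D (u i)} := by
      intro u hu
      by_cases hug : ∀ i, L.Good N ω.1 ω.2 (C n) (s n) D (u i)
      · refine Or.inl ⟨hu, ?_⟩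
        rw [hee]
        exact hN ω.1 ω.2 (C n) (s n) hreg u hug
      · push Not at hug
        obtain ⟨i, hi⟩ := hug
        refine Or.inr ?_
        simp only [Set.mem_iUnion]
        exact ⟨i, Finset.mem_univ i, hu, hi⟩
    have hcard : (X.ncard : ℝ) ≤ Y.ncard + ∑ i : Fin k,
        ({u | ψ.Holds ω.1 u ∧ ¬ L.Good N ω.1 ω.2 (C n) (s n) D (u i)}.ncard : ℝ) := by
      have h5 := (Set.ncard_le_ncard hXY (Set.toFinite _)).trans (Set.ncard_union_le _ _)
      have h6 := Finset.set_ncard_biUnion_le (Finset.univ : Finset (Fin k)) fun i =>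
        {u | ψ.Holds ω.1 u ∧ ¬ L.Good N ω.1 ω.2 (C n) (s n) D (u i)}
      exact_mod_cast h5.trans (Nat.add_le_add_left h6 _)
    have hsum : ∑ i : Fin k,
        ({u | ψ.Holds ω.1 u ∧ ¬ L.Good N ω.1 ω.2 (C n) (s n) D (u i)}.ncard : ℝ) ≤
        δ * X.ncard := by
      refine (Finset.sum_le_sum fun i _ => h4.2 i).trans ?_
      rw [Finset.sum_const, Finset.card_univ, Fintype.card_fin, nsmul_eq_mul, ← mul_assoc]
      refine mul_le_mul_of_nonneg_right ?_ (Nat.cast_nonneg _)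
      rw [mul_div_assoc', div_le_iff₀ (by positivity)]
      nlinarith
    linarith
  have h1 : (1 : ℝ) ≤ μ.real A + (μ.real E₁ + μ.real E₂ + (μ.real E₃ + μ.real E₄)) := by
    calc (1 : ℝ) = μ.real Set.univ := by simp
      _ ≤ μ.real (A ∪ ((E₁ ∪ E₂) ∪ (E₃ ∪ E₄))) := measureReal_mono hsub
      _ ≤ μ.real A + μ.real ((E₁ ∪ E₂) ∪ (E₃ ∪ E₄)) := measureReal_union_le _ _
      _ ≤ μ.real A + (μ.real (E₁ ∪ E₂) + μ.real (E₃ ∪ E₄)) :=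
          add_le_add_right (measureReal_union_le _ _) _
      _ ≤ _ := add_le_add_right (add_le_add (measureReal_union_le _ _)
          (measureReal_union_le _ _)) _
  change 1 - θ ≤ μ.real A
  linarith

/-- For large `n`, bounds on the probability that a node on a small set of edges is bad. -/
theorem Converges.eventually_real_edges_inter_not_good_le (h : L.Converges w C s) (N T : ℕ) :
    ∀ᶠ n in atTop, ∀ (b : Fin n) (W : Finset (Fin n)) (S : Finset (Sym2 (Fin n))), b ∈ W →
      W.card ≤ T → (∀ e ∈ S, ¬ e.IsDiag) → (∀ e ∈ S, ∀ v ∈ e, v ∈ W) →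
      (withFeatures (inhomGraph (w n)) L.F).real
        {ω | (∀ e ∈ S, e ∈ ω.1.edgeSet) ∧ ¬ L.Good N ω.1 ω.2 (C n) (s n) 0 b} ≤
      L.tests N * ((∏ e ∈ S, (w n e : ℝ)) * Real.exp (-(L.rate N * s n))) := by
  have ht := L.tol_pos N
  filter_upwards [eventually_all.2 fun j => h.degrees j (L.tol N / 8) (by positivity),
    h.scale.eventually_gt_atTop 0, h.scale.eventually_ge_atTop (T * 8 / L.tol N)]
    with n hn hs0 hsT b W S hb hW hS hSW
  refine L.real_edges_inter_not_good_le (w n) N (C n) hs0 hb hS hSW ?_ fun j => ?_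
  · rw [div_le_iff₀ ht] at hsT
    have : (W.card : ℝ) ≤ T := by exact_mod_cast hW
    linarith
  · have := hn j b
    linarith

/-- Following the recursion in `Good` to a failing neighbour at each level traces the walk to an
unbalanced neighbourhood. -/
theorem not_good_iff_mem_nearSet {V : Type} {N : ℕ} {G : SimpleGraph V} {H : V → Feat d}
    {C : V → Fin m} {s : ℝ} {D : ℕ} {v : V} (hv : ¬ L.Good N G H C s D v) :
    v ∈ G.nearSet {b | ¬ L.Good N G H C s 0 b} D := by
  induction D generalizing v with
  | zero => exact ⟨v, hv, SimpleGraph.Walk.nil, le_rfl⟩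
  | succ D ih =>
    simp only [Good, not_and_or, not_forall] at hv
    rcases hv with hv | ⟨v', hvv, hv'⟩
    · obtain ⟨b, hb, p, hp⟩ := ih hv
      exact ⟨b, hb, p, hp.trans (Nat.le_succ D)⟩
    · obtain ⟨b, hb, p, hp⟩ := ih hv'
      exact ⟨b, hb, SimpleGraph.Walk.cons hvv p, by simpa using hp⟩

/-- Terms are approximated if the scale of the degrees grows faster than the logarithm. -/
theorem Converges.approximates_of_superlog (h : L.Converges w C s)
    (hlog : ∀ A : ℝ, ∀ᶠ n : ℕ in atTop, A * Real.log n ≤ s n) {k D : ℕ} {π : AggTerm d k}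
    {e : (Fin k → Feat d) → (Fin k → Fin m) → Feat d} (he : L.Approximated D e π) {T : Type}
    {tp : (n : ℕ) → SimpleGraph (Fin n) → (Fin k → Fin n) → T}
    {e' : (Fin k → Feat d) → T → Feat d}
    (hee : ∀ n G u a, e' a (tp n G u) = e a fun i => C n (u i)) :
    Approximates (fun n => withFeatures (inhomGraph (w n)) L.F) tp e' π := by
  classical
  refine h.approximates he hee (Eventually.of_forall fun N ψ δ hδ => ?_)
  have hlim : Tendsto (fun n : ℕ => L.tests N * (1 / (n : ℝ))) atTop (𝓝 (L.tests N * 0)) :=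
    (tendsto_one_div_atTop_nhds_zero_nat).const_mul _
  rw [mul_zero] at hlim
  refine squeeze_zero' (Eventually.of_forall fun n => measureReal_nonneg) ?_ hlim
  -- The factor `2 / rate` makes the failure probability of a node at most `tests / n ^ 2`, so the
  -- union over `n` nodes still tends to zero.
  filter_upwards [h.eventually_real_edges_inter_not_good_le N 1, hlog (2 / L.rate N),
    eventually_gt_atTop 0] with n hn hsn hn0
  have hn0' : (0 : ℝ) < n := by exact_mod_cast hn0
  have hb : ∀ b : Fin n, (withFeatures (inhomGraph (w n)) L.F).real
      {ω | ¬ L.Good N ω.1 ω.2 (C n) (s n) 0 b} ≤ L.tests N * Real.exp (-(2 * Real.log n)) := by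
    intro b
    have h1 := hn b {b} ∅ (by simp) (by simp) (by simp) (by simp)
    simp only [Finset.notMem_empty, IsEmpty.forall_iff, implies_true, true_and,
      Finset.prod_empty, one_mul] at h1
    refine h1.trans (mul_le_mul_of_nonneg_left (Real.exp_le_exp.2 ?_) (L.tests_nonneg N))
    have h2 := mul_le_mul_of_nonneg_left hsn (L.rate_pos N).le
    have h3 : L.rate N * (2 / L.rate N * Real.log n) = 2 * Real.log n := by
      field_simp [(L.rate_pos N).ne']
    linarith
  have hsub : {ω : SimpleGraph (Fin n) × (Fin n → Feat d) |
      ¬ (({v | ¬ L.Good N ω.1 ω.2 (C n) (s n) D v}.ncard : ℝ) ≤ n / ((N : ℝ) + 1) ∧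
          ∀ i, ({u | ψ.Holds ω.1 u ∧ ¬ L.Good N ω.1 ω.2 (C n) (s n) D (u i)}.ncard : ℝ) ≤
            δ * {u | ψ.Holds ω.1 u}.ncard)} ⊆
      ⋃ b ∈ (Finset.univ : Finset (Fin n)), {ω | ¬ L.Good N ω.1 ω.2 (C n) (s n) 0 b} := by
    intro ω hω
    by_contra hcon
    simp only [Set.mem_iUnion, Set.mem_ofPred_eq, not_exists, Finset.mem_univ, not_not,
      forall_true_left] at hcon
    have hall : ∀ v, L.Good N ω.1 ω.2 (C n) (s n) D v := by
      intro v
      by_contra hv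
      obtain ⟨b, hb, -⟩ := not_good_iff_mem_nearSet hv
      exact hb (hcon b)
    refine hω ⟨?_, fun i => ?_⟩
    · simp only [hall, not_true_eq_false, Set.ofPred_false, Set.ncard_empty, Nat.cast_zero]
      positivity
    · simp only [hall, not_true_eq_false, and_false, Set.ofPred_false, Set.ncard_empty,
        Nat.cast_zero]
      positivity
  refine (measureReal_mono hsub (measure_ne_top _ _)).trans
    ((measureReal_biUnion_finset_le _ _).trans
    ((Finset.sum_le_sum fun b _ => hb b).trans ?_))
  rw [Finset.sum_const, Finset.card_univ, Fintype.card_fin, nsmul_eq_mul]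
  have h4 : Real.exp (-(2 * Real.log n)) = 1 / ((n : ℝ) * n) := by
    rw [Real.exp_neg, two_mul, Real.exp_add, Real.exp_log hn0', one_div]
  rw [h4]
  apply le_of_eq
  field_simp

end LocalLimit

/-! ### Logarithmic growth -/

theorem tendsto_log_pow_mul_exp_neg {a b κ : ℝ} (ha : 0 ≤ a) (hb : 0 ≤ b) (hκ : 0 < κ) (R : ℕ) :
    Tendsto (fun n : ℕ => (a * Real.log n + b) ^ R * Real.exp (-(κ * Real.log n))) atTop (𝓝 0) := by
  have h1 : Tendsto (fun x : ℝ => (a + b) ^ R * (x ^ (R : ℝ) * Real.exp (-κ * x))) atTop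
      (𝓝 ((a + b) ^ R * 0)) :=
    (tendsto_rpow_mul_exp_neg_mul_atTop_nhds_zero R κ hκ).const_mul _
  rw [mul_zero] at h1
  have h2 : Tendsto (fun x : ℝ => (a * x + b) ^ R * Real.exp (-(κ * x))) atTop (𝓝 0) := by
    refine squeeze_zero' ?_ ?_ h1
    · filter_upwards [eventually_ge_atTop 0] with x hx
      positivity
    · filter_upwards [eventually_ge_atTop 1] with x hx
      rw [Real.rpow_natCast, ← mul_assoc, ← mul_pow, neg_mul]
      refine mul_le_mul_of_nonneg_right (pow_le_pow_left₀ (by positivity) ?_ R)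
        (Real.exp_pos _).le
      nlinarith
  exact h2.comp (Real.tendsto_log_atTop.comp tendsto_natCast_atTop_atTop)

namespace SimpleGraph

variable {V : Type} [DecidableEq V]

/-- The edges of a lasso. -/
def lassoEdges (t s : ℕ) (f : ℕ → V) : Finset (Sym2 V) :=
  insert s(f t, f s) ((Finset.range t).image fun i => s(f i, f (i + 1)))

theorem IsLasso.mem_edgeSet {G : SimpleGraph V} {t s : ℕ} {f : ℕ → V} (h : G.IsLasso t s f) :
    ∀ e ∈ lassoEdges t s f, e ∈ G.edgeSet := by
  intro e he
  simp only [lassoEdges, Finset.mem_insert, Finset.mem_image, Finset.mem_range] at he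
  rcases he with rfl | ⟨i, hi, rfl⟩
  · exact h.2.2.2
  · exact h.2.2.1 i hi

/-- Injectivity separates the edges of the path, and `s + 1 < t` separates the chord from the last
of them. Having as many edges as nodes is what makes lassos at bad nodes rare. -/
theorem card_lassoEdges {t s : ℕ} {f : ℕ → V} (hs : s + 1 < t) (hf : Set.InjOn f (Set.Iic t)) :
    (lassoEdges t s f).card = t + 1 := by
  have hinj : ∀ i ≤ t, ∀ j ≤ t, f i = f j → i = j := fun i hi j hj h => hf hi hj h
  rw [lassoEdges, Finset.card_insert_of_notMem, Finset.card_image_of_injOn, Finset.card_range]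
  · intro i hi j hj hij
    simp only [Finset.coe_range, Set.mem_Iio] at hi hj
    simp only [Sym2.eq_iff] at hij
    rcases hij with ⟨h1, -⟩ | ⟨h1, h2⟩
    · exact hinj i hi.le j hj.le h1
    · have h3 := hinj i hi.le (j + 1) hj h1
      have h4 := hinj (i + 1) hi j hj.le h2
      omega
  · simp only [Finset.mem_image, Finset.mem_range, not_exists, not_and, Sym2.eq_iff]
    rintro i hi (⟨h1, -⟩ | ⟨h1, h2⟩)
    · have := hinj i hi.le t le_rfl h1
      omega
    · have h3 := hinj i hi.le s (by omega) h1
      have h4 := hinj (i + 1) hi t le_rfl h2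
      omega

theorem not_isDiag_of_mem_lassoEdges {t s : ℕ} {f : ℕ → V} (hs : s + 1 < t)
    (hf : Set.InjOn f (Set.Iic t)) : ∀ e ∈ lassoEdges t s f, ¬ e.IsDiag := by
  intro e he
  simp only [lassoEdges, Finset.mem_insert, Finset.mem_image, Finset.mem_range] at he
  rcases he with rfl | ⟨i, hi, rfl⟩
  · rw [Sym2.mk_isDiag_iff]
    intro h
    have := hf (le_refl t) (show s ≤ t by omega) h
    omega
  · rw [Sym2.mk_isDiag_iff]
    intro h
    have := hf (show i ≤ t by omega) (show i + 1 ≤ t by omega) h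
    omega

theorem mem_image_of_mem_lassoEdges {t s : ℕ} {f : ℕ → V} (hs : s + 1 < t) :
    ∀ e ∈ lassoEdges t s f, ∀ v ∈ e, v ∈ (Finset.range (t + 1)).image f := by
  intro e he v hv
  simp only [lassoEdges, Finset.mem_insert, Finset.mem_image, Finset.mem_range] at he ⊢
  rcases he with rfl | ⟨i, hi, rfl⟩
  · rcases Sym2.mem_iff.1 hv with rfl | rfl
    · exact ⟨t, by omega, rfl⟩
    · exact ⟨s, by omega, rfl⟩
  · rcases Sym2.mem_iff.1 hv with rfl | rfl
    · exact ⟨i, by omega, rfl⟩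
    · exact ⟨i + 1, by omega, rfl⟩

end SimpleGraph

namespace LocalLimit

variable {d m : ℕ} {L : LocalLimit d m} {w : (n : ℕ) → Sym2 (Fin n) → unitInterval}
  {C : (n : ℕ) → Fin n → Fin m} {s : ℕ → ℝ}

/-- Probability that there is a lasso at a bad node. -/
theorem Converges.eventually_real_lasso_le (h : L.Converges w C s) (N t r : ℕ) {p : ℕ → ℝ}
    (hw : ∀ n e, (w n e : ℝ) ≤ p n) :
    ∀ᶠ n in atTop, (withFeatures (inhomGraph (w n)) L.F).real
        {ω | ∃ f : ℕ → Fin n, ¬ L.Good N ω.1 ω.2 (C n) (s n) 0 (f 0) ∧ ω.1.IsLasso t r f} ≤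
      L.tests N * (((n : ℝ) * p n) ^ (t + 1) * Real.exp (-(L.rate N * s n))) := by
  classical
  filter_upwards [h.eventually_real_edges_inter_not_good_le N (t + 1)] with n hn
  -- Only the entries `0, …, t` of a lasso matter, so the union bound runs over `n ^ (t + 1)`
  -- tuples; the values beyond `t` are arbitrary.
  let ext : (Fin (t + 1) → Fin n) → ℕ → Fin n := fun g i =>
    if hi : i < t + 1 then g ⟨i, hi⟩ else g 0
  let E : (Fin (t + 1) → Fin n) → Set (SimpleGraph (Fin n) × (Fin n → Feat d)) := fun g =>
    {ω | (r + 1 < t ∧ Set.InjOn (ext g) (Set.Iic t)) ∧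
      (∀ e ∈ SimpleGraph.lassoEdges t r (ext g), e ∈ ω.1.edgeSet) ∧
      ¬ L.Good N ω.1 ω.2 (C n) (s n) 0 (ext g 0)}
  have hE : ∀ g, (withFeatures (inhomGraph (w n)) L.F).real (E g) ≤
      L.tests N * (p n ^ (t + 1) * Real.exp (-(L.rate N * s n))) := by
    intro g
    by_cases hg : r + 1 < t ∧ Set.InjOn (ext g) (Set.Iic t)
    · have h1 := hn (ext g 0) ((Finset.range (t + 1)).image (ext g))
        (SimpleGraph.lassoEdges t r (ext g))
        (Finset.mem_image.2 ⟨0, Finset.mem_range.2 (Nat.succ_pos t), rfl⟩)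
        (Finset.card_image_le.trans (by simp))
        (SimpleGraph.not_isDiag_of_mem_lassoEdges hg.1 hg.2)
        (SimpleGraph.mem_image_of_mem_lassoEdges hg.1)
      have h2 : ∏ e ∈ SimpleGraph.lassoEdges t r (ext g), (w n e : ℝ) ≤ p n ^ (t + 1) := by
        rw [← SimpleGraph.card_lassoEdges hg.1 hg.2, ← Finset.prod_const]
        exact Finset.prod_le_prod (fun e _ => (w n e).2.1) fun e _ => hw n e
      refine (measureReal_mono (fun ω hω => hω.2)).trans (h1.trans ?_)
      exact mul_le_mul_of_nonneg_left (mul_le_mul_of_nonneg_right h2 (Real.exp_pos _).le)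
        (L.tests_nonneg N)
    · have : E g = ∅ := Set.eq_empty_iff_forall_notMem.2 fun ω hω => hg hω.1
      rw [this, measureReal_empty]
      have hp : 0 ≤ p n := (w n s(g 0, g 0)).2.1.trans (hw n _)
      have := L.tests_nonneg N
      positivity
  have hsub : {ω : SimpleGraph (Fin n) × (Fin n → Feat d) |
      ∃ f : ℕ → Fin n, ¬ L.Good N ω.1 ω.2 (C n) (s n) 0 (f 0) ∧ ω.1.IsLasso t r f} ⊆
      ⋃ g ∈ (Finset.univ : Finset (Fin (t + 1) → Fin n)), E g := by
    rintro ω ⟨f, hf0, hf⟩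
    simp only [Set.mem_iUnion]
    have hext : ∀ i ≤ t, ext (fun i => f i) i = f i := fun i hi => by
      simp only [ext, dif_pos (Nat.lt_succ_of_le hi)]
    have hl : SimpleGraph.lassoEdges t r (ext fun i => f i) = SimpleGraph.lassoEdges t r f := by
      have hr := hf.1
      unfold SimpleGraph.lassoEdges
      rw [hext t le_rfl, hext r (by omega)]
      congr 1
      refine Finset.image_congr fun i hi => ?_
      simp only [Finset.coe_range, Set.mem_Iio] at hi
      rw [hext i hi.le, hext (i + 1) hi]
    refine ⟨fun i => f i, Finset.mem_univ _, ⟨hf.1, hf.2.1.congr fun i hi => (hext i hi).symm⟩,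
      ?_, ?_⟩
    · rw [hl]; exact hf.mem_edgeSet
    · rw [hext 0 (Nat.zero_le t)]; exact hf0
  refine (measureReal_mono hsub (measure_ne_top _ _)).trans
    ((measureReal_biUnion_finset_le _ _).trans ((Finset.sum_le_sum fun g _ => hE g).trans ?_))
  rw [Finset.sum_const, Finset.card_univ, Fintype.card_fun, Fintype.card_fin, Fintype.card_fin,
    nsmul_eq_mul, mul_pow]
  push_cast
  apply le_of_eq
  ring

/-- Conclusions about tuples when there are few bad nodes, bounded degrees, and no lassos at bad
nodes. -/
theorem ncard_not_good_le {n : ℕ} {G : SimpleGraph (Fin n)} {H : Fin n → Feat d}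
    {C : Fin n → Fin m} {s : ℝ} {N k D T : ℕ} {η Δ : ℝ} (hs : 0 < s)
    (hlam : ∀ i, 1 / ((N : ℝ) + 1) < ∑ j, L.lam i j) (ψ : WedgeDesc k)
    (hT : ∀ i, (∃ p : ψ.graph.Walk i i, Odd p.length) →
      ∃ p : ψ.graph.Walk i i, Odd p.length ∧ p.length ≤ T)
    (hΔ : ∀ v, ((G.neighborSet v).ncard : ℝ) ≤ Δ) (hη0 : 0 ≤ η) (hη : η ≤ 1 / 2)
    (hbad : ({b | ¬ L.Good N G H C s 0 b}.ncard : ℝ) * (Δ + 1) ^ (D + k * k) ≤ η * n)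
    (hlasso : ∀ t ≤ T + 2 * D, ∀ r ≤ T + 2 * D, ¬ ∃ f : ℕ → Fin n,
      ¬ L.Good N G H C s 0 (f 0) ∧ G.IsLasso t r f) :
    ({v | ¬ L.Good N G H C s D v}.ncard : ℝ) ≤ η * n ∧
    ∀ i, ({u | ψ.Holds G u ∧ ¬ L.Good N G H C s D (u i)}.ncard : ℝ) ≤
      2 * η * {u | ψ.Holds G u}.ncard := by
  classical
  rcases Nat.eq_zero_or_pos n with hn0 | hn0
  · subst hn0
    refine ⟨by simp [Set.eq_empty_of_isEmpty], fun i => ?_⟩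
    have : {u | ψ.Holds G u ∧ ¬ L.Good N G H C s D (u i)} = ∅ :=
      Set.eq_empty_iff_forall_notMem.2 fun u _ => (u i).elim0
    rw [this]; simp; positivity
  have hn0' : (0 : ℝ) < n := by exact_mod_cast hn0
  set B := {b | ¬ L.Good N G H C s 0 b} with hB
  have hΔ0 : 0 ≤ Δ := (Nat.cast_nonneg _).trans (hΔ ⟨0, hn0⟩)
  set M := ⌊Δ⌋₊ with hM
  have hMΔ : (M : ℝ) + 1 ≤ Δ + 1 := by linarith [Nat.floor_le hΔ0]
  have hdeg : ∀ v, (G.neighborSet v).ncard ≤ M := fun v => Nat.le_floor (hΔ v)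
  have hD : ({v | ¬ L.Good N G H C s D v}.ncard : ℝ) ≤ η * n := by
    have h1 : {v | ¬ L.Good N G H C s D v}.ncard ≤ B.ncard * (M + 1) ^ D :=
      (Set.ncard_le_ncard (fun v hv => not_good_iff_mem_nearSet hv) (Set.toFinite _)).trans
        (G.ncard_nearSet_le hdeg B D)
    have h2 : ({v | ¬ L.Good N G H C s D v}.ncard : ℝ) ≤ B.ncard * ((M : ℝ) + 1) ^ D := by
      exact_mod_cast h1
    refine h2.trans (le_trans ?_ hbad)
    refine mul_le_mul_of_nonneg_left ?_ (Nat.cast_nonneg _)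
    calc ((M : ℝ) + 1) ^ D ≤ (Δ + 1) ^ D := pow_le_pow_left₀ (by positivity) hMΔ D
      _ ≤ _ := pow_le_pow_right₀ (by linarith) (Nat.le_add_right _ _)
  refine ⟨hD, fun i => ?_⟩
  -- There must be many edges to fold onto: a balanced neighbourhood is non-empty because the rows
  -- of `lam` have sum above `1 / (N + 1)`, and at most `η n ≤ n / 2` nodes are bad.
  have hI : (n : ℝ) / 2 ≤ {x | ∃ y, G.Adj x y}.ncard := by
    have hsub : (Set.univ : Set (Fin n)) ⊆ {x | ∃ y, G.Adj x y} ∪ B := by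
      intro x _
      by_cases hx : L.Good N G H C s 0 x
      · refine Or.inl ?_
        have hb : L.Balanced N H C s (L.lam (C x)) ((G.neighborFinset x : Finset _) : Set _) := by
          rw [SimpleGraph.coe_neighborFinset]; exact hx
        have h1 := (abs_le.1 (Balanced.abs_card_sub_le L hs.le hb)).1
        have h2 := mul_lt_mul_of_pos_left (hlam (C x)) hs
        rw [mul_one_div] at h2
        have h3 : (0 : ℝ) < (G.neighborFinset x).card := by linarith
        obtain ⟨y, hy⟩ := Finset.card_pos.1 (by exact_mod_cast h3)
        exact ⟨y, by simpa using hy⟩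
      · exact Or.inr hx
    have h1 := (Set.ncard_le_ncard hsub (Set.toFinite _)).trans (Set.ncard_union_le _ _)
    rw [Set.ncard_univ, Nat.card_fin] at h1
    have h2 : (n : ℝ) ≤ {x | ∃ y, G.Adj x y}.ncard + B.ncard := by exact_mod_cast h1
    have h3 : (B.ncard : ℝ) ≤ η * n := by
      refine le_trans (le_mul_of_one_le_right (Nat.cast_nonneg _) ?_) hbad
      exact one_le_pow₀ (by linarith)
    have h4 : η * n ≤ 1 / 2 * n := mul_le_mul_of_nonneg_right hη hn0'.le
    linarith
  have hmain := ψ.ncard_holds_near_le (G := G) i (B := B) (D := D) (T := T) hdeg hT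
    (fun b hb t ht r f hf0 hf => hlasso t ht r (by have := hf.1; omega)
      ⟨f, by rw [hf0]; exact hb, hf⟩)
  have hX : {u | ψ.Holds G u ∧ ¬ L.Good N G H C s D (u i)}.ncard ≤
      {u | ψ.Holds G u ∧ u i ∈ G.nearSet B D}.ncard :=
    Set.ncard_le_ncard (fun u hu => ⟨hu.1, not_good_iff_mem_nearSet hu.2⟩) (Set.toFinite _)
  have hmain' : ({u | ψ.Holds G u ∧ ¬ L.Good N G H C s D (u i)}.ncard : ℝ) *
      {x | ∃ y, G.Adj x y}.ncard ≤
      {u | ψ.Holds G u}.ncard * (B.ncard * ((M : ℝ) + 1) ^ (D + k * k)) := by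
    have := (Nat.mul_le_mul_right _ hX).trans hmain
    rw [← pow_mul, mul_assoc B.ncard, ← pow_add] at this
    exact_mod_cast this
  have h5 : (B.ncard : ℝ) * ((M : ℝ) + 1) ^ (D + k * k) ≤ η * n :=
    le_trans (mul_le_mul_of_nonneg_left (pow_le_pow_left₀ (by positivity) hMΔ _)
      (Nat.cast_nonneg _)) hbad
  set X : ℝ := ({u | ψ.Holds G u ∧ ¬ L.Good N G H C s D (u i)}.ncard : ℝ) with hXdef
  set Y : ℝ := ({u | ψ.Holds G u}.ncard : ℝ)
  have h6 : X * (n / 2) ≤ Y * (η * n) :=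
    (mul_le_mul_of_nonneg_left hI (Nat.cast_nonneg _)).trans
      (hmain'.trans (mul_le_mul_of_nonneg_left h5 (Nat.cast_nonneg _)))
  have h7 : X * (n / 2) ≤ 2 * η * Y * (n / 2) := by linarith
  exact le_of_mul_le_mul_right h7 (by positivity)

/-- Terms are approximated if the degrees grow logarithmically. -/
theorem Converges.approximates_of_log (h : L.Converges w C s) {K K' : ℝ} (hK : 0 < K)
    (hK' : 0 ≤ K') (hs : ∀ᶠ n : ℕ in atTop, s n = K * Real.log n) {p : ℕ → ℝ}
    (hp0 : ∀ n, 0 ≤ p n) (hw : ∀ n e, (w n e : ℝ) ≤ p n)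
    (hp : ∀ᶠ n : ℕ in atTop, n * p n ≤ K' * Real.log n) (hlam : ∀ i, 0 < ∑ j, L.lam i j) {k D : ℕ}
    {π : AggTerm d k} {e : (Fin k → Feat d) → (Fin k → Fin m) → Feat d}
    (he : L.Approximated D e π) {T : Type}
    {tp : (n : ℕ) → SimpleGraph (Fin n) → (Fin k → Fin n) → T}
    {e' : (Fin k → Feat d) → T → Feat d}
    (hee : ∀ n G u a, e' a (tp n G u) = e a fun i => C n (u i)) :
    Approximates (fun n => withFeatures (inhomGraph (w n)) L.F) tp e' π := by
  classical
  have hlamN : ∀ᶠ N : ℕ in atTop, ∀ i, 1 / ((N : ℝ) + 1) < ∑ j, L.lam i j :=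
    eventually_all.2 fun i =>
      (tendsto_one_div_add_atTop_nhds_zero_nat (𝕜 := ℝ)).eventually (gt_mem_nhds (hlam i))
  refine h.approximates he hee (hlamN.mono fun N hN ψ δ hδ => ?_)
  obtain ⟨T, hT⟩ := ψ.exists_odd_walk_bound
  set T' := T + 2 * D
  set R := D + k * k
  -- As `exp 1 - 1 ≤ 2`, the degree tail at `A log n` is at most `exp (2 K' log n - A log n) = n ^
  -- (-2)`.
  set A := 2 * K' + 2 with hA
  set κ := L.rate N * K with hκ
  have hκ0 : 0 < κ := mul_pos (L.rate_pos N) hK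
  set η := min (1 / ((N : ℝ) + 1)) (min (δ / 2) (1 / 2)) with hη
  have hη0 : 0 < η := by
    refine lt_min (by positivity) (lt_min (by positivity) (by norm_num))
  have hη1 : η ≤ 1 / ((N : ℝ) + 1) := min_le_left _ _
  have hη2 : η ≤ δ / 2 := (min_le_right _ _).trans (min_le_left _ _)
  have hη3 : η ≤ 1 / 2 := (min_le_right _ _).trans (min_le_right _ _)
  -- the limits of the bounds for the exceptional events
  have hlim₁ : Tendsto (fun n : ℕ => L.tests N / η *
      ((A * Real.log n + 1) ^ R * Real.exp (-(κ * Real.log n)))) atTop (𝓝 0) := by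
    have := (tendsto_log_pow_mul_exp_neg (a := A) (b := 1) (by positivity) zero_le_one hκ0
      R).const_mul (L.tests N / η)
    simpa only [mul_zero] using this
  have hlim₂ : Tendsto (fun n : ℕ => 1 / (n : ℝ)) atTop (𝓝 0) := tendsto_one_div_atTop_nhds_zero_nat
  have hlim₃ : Tendsto (fun n : ℕ => ∑ t ∈ Finset.range (T' + 1), ∑ _r ∈ Finset.range (T' + 1),
      L.tests N * ((K' * Real.log n) ^ (t + 1) * Real.exp (-(κ * Real.log n)))) atTop
      (𝓝 0) := by
    have hterm : ∀ t : ℕ, Tendsto (fun n : ℕ => L.tests N *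
        ((K' * Real.log n) ^ (t + 1) * Real.exp (-(κ * Real.log n)))) atTop (𝓝 0) := by
      intro t
      have := (tendsto_log_pow_mul_exp_neg hK' le_rfl hκ0 (t + 1)).const_mul (L.tests N)
      simpa only [mul_zero, add_zero] using this
    have := tendsto_finsetSum (Finset.range (T' + 1)) fun t _ =>
      tendsto_finsetSum (Finset.range (T' + 1)) fun _ _ => hterm t
    simpa only [Finset.sum_const_zero] using this
  have hlim := (hlim₁.add hlim₂).add hlim₃
  simp only [add_zero] at hlim
  refine squeeze_zero' (Eventually.of_forall fun n => measureReal_nonneg) ?_ hlim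
  have hlasso : ∀ᶠ n in atTop, ∀ t ∈ Finset.range (T' + 1), ∀ r ∈ Finset.range (T' + 1),
      (withFeatures (inhomGraph (w n)) L.F).real
        {ω | ∃ f : ℕ → Fin n, ¬ L.Good N ω.1 ω.2 (C n) (s n) 0 (f 0) ∧ ω.1.IsLasso t r f} ≤
      L.tests N * (((n : ℝ) * p n) ^ (t + 1) * Real.exp (-(L.rate N * s n))) := by
    rw [eventually_all_finset]
    intro t _
    rw [eventually_all_finset]
    intro r _
    exact h.eventually_real_lasso_le N t r hw
  filter_upwards [h.eventually_real_edges_inter_not_good_le N 1, hlasso, hs, hp,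
    eventually_gt_atTop 1] with n hn hnl hsn hpn hn1
  have hn0' : (0 : ℝ) < n := by exact_mod_cast (zero_lt_one.trans hn1)
  have hlog : 0 < Real.log n := Real.log_pos (by exact_mod_cast hn1)
  have hs0 : 0 < s n := by rw [hsn]; positivity
  have hrate : L.rate N * s n = κ * Real.log n := by rw [hsn, hκ, mul_assoc]
  rw [hrate] at hn hnl
  set μ := withFeatures (inhomGraph (w n)) L.F
  set Δ := A * Real.log n with hΔ
  have hΔ0 : 0 ≤ Δ := by positivity
  let Bad : SimpleGraph (Fin n) × (Fin n → Feat d) → Set (Fin n) := fun ω =>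
    {b | ¬ L.Good N ω.1 ω.2 (C n) (s n) 0 b}
  -- Too many bad nodes, bounded by Markov's inequality: their expected number is at most `tests * n
  -- ^ (1 - κ)`, which beats `n` divided by a power of the logarithm for every `κ > 0`. The other
  -- two events are a large degree and a short lasso at a bad node.
  let E₁ : Set (SimpleGraph (Fin n) × (Fin n → Feat d)) :=
    {ω | η * n / (Δ + 1) ^ R ≤ ((Bad ω).ncard : ℝ)}
  let E₂ : Set (SimpleGraph (Fin n) × (Fin n → Feat d)) :=
    ⋃ b ∈ (Finset.univ : Finset (Fin n)), {ω | Δ ≤ ((ω.1.neighborSet b).ncard : ℝ)}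
  let E₃ : Set (SimpleGraph (Fin n) × (Fin n → Feat d)) :=
    ⋃ t ∈ Finset.range (T' + 1), ⋃ r ∈ Finset.range (T' + 1),
      {ω | ∃ f : ℕ → Fin n, ¬ L.Good N ω.1 ω.2 (C n) (s n) 0 (f 0) ∧ ω.1.IsLasso t r f}
  have h₁ : μ.real E₁ ≤ L.tests N / η *
      ((A * Real.log n + 1) ^ R * Real.exp (-(κ * Real.log n))) := by
    have hb : ∀ b : Fin n, μ.real {ω | ¬ L.Good N ω.1 ω.2 (C n) (s n) 0 b} ≤
        L.tests N * Real.exp (-(κ * Real.log n)) := by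
      intro b
      have h1 := hn b {b} ∅ (by simp) (by simp) (by simp) (by simp)
      simpa only [Finset.notMem_empty, IsEmpty.forall_iff, implies_true, true_and,
        Finset.prod_empty, one_mul] using h1
    have h2 := (mul_real_le_sum_real μ (fun b : Fin n =>
      {ω | ¬ L.Good N ω.1 ω.2 (C n) (s n) 0 b}) (t := η * n / (Δ + 1) ^ R)).trans
      (Finset.sum_le_sum fun b _ => hb b)
    rw [Finset.sum_const, Finset.card_univ, Fintype.card_fin, nsmul_eq_mul] at h2
    have h3 : 0 < (Δ + 1) ^ R := by positivity
    have h4 : η * n / (Δ + 1) ^ R * μ.real E₁ ≤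
        n * (L.tests N * Real.exp (-(κ * Real.log n))) := h2
    rw [div_mul_eq_mul_div, div_le_iff₀ h3] at h4
    have h5 : (η * n) * μ.real E₁ ≤ (η * n) * (L.tests N / η *
        ((Δ + 1) ^ R * Real.exp (-(κ * Real.log n)))) := by
      refine h4.trans (le_of_eq ?_)
      field_simp
    exact le_of_mul_le_mul_left h5 (by positivity)
  have h₂ : μ.real E₂ ≤ 1 / n := by
    have hb : ∀ b : Fin n, μ.real {ω | Δ ≤ ((ω.1.neighborSet b).ncard : ℝ)} ≤
        Real.exp (-(2 * Real.log n)) := by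
      intro b
      refine (real_degree_ge_le (w n) L.F b Δ).trans (Real.exp_le_exp.2 ?_)
      have h1 : ∑ v, (w n s(b, v) : ℝ) ≤ K' * Real.log n := by
        refine (Finset.sum_le_sum fun v _ => hw n _).trans ?_
        simpa using hpn
      have h2 : Real.exp 1 - 1 ≤ 2 := by linarith [Real.exp_one_lt_d9]
      have h3 : 0 ≤ Real.exp 1 - 1 := by linarith [Real.add_one_le_exp 1]
      have h4 : (∑ v, (w n s(b, v) : ℝ)) * (Real.exp 1 - 1) ≤ K' * Real.log n * 2 :=
        mul_le_mul h1 h2 h3 (by positivity)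
      rw [hΔ, hA]
      linarith
    refine (measureReal_biUnion_finset_le _ _).trans ((Finset.sum_le_sum fun b _ => hb b).trans ?_)
    rw [Finset.sum_const, Finset.card_univ, Fintype.card_fin, nsmul_eq_mul, Real.exp_neg, two_mul,
      Real.exp_add, Real.exp_log hn0']
    apply le_of_eq
    field_simp
  have h₃ : μ.real E₃ ≤ ∑ t ∈ Finset.range (T' + 1), ∑ _r ∈ Finset.range (T' + 1),
      L.tests N * ((K' * Real.log n) ^ (t + 1) * Real.exp (-(κ * Real.log n))) := by
    refine (measureReal_biUnion_finset_le _ _).trans (Finset.sum_le_sum fun t ht => ?_)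
    refine (measureReal_biUnion_finset_le _ _).trans (Finset.sum_le_sum fun r hr => ?_)
    refine (hnl t ht r hr).trans (mul_le_mul_of_nonneg_left ?_ (L.tests_nonneg N))
    exact mul_le_mul_of_nonneg_right (pow_le_pow_left₀ (mul_nonneg hn0'.le (hp0 n)) hpn _)
      (Real.exp_pos _).le
  refine le_trans (measureReal_mono (s₂ := E₁ ∪ E₂ ∪ E₃) ?_ (measure_ne_top _ _))
    ((measureReal_union_le _ _).trans (add_le_add ((measureReal_union_le _ _).trans
      (add_le_add h₁ h₂)) h₃))
  intro ω hω
  by_contra hcon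
  simp only [Set.mem_union, not_or] at hcon
  obtain ⟨⟨hc1, hc2⟩, hc3⟩ := hcon
  simp only [E₁, E₂, E₃, Set.mem_iUnion, Set.mem_ofPred_eq, not_exists, not_le, Finset.mem_univ,
    Finset.mem_range, forall_true_left] at hc1 hc2 hc3
  refine hω ?_
  obtain ⟨hg1, hg2⟩ := ncard_not_good_le (L := L) (G := ω.1) (H := ω.2) (C := C n) hs0 hN ψ hT
    (D := D) (η := η) (Δ := Δ) (fun v => (hc2 v).le) hη0.le hη3
    (by rw [lt_div_iff₀ (by positivity)] at hc1; exact hc1.le)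
    (fun t ht r hr hf => by
      obtain ⟨f, hf⟩ := hf
      exact hc3 t (Nat.lt_succ_of_le ht) r (Nat.lt_succ_of_le hr) f hf)
  refine ⟨hg1.trans ?_, fun i => (hg2 i).trans ?_⟩
  · rw [div_eq_mul_one_div, mul_comm]
    exact mul_le_mul_of_nonneg_left hη1 hn0'.le
  · exact mul_le_mul_of_nonneg_right (by linarith) (Nat.cast_nonneg _)

end LocalLimit

/-! ### The two models -/

/-- Diagonal pairs are excluded from the random set on the left, and drawn but discarded by
`fromEdgeSet` on the right. -/
theorem binomialRandom_eq_inhomGraph {V : Type} [Fintype V] [DecidableEq V] (p : unitInterval) :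
    SimpleGraph.binomialRandom V p = inhomGraph fun _ => p := by
  have hset : Measurable fun s : Sym2 V → Prop => {e | s e} := MeasurableEquiv.setOfPred.measurable
  have hφ : ∀ e : Sym2 V, Measurable fun q : Prop => q ∧ e ∈ (Sym2.diagSet : Set (Sym2 V))ᶜ :=
    fun e => Measurable.of_discrete
  have hmap : ∀ e : Sym2 V, (unitInterval.toNNReal p •
      Measure.dirac (e ∈ (Sym2.diagSet : Set (Sym2 V))ᶜ) +
      unitInterval.toNNReal (unitInterval.symm p) • Measure.dirac False) =
      (unitInterval.toNNReal p • Measure.dirac True +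
      unitInterval.toNNReal (unitInterval.symm p) • Measure.dirac False).map
        fun q : Prop => q ∧ e ∈ (Sym2.diagSet : Set (Sym2 V))ᶜ := by
    intro e
    rw [Measure.map_add _ _ (hφ e), Measure.map_smul, Measure.map_smul,
      Measure.map_dirac' (hφ e), Measure.map_dirac' (hφ e)]
    simp
  rw [SimpleGraph.binomialRandom_eq_map, ProbabilityTheory.setBernoulli_eq_map]
  have hprob : ∀ e : Sym2 V, IsProbabilityMeasure (unitInterval.toNNReal p •
      Measure.dirac (e ∈ (Sym2.diagSet : Set (Sym2 V))ᶜ) +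
      unitInterval.toNNReal (unitInterval.symm p) • Measure.dirac False) := by
    intro e
    rw [hmap]
    exact Measure.isProbabilityMeasure_map (hφ e).aemeasurable
  rw [Measure.infinitePi_eq_pi]
  simp_rw [hmap]
  have hprob' : ∀ e : Sym2 V, IsProbabilityMeasure ((unitInterval.toNNReal p • Measure.dirac True +
      unitInterval.toNNReal (unitInterval.symm p) • Measure.dirac False).map
        fun q : Prop => q ∧ e ∈ (Sym2.diagSet : Set (Sym2 V))ᶜ) := fun e =>
    Measure.isProbabilityMeasure_map (hφ e).aemeasurable
  rw [← Measure.pi_map_pi fun e => (hφ e).aemeasurable]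
  have hall : Measurable fun (s : Sym2 V → Prop) (e : Sym2 V) =>
      s e ∧ e ∈ (Sym2.diagSet : Set (Sym2 V))ᶜ :=
    measurable_pi_lambda _ fun e => (hφ e).comp (measurable_pi_apply e)
  rw [Measure.map_map SimpleGraph.measurable_fromEdgeSet hset,
    Measure.map_map (SimpleGraph.measurable_fromEdgeSet.comp hset) hall]
  unfold inhomGraph
  congr 1
  funext s
  ext a b
  simp only [Function.comp, SimpleGraph.fromEdgeSet_adj, Set.mem_ofPred_eq, Set.mem_compl_iff,
    Sym2.mem_diagSet, Sym2.mk_isDiag_iff]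
  tauto

theorem exists_finset_nets {d : ℕ} (B : ℝ) :
    ∃ net : ℕ → Finset (Feat d), ∀ (N : ℕ) (x : Feat d), ‖x‖ ≤ B →
      ∃ c ∈ net N, dist x c < 1 / ((N : ℝ) + 1) := by
  have h : ∀ N : ℕ, ∃ t : Finset (Feat d), ∀ x : Feat d, ‖x‖ ≤ B →
      ∃ c ∈ t, dist x c < 1 / ((N : ℝ) + 1) := by
    intro N
    obtain ⟨t, -, ht, hcov⟩ := (isCompact_closedBall (0 : Feat d) B).finite_cover_balls
      (e := 1 / ((N : ℝ) + 1)) (by positivity)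
    refine ⟨ht.toFinset, fun x hx => ?_⟩
    have := hcov (show x ∈ Metric.closedBall (0 : Feat d) B by simpa using hx)
    simp only [Set.mem_iUnion, Metric.mem_ball, exists_prop] at this
    simpa using this
  choose net hnet using h
  exact ⟨net, hnet⟩

theorem exists_localLimit {d m : ℕ} (F : Measure (Feat d)) [hF₁ : IsProbabilityMeasure F]
    (hF : ∃ B : ℝ, ∀ᵐ x ∂F, ‖x‖ ≤ B) (q : Fin m → ℝ) (hq : ∀ j, 0 ≤ q j) (hq1 : 0 < ∑ j, q j)
    (lam : Fin m → Fin m → ℝ) (hlam : ∀ i j, 0 ≤ lam i j) :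
    ∃ L : LocalLimit d m, L.F = F ∧ L.q = q ∧ L.lam = lam := by
  obtain ⟨B, hB⟩ := hF
  obtain ⟨net, hnet⟩ := exists_finset_nets (d := d) (max B 0)
  exact ⟨{ F := F, prob := hF₁, B := max B 0, B_nonneg := le_max_right _ _,
           ae_le := hB.mono fun x hx => hx.trans (le_max_left _ _), net := net, net_cover := hnet,
           q := q, q_nonneg := hq, q_sum := hq1, lam := lam, lam_nonneg := hlam }, rfl, rfl, rfl⟩

theorem eventually_mul_log_le_mul_rpow {r K : ℝ} (hr : 0 < r) (hK : 0 < K) (A : ℝ) :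
    ∀ᶠ n : ℕ in atTop, A * Real.log n ≤ K * (n : ℝ) ^ r := by
  have h1 := ((isLittleO_log_rpow_atTop hr).comp_tendsto
    (tendsto_natCast_atTop_atTop (R := ℝ))).bound (show 0 < K / (|A| + 1) by positivity)
  filter_upwards [h1, eventually_ge_atTop 1] with n hn hn1
  have hlog : 0 ≤ Real.log n := Real.log_nonneg (by exact_mod_cast hn1)
  have hpow : 0 ≤ (n : ℝ) ^ r := Real.rpow_nonneg (Nat.cast_nonneg n) r
  simp only [Function.comp, Real.norm_eq_abs] at hn
  rw [abs_of_nonneg hlog, abs_of_nonneg hpow, div_mul_eq_mul_div,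
    le_div_iff₀ (by positivity)] at hn
  nlinarith [le_abs_self A]

/-- Under density and root growth, `n p(n)` is at least a positive power of `n` up to a constant;
only logarithmic growth needs the lasso argument. -/
theorem NonSparse.superlog_or_log {p : ℕ → unitInterval} (hp : NonSparse p) :
    (∀ A : ℝ, ∀ᶠ n : ℕ in atTop, A * Real.log n ≤ n * (p n : ℝ)) ∨
    ∃ K : ℝ, 0 < K ∧ ∀ᶠ n : ℕ in atTop, (n : ℝ) * (p n : ℝ) = K * Real.log n := by
  rcases hp with ⟨p', hp', hlim⟩ | ⟨K, β, hK, hβ, hβ1, h⟩ | ⟨K, hK, h⟩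
  · refine Or.inl fun A => ?_
    filter_upwards [eventually_mul_log_le_mul_rpow one_pos (half_pos hp') A,
      hlim.eventually (lt_mem_nhds (half_lt_self hp'))] with n hn hpn
    rw [Real.rpow_one] at hn
    have := mul_le_mul_of_nonneg_right hpn.le (Nat.cast_nonneg (α := ℝ) n)
    linarith
  · refine Or.inl fun A => ?_
    filter_upwards [eventually_mul_log_le_mul_rpow (sub_pos.2 hβ1) hK A, h, eventually_gt_atTop 0]
      with n hn hpn hn0
    have hn0' : (0 : ℝ) < n := by exact_mod_cast hn0
    rw [hpn, mul_left_comm]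
    rw [sub_eq_add_neg, Real.rpow_add hn0', Real.rpow_one] at hn
    exact hn
  · refine Or.inr ⟨K, hK, ?_⟩
    filter_upwards [h, eventually_gt_atTop 0] with n hpn hn0
    have hn0' : (0 : ℝ) < n := by exact_mod_cast hn0
    rw [hpn, mul_div_cancel₀ _ hn0'.ne']

theorem tendsto_atTop_of_log_le {s : ℕ → ℝ} {K : ℝ} (hK : 0 < K)
    (h : ∀ᶠ n : ℕ in atTop, K * Real.log n ≤ s n) : Tendsto s atTop atTop :=
  tendsto_atTop_mono' _ h
    ((Real.tendsto_log_atTop.comp tendsto_natCast_atTop_atTop).const_mul_atTop hK)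

theorem Tame.isController {d k m : ℕ} {T : Type}
    {e : (Fin k → Feat d) → (Fin k → Fin m) → Feat d} (he : Tame e) (c : T → Fin k → Fin m) :
    IsController fun (a : Fin k → Feat d) (t : T) => e a (c t) := by
  obtain ⟨K, -, hK, -⟩ := he
  exact fun t => ⟨K, hK (c t)⟩

theorem exists_controller_binomialRandom {d : ℕ} (F : Measure (Feat d)) [IsProbabilityMeasure F]
    (hF : ∃ B : ℝ, ∀ᵐ x ∂F, ‖x‖ ≤ B) {p : ℕ → unitInterval} (hp : NonSparse p) (k : ℕ)
    (π : AggTerm d k) :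
    ∃ e : (Fin k → Feat d) → SimpleGraph (Fin k) → Feat d, IsController e ∧
      Approximates (fun n => withFeatures (SimpleGraph.binomialRandom (Fin n) (p n)) F)
        (fun _ G u => graphType G u) e π := by
  obtain ⟨L, rfl, hq, hlam⟩ := exists_localLimit (m := 1) F hF (fun _ => 1)
    (fun _ => zero_le_one) (by simp) (fun _ _ => 1) fun _ _ => zero_le_one
  obtain ⟨e, he, hD⟩ := L.exists_tame_approximated π
  obtain ⟨D, hD⟩ := hD.exists
  refine ⟨fun a _ => e a fun _ => 0, he.isController fun _ _ => 0, ?_⟩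
  simp_rw [binomialRandom_eq_inhomGraph]
  have hscale : Tendsto (fun n : ℕ => (n : ℝ) * (p n : ℝ)) atTop atTop := by
    rcases hp.superlog_or_log with h | ⟨K, hK, h⟩
    · exact tendsto_atTop_of_log_le one_pos (h 1)
    · exact tendsto_atTop_of_log_le hK (h.mono fun n hn => hn.ge)
  have hconv : L.Converges (fun n _ => p n) (fun _ _ => 0) fun n => n * (p n : ℝ) := by
    refine ⟨hscale, fun j => ?_, fun j r hr => ?_, Eventually.of_forall fun n b hb v => ?_⟩
    · rw [hq]
      refine tendsto_const_nhds.congr' ?_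
      filter_upwards [eventually_gt_atTop 0] with n hn
      have hn0' : (n : ℝ) ≠ 0 := by exact_mod_cast hn.ne'
      have : {v : Fin n | (0 : Fin 1) = j} = Set.univ :=
        Set.eq_univ_of_forall fun v => Subsingleton.elim _ _
      rw [this, Set.ncard_univ, Nat.card_fin, div_self hn0']
    -- The sum includes the irrelevant diagonal weight, so it equals the scale `n p(n)` exactly.
    · refine Eventually.of_forall fun n b => ?_
      rw [hlam, Subsingleton.elim j 0]
      simp only [Finset.filter_true, Finset.sum_const, Finset.card_univ, Fintype.card_fin,
        nsmul_eq_mul, mul_one, sub_self, abs_zero]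
      exact mul_nonneg hr.le (mul_nonneg (Nat.cast_nonneg n) (p n).2.1)
    · have := hb 0
      rw [hlam] at this
      exact absurd this one_ne_zero
  rcases hp.superlog_or_log with h | ⟨K, hK, h⟩
  · exact hconv.approximates_of_superlog h hD fun n G u a => by
      congr 1
  · exact hconv.approximates_of_log hK hK.le h (fun n => (p n).2.1) (fun n _ => le_rfl)
      (h.mono fun n hn => hn.le) (by simp [hlam]) hD fun n G u a => by
      congr 1

theorem sum_eq_one_of_tendsto {m : ℕ} (C : (n : ℕ) → Fin n → Fin m) (q : Fin m → ℝ)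
    (hC : ∀ j, Tendsto (fun n : ℕ => ({v : Fin n | C n v = j}.ncard : ℝ) / (n : ℝ))
      atTop (𝓝 (q j))) : ∑ j, q j = 1 := by
  have h1 := tendsto_finsetSum (Finset.univ : Finset (Fin m)) fun j _ => hC j
  refine tendsto_nhds_unique h1 (tendsto_const_nhds.congr' ?_)
  filter_upwards [eventually_gt_atTop 0] with n hn
  have hn0' : (n : ℝ) ≠ 0 := by exact_mod_cast hn.ne'
  rw [← Finset.sum_div, eq_div_iff hn0', one_mul]
  have h2 := Finset.card_eq_sum_card_fiberwise (f := C n) (s := Finset.univ)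
    (t := Finset.univ) fun _ _ => Finset.mem_coe.2 (Finset.mem_univ _)
  rw [Finset.card_univ, Fintype.card_fin] at h2
  have h3 : ∀ j, {v : Fin n | C n v = j}.ncard = (Finset.univ.filter fun v => C n v = j).card :=
    fun j => by rw [← Set.ncard_coe_finset]; simp
  simp_rw [h3]
  exact_mod_cast h2

theorem exists_controller_sbmGraph {d : ℕ} (F : Measure (Feat d)) [IsProbabilityMeasure F]
    (hF : ∃ B : ℝ, ∀ᵐ x ∂F, ‖x‖ ≤ B) {m : ℕ} (P : Fin m → Fin m → unitInterval)
    (hP : ∀ i j, P i j = P j i) (C : (n : ℕ) → Fin n → Fin m) (q : Fin m → ℝ)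
    (hC : ∀ j, Tendsto (fun n : ℕ => ({v : Fin n | C n v = j}.ncard : ℝ) / (n : ℝ))
      atTop (𝓝 (q j)))
    (hiso : ∀ j, ∑ l, q l * (P l j : ℝ) = 0 → ∀ i, P i j = 0) (k : ℕ) (π : AggTerm d k) :
    ∃ e : (Fin k → Feat d) → SimpleGraph (Fin k) × (Fin k → Fin m) → Feat d, IsController e ∧
      Approximates (fun n => withFeatures (sbmGraph P hP (C n)) F)
        (fun n G u => (graphType G u, fun i => C n (u i))) e π := by
  have hq0 : ∀ j, 0 ≤ q j := fun j =>
    ge_of_tendsto' (hC j) fun n => div_nonneg (Nat.cast_nonneg _) (Nat.cast_nonneg _)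
  have hq1 : ∑ j, q j = 1 := sum_eq_one_of_tendsto C q hC
  obtain ⟨L, hLF, hq, hlam⟩ := exists_localLimit F hF q hq0 (by rw [hq1]; exact one_pos)
    (fun i j => q j * P i j) fun i j => mul_nonneg (hq0 j) (P i j).2.1
  obtain ⟨e, he, hD⟩ := L.exists_tame_approximated π
  obtain ⟨D, hD⟩ := hD.exists
  have hc : IsController fun (a : Fin k → Feat d) (t : SimpleGraph (Fin k) × (Fin k → Fin m)) =>
      e a t.2 := he.isController fun t : SimpleGraph (Fin k) × (Fin k → Fin m) => t.2
  refine ⟨fun a t => e a t.2, hc, ?_⟩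
  -- At the linear scale `n`, a node of community `i` has about `n q_j P_ij` neighbours in community
  -- `j`. The assumption on vanishing columns, with the symmetry of `P`, excludes edges at nodes
  -- whose limit degree is zero.
  have hconv : L.Converges (fun n => Sym2.lift ⟨fun u v => P (C n u) (C n v),
      fun u v => hP (C n u) (C n v)⟩) C fun n => (n : ℝ) := by
    refine ⟨tendsto_natCast_atTop_atTop, fun j => by rw [hq]; exact hC j, fun j r hr => ?_,
      Eventually.of_forall fun n b hb v => ?_⟩
    · have := (Metric.tendsto_nhds.1 (hC j)) r hr
      filter_upwards [this, eventually_gt_atTop 0] with n hn hn0 b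
      have hn0' : (0 : ℝ) < n := by exact_mod_cast hn0
      have h1 : ∑ v with C n v = j, (P (C n b) (C n v) : ℝ) =
          ({v : Fin n | C n v = j}.ncard : ℝ) * P (C n b) j := by
        rw [Finset.sum_congr rfl fun v hv => by rw [(Finset.mem_filter.1 hv).2], Finset.sum_const,
          nsmul_eq_mul, ← Set.ncard_coe_finset]
        simp
      simp only [Sym2.lift_mk, hlam]
      rw [Real.dist_eq] at hn
      rw [h1]
      have h2 : ({v : Fin n | C n v = j}.ncard : ℝ) * P (C n b) j - n * (q j * P (C n b) j) =
          (({v : Fin n | C n v = j}.ncard : ℝ) / n - q j) * n * P (C n b) j := by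
        field_simp
      rw [h2, abs_mul, abs_mul, abs_of_pos hn0', abs_of_nonneg (P (C n b) j).2.1]
      refine (mul_le_of_le_one_right (by positivity) (P (C n b) j).2.2).trans ?_
      exact mul_le_mul_of_nonneg_right hn.le hn0'.le
    · rw [hlam] at hb
      have h1 : ∑ l, q l * (P l (C n b) : ℝ) = 0 :=
        Finset.sum_eq_zero fun l _ => by rw [hP]; exact hb l
      have h2 := hiso _ h1 (C n v)
      simp only [Sym2.lift_mk]
      rw [hP, h2]
      rfl
  rw [← hLF]
  refine hconv.approximates_of_superlog (fun A => ?_) hD fun n G u a => rfl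
  filter_upwards [eventually_mul_log_le_mul_rpow one_pos one_pos A] with n hn
  rwa [Real.rpow_one, one_mul] at hn

theorem mainTheorem2 {d : ℕ} (F : Measure (Feat d)) [IsProbabilityMeasure F]
    (hF : ∃ B : ℝ, ∀ᵐ x ∂F, ‖x‖ ≤ B) :
    (∀ p : ℕ → unitInterval, NonSparse p →
      ∀ (k : ℕ) (π : AggTerm d k),
        ∃ e : (Fin k → Feat d) → SimpleGraph (Fin k) → Feat d,
          IsController e ∧
          Approximates (fun n => withFeatures (SimpleGraph.binomialRandom (Fin n) (p n)) F)
            (fun _ G u => graphType G u) e π) ∧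
    (∀ (m : ℕ) (P : Fin m → Fin m → unitInterval) (hP : ∀ i j, P i j = P j i)
      (C : (n : ℕ) → Fin n → Fin m) (q : Fin m → ℝ),
      (∀ j, Tendsto (fun n : ℕ => ({v : Fin n | C n v = j}.ncard : ℝ) / (n : ℝ))
        atTop (𝓝 (q j))) →
      (∀ j, ∑ l, q l * (P l j : ℝ) = 0 → ∀ i, P i j = 0) →
      ∀ (k : ℕ) (π : AggTerm d k),
        ∃ e : (Fin k → Feat d) → SimpleGraph (Fin k) × (Fin k → Fin m) → Feat d,
          IsController e ∧
          Approximates (fun n => withFeatures (sbmGraph P hP (C n)) F)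
            (fun n G u => (graphType G u, fun i => C n (u i))) e π) :=
  ⟨fun _ hp k π => exists_controller_binomialRandom F hF hp k π,
    fun _ P hP C q hC hiso k π => exists_controller_sbmGraph F hF P hP C q hC hiso k π⟩
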